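/- Let $n\ge 2$ and let $\theta$ be a real antisymmetric $n\times n$ matrix with columns $\theta_1,\dots,\theta_n$. Let $\mathbb T^n=\mathbb R^n/2\pi\mathbb Z^n$, and let $A_\theta$ be the $C^*$-algebra of operators on $L^2(\mathbb T^n)$ (normalized measure $(2\pi)^{-n}dx$) generated by the unitaries $(U_jf)(x)=e^{ix_j}f(x+\pi\theta_j)$, $1\le j\le n$. Let $\tau(T)=\langle T1,1\rangle$, and let $\mathscr H_\theta$ be the Hilbert space obtained by completing $A_\theta$ with respect to the pre-inner product $\langle u,v\rangle=\tau(uv^*)$. Let $\alpha_s(T)=V_sTV_s^{-1}$ with $(V_sf)(x)=f(x+s)$, let $\mathscr A_\theta=\{u\in A_\theta:\ s\mapsto\alpha_s(u)\ \text{is}\ C^\infty\}$, let $\delta_j(u)=\frac1i\partial_{s_j}\alpha_s(u)|_{s=0}$ and $\delta^\alpha=\delta_1^{\alpha_1}\cdots\delta_n^{\alpha_n}$, and give $\mathscr A_\theta$ the Fréchet topology defined by the semi-norms $\|\delta^\alpha(u)\|$. For $q\in\mathbb C$, let $S^q(\mathbb R^n;\mathscr A_\theta)$ be the space of classical symbols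 of order $q$, i.e. of maps $\rho\in C^\infty(\mathbb R^n;\mathscr A_\theta)$ for which there are $\rho_{q-j}\in C^\infty(\mathbb R^n\setminus 0;\mathscr A_\theta)$, $j\geq 0$, homogeneous of degree $q-j$, such that for all $N,\alpha,\beta$ there is a constant $C$ with $\|\delta^\alpha\partial_\xi^\beta(\rho-\sum_{j<N}\rho_{q-j})(\xi)\|\le C|\xi|^{\Re q-N-|\beta|}$ for $|\xi|\ge1$. Let $\Psi^q(\mathscr A_\theta)$ be the set of linear operators $P:\mathscr A_\theta\to\mathscr A_\theta$ of the form $P=P_\rho$ with $\rho\in S^q(\mathbb R^n;\mathscr A_\theta)$, where $$P_\rho u=(2\pi)^{-n}\iint e^{is\cdot\xi}\rho(\xi)\alpha_{-s}(u)\,ds\,d\xi\qquad(u\in\mathscr A_\theta)$$ as an oscillating integral; such a $\rho$ is called a symbol of $P$. A symbol $\rho$ is called *normalized* when $\int_{\mathbb R^n}\rho(\xi)\,d\xi=\sum_{k\in\mathbb Z^n}\rho(k)$, both sides being convergent. A *Meyer-type function* is a Schwartz function $\phi:\mathbb R^n\to\mathbb C$ such that (i) $\phi(0)=1$ and $\phi(k)=0$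 for $k\in\mathbb Z^n\setminus0$; (ii) for every multi-order $\beta$ there is a Schwartz function $\phi_\beta$ with $\partial^\beta\phi=\overline\Delta^\beta\phi_\beta$, where $\overline\Delta^\beta=\overline\Delta_1^{\beta_1}\cdots\overline\Delta_n^{\beta_n}$ and $\overline\Delta_jf(\xi)=f(\xi)-f(\xi-e_j)$; (iii) $\int\phi(\xi)\,d\xi=1$. Let $P\in\Psi^q(\mathscr A_\theta)$ with $\Re q<-n$. Then: 1. Meyer-type functions exist, and for every Meyer-type function $\phi$ and every symbol $\rho\in S^q(\mathbb R^n;\mathscr A_\theta)$ of $P$, the series $\tilde\rho(\xi)=\sum_{k\in\mathbb Z^n}\phi(\xi-k)\rho(k)$ converges for all $\xi$ and defines a normalized symbol $\tilde\rho\in S^q(\mathbb R^n;\mathscr A_\theta)$ of $P$. In particular, $P$ admits a normalized symbol in $S^q(\mathbb R^n;\mathscr A_\theta)$. 2. $P$ extends uniquely to a bounded operator on $\mathscr H_\theta$, this extension is trace-class, and for every normalized symbol $\rho\in S^q(\mathbb R^n;\mathscr A_\theta)$ of $P$, the function $\tau[\rho(\xi)]$ is integrable and $$\operatorname{Trace}(P)=\int_{\mathbb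 R^n}\tau[\rho(\xi)]\,d\xi .$$ -/

import Mathlib

open MeasureTheory Filter Topology Real
open scoped ContDiff SchwartzMap Matrix ENNReal

noncomputable section

namespace NCTorus

/-! ## Multi-index calculus on `ℝⁿ` -/

/-- `ℝⁿ` with its Euclidean norm and Lebesgue measure. -/
abbrev E (n : ℕ) : Type := EuclideanSpace ℝ (Fin n)

/-- The canonical basis vector `e_j` of `ℝⁿ`. -/
def basisVec {n : ℕ} (j : Fin n) : E n := EuclideanSpace.single j (1 : ℝ)

/-- The inclusion of `ℤⁿ` into `ℝⁿ`. -/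
def latt {n : ℕ} (k : Fin n → ℤ) : E n := WithLp.toLp 2 fun i => (k i : ℝ)

/-- For operators `D₁, …, Dₙ` on `X` and a multi-order `β`, the composite `D₁^{β₁} ⋯ Dₙ^{βₙ}`. -/
def multiPow {n : ℕ} {X : Type*} (D : Fin n → X → X) (β : Fin n → ℕ) (x : X) : X :=
  (List.finRange n).foldr (fun j y => (D j)^[β j] y) x

/-- The partial derivative `∂_{ξ_j} f`. -/
def partialD {n : ℕ} (j : Fin n) (f : E n → ℂ) : E n → ℂ :=
  fun ξ => lineDeriv ℝ f ξ (basisVec j)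

/-- The backward difference `f(ξ) - f(ξ - e_j)`. -/
def backDiff {n : ℕ} (j : Fin n) (f : E n → ℂ) : E n → ℂ :=
  fun ξ => f ξ - f (ξ - basisVec j)

/-- The Meyer-type interpolating functions: Schwartz functions `φ` with `φ(0) = 1` and `φ(k) = 0`
for `k ∈ ℤⁿ \ 0`, all of whose partial derivatives `∂^β φ` are iterated backward differences
of Schwartz functions, and which have integral one. -/
structure IsMeyer {n : ℕ} (φ : 𝓢(E n, ℂ)) : Prop where
  map_zero : φ 0 = 1
  map_latt : ∀ k : Fin n → ℤ, k ≠ 0 → φ (latt k) = 0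
  derivs : ∀ β : Fin n → ℕ, ∃ ψ : 𝓢(E n, ℂ),
    multiPow partialD β (φ : E n → ℂ) = multiPow backDiff β (ψ : E n → ℂ)
  integral_eq : ∫ ξ, φ ξ = 1

/-! ## The noncommutative torus -/

instance instFactTwoPi : Fact (0 < 2 * π) := ⟨two_pi_pos⟩

/-- The ordinary torus `𝕋ⁿ = ℝⁿ / 2πℤⁿ`. -/
abbrev Torus (n : ℕ) : Type := Fin n → AddCircle (2 * π)

/-- The normalized Lebesgue measure `(2π)⁻ⁿ dx` on `𝕋ⁿ`. -/
abbrev torusMeasure (n : ℕ) : Measure (Torus n) :=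
  Measure.pi fun _ => (AddCircle.haarAddCircle : Measure (AddCircle (2 * π)))

/-- `L²(𝕋ⁿ)`. -/
abbrev L2 (n : ℕ) : Type := Lp ℂ 2 (torusMeasure n)

/-- The bounded operators on `L²(𝕋ⁿ)`; the involution is the adjoint. -/
abbrev B (n : ℕ) : Type := L2 n →L[ℂ] L2 n

/-- Translation on `L²(𝕋ⁿ)`: `ξ ↦ ξ(· + a)`. -/
def translate {n : ℕ} (a : Torus n) : B n :=
  (Lp.compMeasurePreservingₗᵢ (p := 2) (μ := torusMeasure n) (μb := torusMeasure n) (E := ℂ) ℂ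
    (fun x => x + a) (measurePreserving_add_right (torusMeasure n) a)).toContinuousLinearMap

/-- The function `e^{i x_j}` on `𝕋ⁿ`. -/
def expCoord {n : ℕ} (j : Fin n) : C(Torus n, ℂ) where
  toFun x := fourier 1 (x j)
  continuous_toFun := by fun_prop

/-- Multiplication by a continuous function on `L²(𝕋ⁿ)`. -/
def mulOp {n : ℕ} (f : C(Torus n, ℂ)) : B n :=
  (ContinuousLinearMap.mul ℂ ℂ).holderL (torusMeasure n) ∞ 2 2
    (ContinuousMap.toLp ∞ (torusMeasure n) ℂ f)

/-- `(U_j ξ)(x) = e^{i x_j} ξ(x + π θ_j)`, where `θ_j` is the `j`-th column of `θ`. -/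
def U {n : ℕ} (θ : Matrix (Fin n) (Fin n) ℝ) (j : Fin n) : B n :=
  mulOp (expCoord j) ∘L translate fun i => ((π * θ i j : ℝ) : AddCircle (2 * π))

/-- The noncommutative torus `A_θ`: the `C*`-algebra generated by `U₁, …, Uₙ`. -/
def A {n : ℕ} (θ : Matrix (Fin n) (Fin n) ℝ) : StarSubalgebra ℂ (B n) :=
  (StarAlgebra.adjoin ℂ (Set.range (U θ))).topologicalClosure

/-- The constant function `1` in `L²(𝕋ⁿ)`. -/
def oneL2 (n : ℕ) : L2 n := Lp.const 2 (torusMeasure n) (1 : ℂ)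

/-- The state `τ(T) = ⟨T1, 1⟩` (Mathlib's inner products are linear in the second variable). -/
def τ {n : ℕ} (T : B n) : ℂ := inner ℂ (oneL2 n) (T (oneL2 n))

/-- The unitary `V_s` on `L²(𝕋ⁿ)`: `(V_s ξ)(x) = ξ(x + s)`. -/
def V {n : ℕ} (s : E n) : B n := translate fun i => ((s i : ℝ) : AddCircle (2 * π))

/-- `V_{-s}` is the inverse of `V_s`. -/
theorem V_mul_V_neg {n : ℕ} (s : E n) : V s * V (-s) = 1 := by
  ext1 f
  change Lp.compMeasurePreserving _ _ (Lp.compMeasurePreserving _ _ f) = f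
  have h := measurePreserving_add_right (torusMeasure n)
  rw [← Lp.compMeasurePreserving_comp_apply f (h _) (h _)]
  convert Lp.compMeasurePreserving_id_apply f using 2
  congr 1
  ext x i
  simp

/-- The action `α_s(T) = V_s T V_s⁻¹`. -/
def act {n : ℕ} (s : E n) (T : B n) : B n := V s * T * V (-s)

/-- `δ_j(u) = (1/i) ∂_{s_j} α_s(u)` at `s = 0`. -/
def delta {n : ℕ} (j : Fin n) (u : B n) : B n :=
  (-Complex.I) • deriv (fun t : ℝ => act (t • basisVec j) u) 0

/-- `δ^β = δ₁^{β₁} ⋯ δₙ^{βₙ}`. -/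
def deltaPow {n : ℕ} (β : Fin n → ℕ) (u : B n) : B n := multiPow delta β u

/-- The smooth noncommutative torus `𝒜_θ`: the `u ∈ A_θ` such that `s ↦ α_s(u)` is smooth. -/
def SA {n : ℕ} (θ : Matrix (Fin n) (Fin n) ℝ) : Submodule ℂ (B n) where
  carrier := {u | u ∈ A θ ∧ ContDiff ℝ ∞ fun s : E n => act s u}
  zero_mem' := ⟨zero_mem _, by simpa [act] using contDiff_const⟩
  add_mem' := by
    rintro u v ⟨hu, hu'⟩ ⟨hv, hv'⟩
    exact ⟨add_mem hu hv, by simpa [act, mul_add, add_mul] using hu'.add hv'⟩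
  smul_mem' := by
    rintro c u ⟨hu, hu'⟩
    exact ⟨SMulMemClass.smul_mem c hu, by simpa [act] using hu'.const_smul c⟩

/-! ## The Hilbert space `ℋ_θ` -/

/-- A copy of `A_θ`, to carry the pre-inner product `⟨u, v⟩ = τ(u v*)`. -/
def PreH {n : ℕ} (θ : Matrix (Fin n) (Fin n) ℝ) : Type := A θ

instance {n : ℕ} (θ : Matrix (Fin n) (Fin n) ℝ) : AddCommGroup (PreH θ) :=
  inferInstanceAs (AddCommGroup (A θ))

instance {n : ℕ} (θ : Matrix (Fin n) (Fin n) ℝ) : Module ℂ (PreH θ) :=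
  inferInstanceAs (Module ℂ (A θ))

/-- The identity map from `A_θ` to its copy `PreH θ`. -/
def toPreH {n : ℕ} (θ : Matrix (Fin n) (Fin n) ℝ) : A θ ≃ₗ[ℂ] PreH θ := LinearEquiv.refl ℂ _

/-- The underlying operator of an element of `PreH θ`. -/
def PreH.val {n : ℕ} {θ : Matrix (Fin n) (Fin n) ℝ} (u : PreH θ) : B n :=
  ((toPreH θ).symm u : A θ)

/-- The sesquilinear form `⟨u, v⟩ = τ(u v*)` on `A_θ`, linear in `u`. In Mathlib's convention
this is `inner v u`. -/
abbrev preInner {n : ℕ} (θ : Matrix (Fin n) (Fin n) ℝ) : PreInnerProductSpace.Core ℂ (PreH θ) where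
  inner v u := τ (u.val * star v.val)
  conj_inner_symm x y := by
    simp only [τ, inner_conj_symm]
    rw [show y.val * star x.val = star (x.val * star y.val) by simp,
      ContinuousLinearMap.star_eq_adjoint (x.val * star y.val),
      ContinuousLinearMap.adjoint_inner_right]
  re_inner_nonneg x := by
    simp only [τ, ContinuousLinearMap.star_eq_adjoint]
    change 0 ≤ RCLike.re (inner ℂ (oneL2 n) (x.val (ContinuousLinearMap.adjoint x.val (oneL2 n))))
    rw [← ContinuousLinearMap.adjoint_inner_left]
    exact inner_self_nonneg
  add_left x y z := by
    simp [τ, PreH.val, mul_add, inner_add_right]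
  smul_left x y r := by
    simp [τ, PreH.val, inner_smul_right]

instance {n : ℕ} (θ : Matrix (Fin n) (Fin n) ℝ) : SeminormedAddCommGroup (PreH θ) :=
  InnerProductSpace.Core.toSeminormedAddCommGroup (c := preInner θ)

instance {n : ℕ} (θ : Matrix (Fin n) (Fin n) ℝ) : InnerProductSpace ℂ (PreH θ) :=
  InnerProductSpace.ofCore (preInner θ)

/-- The Hilbert space `ℋ_θ`, the completion for the pre-inner product `⟨u, v⟩ = τ(u v*)`.
(Completing `A_θ` or the dense linear span of the monomials in the `U_j` is the same, because
`τ(u u*) ≤ ‖u‖²`.) -/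
abbrev H {n : ℕ} (θ : Matrix (Fin n) (Fin n) ℝ) : Type := UniformSpace.Completion (PreH θ)

/-- The inclusion of `𝒜_θ` into `ℋ_θ`. -/
def toH {n : ℕ} {θ : Matrix (Fin n) (Fin n) ℝ} (u : SA θ) : H θ :=
  ((toPreH θ ⟨u.1, u.2.1⟩ : PreH θ) : H θ)

/-- `T ∈ ℒ(ℋ_θ)` extends the linear operator `P` on `𝒜_θ`. -/
def Extends {n : ℕ} {θ : Matrix (Fin n) (Fin n) ℝ} (T : H θ →L[ℂ] H θ)
    (P : SA θ →ₗ[ℂ] SA θ) : Prop :=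
  ∀ u : SA θ, T (toH u) = toH (P u)

/-! ## Trace-class operators -/

/-- The characteristic value `μ_k(T) = inf {‖T|_{F^⊥}‖ ; dim F = k}`: for compact `T` this is the
`(k+1)`-th eigenvalue of `|T|`, by the min-max principle. -/
def charValue {K : Type*} [NormedAddCommGroup K] [InnerProductSpace ℂ K]
    (T : K →L[ℂ] K) (k : ℕ) : ℝ :=
  ⨅ F : {F : Submodule ℂ K // FiniteDimensional ℂ F ∧ Module.finrank ℂ F = k},
    ‖T ∘L (F.1ᗮ).subtypeL‖

/-- Trace-class operators: compact operators with summable characteristic values. -/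
def IsTraceClass {K : Type*} [NormedAddCommGroup K] [InnerProductSpace ℂ K]
    (T : K →L[ℂ] K) : Prop :=
  IsCompactOperator T ∧ Summable (charValue T)

/-- `T` is trace-class with `Trace(T) = z`: for any orthonormal basis `(e_i)` we have
`∑ ⟨T e_i, e_i⟩ = z`. -/
def HasTrace {K : Type*} [NormedAddCommGroup K] [InnerProductSpace ℂ K]
    (T : K →L[ℂ] K) (z : ℂ) : Prop :=
  IsTraceClass T ∧ ∀ (ι : Type) (e : HilbertBasis ι ℂ K),
    HasSum (fun i => (inner ℂ (e i) (T (e i)) : ℂ)) z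

/-! ## Classical symbols -/

/-- `ρ ∈ C^∞(Ω; 𝒜_θ)` for `Ω ⊆ ℝⁿ` open. The Fréchet topology of `𝒜_θ` is given by the norms
`‖δ^α(u)‖`, so that `ρ` is smooth into `𝒜_θ` when it takes values in `𝒜_θ` and every
`δ^α(ρ(ξ))` is smooth for the norm of `A_θ`. -/
def IsSmoothOn {n : ℕ} (θ : Matrix (Fin n) (Fin n) ℝ) (Ω : Set (E n)) (ρ : E n → B n) : Prop :=
  (∀ ξ ∈ Ω, ρ ξ ∈ SA θ) ∧ ∀ α : Fin n → ℕ, ContDiffOn ℝ ∞ (fun ξ => deltaPow α (ρ ξ)) Ω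

/-- `S_q(ℝⁿ; 𝒜_θ)`: smooth maps from `ℝⁿ \ 0` to `𝒜_θ` homogeneous of degree `q`. The value
at the origin is irrelevant. -/
def IsHomogeneousSymbol {n : ℕ} (θ : Matrix (Fin n) (Fin n) ℝ) (q : ℂ) (ρ : E n → B n) : Prop :=
  IsSmoothOn θ {0}ᶜ ρ ∧
    ∀ ξ : E n, ξ ≠ 0 → ∀ r : ℝ, 0 < r → ρ (r • ξ) = ((r : ℂ) ^ q) • ρ ξ

/-- `S^q(ℝⁿ; 𝒜_θ)`: smooth maps from `ℝⁿ` to `𝒜_θ` with an expansion `ρ ∼ ∑ ρ_{q-j}`, where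
`ρ_{q-j} ∈ S_{q-j}(ℝⁿ; 𝒜_θ)`, i.e. for all `N`, `α` and all orders `b` of differentiation in `ξ`,
`‖δ^α ∂_ξ^β (ρ - ∑_{j<N} ρ_{q-j})(ξ)‖ ≤ C |ξ|^{Re q - N - b}` for `|β| = b` and `|ξ| ≥ 1`. -/
def IsClassicalSymbol {n : ℕ} (θ : Matrix (Fin n) (Fin n) ℝ) (q : ℂ) (ρ : E n → B n) : Prop :=
  IsSmoothOn θ Set.univ ρ ∧
    ∃ σ : ℕ → E n → B n, (∀ j : ℕ, IsHomogeneousSymbol θ (q - j) (σ j)) ∧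
      ∀ (N : ℕ) (α : Fin n → ℕ) (b : ℕ), ∃ C : ℝ, ∀ ξ : E n, 1 ≤ ‖ξ‖ →
        ‖iteratedFDeriv ℝ b (fun η => deltaPow α (ρ η - ∑ j ∈ Finset.range N, σ j η)) ξ‖
          ≤ C * ‖ξ‖ ^ (q.re - N - b)

/-- A symbol is normalized when `∫ ρ(ξ) dξ = ∑_{k ∈ ℤⁿ} ρ(k)`, the integral and the series being
convergent. -/
def IsNormalized {n : ℕ} (ρ : E n → B n) : Prop :=
  Integrable ρ ∧ HasSum (fun k : Fin n → ℤ => ρ (latt k)) (∫ ξ, ρ ξ)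

/-- The interpolation `ρ̃(ξ) = ∑_{k ∈ ℤⁿ} φ(ξ - k) ρ(k)`. -/
def interpolate {n : ℕ} (φ : 𝓢(E n, ℂ)) (ρ : E n → B n) : E n → B n :=
  fun ξ => ∑' k : Fin n → ℤ, φ (ξ - latt k) • ρ (latt k)

/-! ## Pseudodifferential operators -/

/-- The oscillating integral `(2π)⁻ⁿ ∬ e^{i s·ξ} a(s, ξ) ds dξ` exists and is equal to `v`: for
every cut-off `χ ∈ C_c^∞(ℝⁿ × ℝⁿ)` with `χ(0, 0) = 1`, the absolutely convergent integrals
`(2π)⁻ⁿ ∬ e^{i s·ξ} χ(εs, εξ) a(s, ξ) ds dξ` converge to `v` as `ε → 0⁺`. -/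
def IsOscIntegral {n : ℕ} (a : E n → E n → B n) (v : B n) : Prop :=
  ∀ χ : E n × E n → ℂ, ContDiff ℝ ∞ χ → HasCompactSupport χ → χ 0 = 1 →
    Tendsto (fun ε : ℝ => ((2 * π : ℂ) ^ n)⁻¹ •
        ∫ p : E n × E n,
          (Complex.exp (Complex.I * (inner ℝ p.1 p.2 : ℝ)) * χ (ε • p)) • a p.1 p.2)
      (𝓝[>] 0) (𝓝 v)

/-- `P = P_ρ`, i.e. `P u = (2π)⁻ⁿ ∬ e^{i s·ξ} ρ(ξ) α_{-s}(u) ds dξ` for all `u ∈ 𝒜_θ`. -/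
def IsSymbolOf {n : ℕ} {θ : Matrix (Fin n) (Fin n) ℝ} (ρ : E n → B n)
    (P : SA θ →ₗ[ℂ] SA θ) : Prop :=
  ∀ u : SA θ, IsOscIntegral (fun s ξ => ρ ξ * act (-s) (u : B n)) (P u : B n)

/-- `Ψ^q(𝒜_θ)`: the operators `P_ρ` with `ρ ∈ S^q(ℝⁿ; 𝒜_θ)`. -/
def PsiDO {n : ℕ} (θ : Matrix (Fin n) (Fin n) ℝ) (q : ℂ) : Set (SA θ →ₗ[ℂ] SA θ) :=
  {P | ∃ ρ : E n → B n, IsClassicalSymbol θ q ρ ∧ IsSymbolOf ρ P}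

end NCTorus

end

/-!
If `φ` is a Meyer-type function and `p` a polynomial, summation by parts against
`∂^β φ = Δ̄^β φ_β` kills the high derivatives of `∑ φ(ξ - k) p(k)`, which is therefore a polynomial
in each coordinate; as it agrees with `p` on `ℤⁿ`, it is `p(ξ)`. Taylor's formula at `ξ` then shows
that `ρ̃ - ρ` decays rapidly together with its derivatives: `ρ̃` is a classical symbol with the same
expansion as `ρ`, and it agrees with `ρ` on `ℤⁿ`. Integrating termwise, `∫ φ = 1` makes `ρ̃`
normalized.

The oscillating integral gives `P W_k = ρ(k) W_k` on the Weyl unitaries `W_k`, which span a dense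
subspace of `𝒜_θ`; hence `P` depends only on the restriction of `ρ` to `ℤⁿ`, and `ρ̃` is again a
symbol of `P`. Since the `W_k` form an orthonormal basis of `ℋ_θ`, the extension of `P` is the sum
of rank-one operators `∑ ⟨W_k, ·⟩ P W_k`, which is norm convergent as `Re q < -n`. On the
orthogonal complement of the `W_k` with `k` in a cube of `K` lattice points, a Schur test bounds it
by `C K^{Re q / n}`, so its characteristic values are summable. Its trace is
`∑ ⟨W_k, P W_k⟩ = ∑ τ(ρ(k))`, and this is `∫ τ(ρ)` when `ρ` is normalized.
-/

noncomputable section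

namespace NCTorus

open scoped LineDeriv FourierTransform

variable {n : ℕ}

/-! ### Sums over the lattice -/

@[simp] lemma latt_apply (k : Fin n → ℤ) (i : Fin n) : latt k i = k i := rfl

lemma latt_sub (k l : Fin n → ℤ) : latt (k - l) = latt k - latt l := by
  ext i; simp

@[simp] lemma latt_zero : latt (0 : Fin n → ℤ) = 0 := by
  ext i; simp

lemma latt_injective : Function.Injective (latt : (Fin n → ℤ) → E n) := by
  intro k l h
  ext i
  simpa using congrArg (fun x : E n => x i) h

lemma latt_single (j : Fin n) : latt (Pi.single j 1) = basisVec j := by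
  ext i
  by_cases h : i = j
  · subst h; simp [basisVec]
  · simp [basisVec, h]

lemma eq_sum_smul_basisVec (x : E n) : x = ∑ j, x j • basisVec j := by
  ext i
  simp [basisVec, Finset.sum_apply, Pi.single_apply]

lemma latt_mem_span (k : Fin n → ℤ) :
    latt k ∈ Submodule.span ℤ (Set.range (EuclideanSpace.basisFun (Fin n) ℝ).toBasis) := by
  rw [eq_sum_smul_basisVec (latt k)]
  refine Submodule.sum_mem _ fun i _ => ?_
  rw [latt_apply, Int.cast_smul_eq_zsmul]
  exact Submodule.smul_mem _ _ (Submodule.subset_span ⟨i, by simp [basisVec]⟩)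

lemma summable_one_add_norm_latt_rpow {r : ℝ} (hr : n < r) :
    Summable fun k : Fin n → ℤ => (1 + ‖latt k‖) ^ (-r) := by
  set L := Submodule.span ℤ (Set.range (EuclideanSpace.basisFun (Fin n) ℝ).toBasis)
  have hrank : Module.finrank ℤ L = n := by
    rw [ZLattice.rank ℝ L]; simp
  have hL : Summable fun z : L => ‖z‖ ^ (-r) :=
    ZLattice.summable_norm_rpow L (-r) (by rw [hrank]; linarith)
  have hlatt : Summable fun k : Fin n → ℤ => ‖latt k‖ ^ (-r) :=
    hL.comp_injective (i := fun k : Fin n → ℤ => (⟨latt k, latt_mem_span k⟩ : L))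
      fun k l h => latt_injective (congrArg Subtype.val h)
  refine hlatt.of_norm_bounded_eventually ?_
  filter_upwards [(Set.finite_singleton (0 : Fin n → ℤ)).compl_mem_cofinite] with k hk
  have hk0 : 0 < ‖latt k‖ := by
    rw [norm_pos_iff, ← latt_zero]
    exact latt_injective.ne hk
  have hr0 : 0 < r := (Nat.cast_nonneg n).trans_lt hr
  rw [Real.norm_of_nonneg (by positivity)]
  exact Real.rpow_le_rpow_of_nonpos hk0 (le_add_of_nonneg_left zero_le_one) (neg_nonpos.2 hr0.le)

/-- **Peetre's inequality**. -/
lemma one_add_norm_add_rpow_neg_le {X : Type*} [SeminormedAddCommGroup X] {s : ℝ} (hs : 0 ≤ s)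
    (x v : X) : (1 + ‖x + v‖) ^ (-s) ≤ (1 + ‖x‖) ^ (-s) * (1 + ‖v‖) ^ s := by
  have hx : 1 + ‖x‖ ≤ (1 + ‖x + v‖) * (1 + ‖v‖) := by
    have : ‖x‖ ≤ ‖x + v‖ + ‖v‖ := by simpa using norm_sub_le (x + v) v
    nlinarith [norm_nonneg (x + v), norm_nonneg v]
  have hpow := Real.rpow_le_rpow (by positivity) hx hs
  rw [Real.mul_rpow (by positivity) (by positivity)] at hpow
  rwa [Real.rpow_neg (by positivity), Real.rpow_neg (by positivity), ← div_eq_inv_mul,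
    inv_le_comm₀ (by positivity) (by positivity), inv_div, div_le_iff₀ (by positivity)]

lemma norm_sub_latt_floor_le (ξ : E n) : ‖ξ - latt fun i => ⌊ξ i⌋‖ ≤ √n := by
  rw [EuclideanSpace.norm_eq]
  apply Real.sqrt_le_sqrt
  calc ∑ i, ‖(ξ - latt fun i => ⌊ξ i⌋) i‖ ^ 2 ≤ ∑ _i : Fin n, (1 : ℝ) := by
        refine Finset.sum_le_sum fun i _ => ?_
        simp only [PiLp.sub_apply, latt_apply, Real.norm_eq_abs, sq_abs]
        nlinarith [Int.floor_le (ξ i), Int.lt_floor_add_one (ξ i)]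
    _ = n := by simp

lemma succ_le_norm_latt_of_notMem_piFinset {R : ℕ} {l : Fin n → ℤ}
    (hl : l ∉ Fintype.piFinset fun _ => Finset.Icc (-(R : ℤ)) R) : R + 1 ≤ ‖latt l‖ := by
  obtain ⟨i, hi⟩ : ∃ i, l i ∉ Finset.Icc (-(R : ℤ)) R := by
    simpa only [Fintype.mem_piFinset, not_forall] using hl
  have habs : (R : ℤ) + 1 ≤ |l i| := by
    rw [Finset.mem_Icc, ← abs_le, not_le] at hi
    omega
  calc (R : ℝ) + 1 ≤ |(l i : ℝ)| := by exact_mod_cast habs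
    _ ≤ ‖latt l‖ := by simpa using PiLp.norm_apply_le (latt l) i

lemma exists_finset_card_eq_le_norm_latt (hn : n ≠ 0) {k : ℕ} (hk : k ≠ 0) :
    ∃ s : Finset (Fin n → ℤ), s.card = k ∧
      ∀ l ∉ s, (k : ℝ) ^ (n : ℝ)⁻¹ / 2 ≤ 1 + ‖latt l‖ := by
  have : Nonempty (Fin n) := ⟨⟨0, Nat.pos_of_ne_zero hn⟩⟩
  let x : ℝ := (k : ℝ) ^ (n : ℝ)⁻¹
  have hx : 1 ≤ x := Real.one_le_rpow (by exact_mod_cast Nat.one_le_iff_ne_zero.2 hk)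
    (by positivity)
  let R : ℕ := ⌊(x - 1) / 2⌋₊
  have hR_le : (R : ℝ) ≤ (x - 1) / 2 := Nat.floor_le (by linarith)
  have hR_lt : (x - 1) / 2 < R + 1 := Nat.lt_floor_add_one _
  let Q : Finset (Fin n → ℤ) := Fintype.piFinset fun _ => Finset.Icc (-(R : ℤ)) R
  have hQ_card : Q.card = (2 * R + 1) ^ n := by
    simp only [Q, Fintype.card_piFinset, Int.card_Icc, Finset.prod_const, Finset.card_univ,
      Fintype.card_fin]
    congr 1
    omega
  have hQ : (Q.card : ℝ) ≤ k := by
    rw [hQ_card, ← Real.rpow_inv_natCast_pow k.cast_nonneg hn, Nat.cast_pow]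
    gcongr
    push_cast
    linarith
  obtain ⟨s, hQs, hs⟩ := Infinite.exists_superset_card_eq Q k (by exact_mod_cast hQ)
  refine ⟨s, hs, fun l hl => ?_⟩
  have := succ_le_norm_latt_of_notMem_piFinset (mt (@hQs l) hl)
  change x / 2 ≤ _
  linarith

lemma exists_tsum_one_add_norm_sub_latt_rpow_le {r : ℝ} (hr : n < r) :
    ∃ C : ℝ, ∀ ξ : E n, (Summable fun k : Fin n → ℤ => (1 + ‖ξ - latt k‖) ^ (-r)) ∧
      ∑' k : Fin n → ℤ, (1 + ‖ξ - latt k‖) ^ (-r) ≤ C := by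
  have hr0 : 0 ≤ r := (Nat.cast_nonneg n).trans hr.le
  refine ⟨(∑' k : Fin n → ℤ, (1 + ‖latt k‖) ^ (-r)) * (1 + √n) ^ r, fun ξ => ?_⟩
  let k₀ : Fin n → ℤ := fun i => ⌊ξ i⌋
  have hle (k : Fin n → ℤ) : (1 + ‖ξ - latt k‖) ^ (-r) ≤
      (1 + ‖latt (k₀ - k)‖) ^ (-r) * (1 + √n) ^ r := by
    have h := one_add_norm_add_rpow_neg_le hr0 (latt (k₀ - k)) (ξ - latt k₀)
    rw [show latt (k₀ - k) + (ξ - latt k₀) = ξ - latt k by rw [latt_sub]; abel] at h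
    refine h.trans ?_
    gcongr
    exact norm_sub_latt_floor_le ξ
  have hsum : Summable fun k : Fin n → ℤ => (1 + ‖latt (k₀ - k)‖) ^ (-r) * (1 + √n) ^ r :=
    (((Equiv.subLeft k₀).summable_iff (f := fun k => (1 + ‖latt k‖) ^ (-r))).2
      (summable_one_add_norm_latt_rpow hr)).mul_right _
  have hsum' := hsum.of_nonneg_of_le (fun k => by positivity) hle
  refine ⟨hsum', (hsum'.tsum_le_tsum hle hsum).trans_eq ?_⟩
  rw [tsum_mul_right]
  congr 1
  exact (Equiv.subLeft k₀).tsum_eq fun k => (1 + ‖latt k‖) ^ (-r)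

section SchwartzDecay

variable {X F G : Type*} [NormedAddCommGroup X] [NormedSpace ℝ X] [NormedAddCommGroup F]
  [NormedSpace ℝ F]

lemma exists_norm_iteratedFDeriv_schwartz_le (ψ : 𝓢(X, F)) (b : ℕ) (r : ℝ) :
    ∃ C : ℝ, 0 ≤ C ∧ ∀ x, ‖iteratedFDeriv ℝ b ψ x‖ ≤ C * (1 + ‖x‖) ^ (-r) := by
  obtain ⟨m, hm⟩ := exists_nat_ge r
  refine ⟨2 ^ m * ((Finset.Iic (m, b)).sup fun p => SchwartzMap.seminorm ℝ p.1 p.2) ψ,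
    by positivity, fun x => ?_⟩
  have hseminorm :=
    SchwartzMap.one_add_le_sup_seminorm_apply (𝕜 := ℝ) (m := (m, b)) le_rfl le_rfl ψ x
  have hpow : (1 + ‖x‖) ^ r ≤ (1 + ‖x‖) ^ m := by
    rw [← Real.rpow_natCast]
    exact Real.rpow_le_rpow_of_exponent_le (by simp) hm
  rw [Real.rpow_neg (by positivity), ← div_eq_mul_inv, le_div_iff₀ (by positivity), mul_comm]
  exact (mul_le_mul_of_nonneg_right hpow (norm_nonneg _)).trans hseminorm

lemma exists_norm_schwartz_le (ψ : 𝓢(X, F)) (r : ℝ) :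
    ∃ C : ℝ, 0 ≤ C ∧ ∀ x, ‖ψ x‖ ≤ C * (1 + ‖x‖) ^ (-r) := by
  simpa only [norm_iteratedFDeriv_zero] using exists_norm_iteratedFDeriv_schwartz_le ψ 0 r

lemma exists_summable_bound_schwartz_sub_latt [SeminormedAddCommGroup G] (ψ : 𝓢(E n, F))
    {p : (Fin n → ℤ) → G} {c d : ℝ} (hp : ∀ k, ‖p k‖ ≤ c * (1 + ‖latt k‖) ^ d) (R : ℝ) :
    ∃ u : (Fin n → ℤ) → ℝ, Summable u ∧ ∀ ξ : E n, ‖ξ‖ ≤ R → ∀ k,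
      ‖ψ (ξ - latt k)‖ * ‖p k‖ ≤ u k := by
  let s : ℝ := max (d + (n + 1)) 0
  have hs : 0 ≤ s := le_max_right _ _
  obtain ⟨C, hC, hψ⟩ := exists_norm_schwartz_le ψ s
  have hc : 0 ≤ c := by simpa using (norm_nonneg _).trans (hp 0)
  refine ⟨fun k => C * (1 + R) ^ s * c * (1 + ‖latt k‖) ^ (-((n : ℝ) + 1)),
    (summable_one_add_norm_latt_rpow (by linarith)).mul_left _, fun ξ hξ k => ?_⟩
  have hR : 0 ≤ R := (norm_nonneg _).trans hξ
  have hpeetre := one_add_norm_add_rpow_neg_le hs (-latt k) ξ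
  rw [neg_add_eq_sub, norm_neg] at hpeetre
  have hexp : -s + d ≤ -((n : ℝ) + 1) := by linarith [le_max_left (d + ((n : ℝ) + 1)) 0]
  calc ‖ψ (ξ - latt k)‖ * ‖p k‖
      ≤ (C * ((1 + ‖latt k‖) ^ (-s) * (1 + R) ^ s)) * (c * (1 + ‖latt k‖) ^ d) := by
        refine mul_le_mul ((hψ _).trans ?_) (hp k) (norm_nonneg _) (by positivity)
        refine mul_le_mul_of_nonneg_left (hpeetre.trans ?_) hC
        gcongr
    _ = C * (1 + R) ^ s * c * (1 + ‖latt k‖) ^ (-s + d) := by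
        rw [Real.rpow_add (by positivity)]; ring
    _ ≤ C * (1 + R) ^ s * c * (1 + ‖latt k‖) ^ (-((n : ℝ) + 1)) := by
        gcongr
        linarith [norm_nonneg (latt k)]

end SchwartzDecay

/-! ### Polynomial reproduction by Meyer-type functions -/

lemma exists_polynomial_derivative_eq {K : Type*} [Field K] [CharZero K] (P : Polynomial K) :
    ∃ Q : Polynomial K, Q.derivative = P := by
  induction P using Polynomial.induction_on' with
  | add p q hp hq =>
    obtain ⟨p', rfl⟩ := hp
    obtain ⟨q', rfl⟩ := hq
    exact ⟨p' + q', Polynomial.derivative_add⟩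
  | monomial m a =>
    have : (m : K) + 1 ≠ 0 := Nat.cast_add_one_ne_zero m
    exact ⟨Polynomial.monomial (m + 1) (a / (m + 1)), by simp [this]⟩

lemma exists_polynomial_of_hasDerivAt (m : ℕ) (g : ℕ → ℝ → ℂ)
    (hg : ∀ i t, HasDerivAt (g i) (g (i + 1) t) t) (hm : ∀ t, g m t = 0) :
    ∃ P : Polynomial ℂ, ∀ t : ℝ, g 0 t = P.eval (t : ℂ) := by
  induction m generalizing g with
  | zero => exact ⟨0, fun t => by simpa using hm t⟩
  | succ m ih =>
    obtain ⟨P, hP⟩ := ih (fun i => g (i + 1)) (fun i t => hg (i + 1) t) hm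
    obtain ⟨Q, rfl⟩ := exists_polynomial_derivative_eq P
    have hderiv : ∀ t, HasDerivAt (fun t : ℝ => g 0 t - Q.eval (t : ℂ)) 0 t := fun t => by
      have := (hg 0 t).sub (Q.hasDerivAt (t : ℂ)).comp_ofReal
      rwa [hP t, sub_self] at this
    have hconst := is_const_of_deriv_eq_zero (fun t => (hderiv t).differentiableAt)
      fun t => (hderiv t).deriv
    refine ⟨Q + Polynomial.C (g 0 0 - Q.eval 0), fun t => ?_⟩
    have := hconst t 0
    simp only [Complex.ofReal_zero] at this
    simp [← this]

lemma exists_norm_polynomial_eval_le {K : Type*} [NormedField K] (P : Polynomial K) :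
    ∃ (c : ℝ) (d : ℕ), 0 ≤ c ∧ ∀ x : K, ‖P.eval x‖ ≤ c * (1 + ‖x‖) ^ d := by
  refine ⟨∑ i ∈ Finset.range (P.natDegree + 1), ‖P.coeff i‖, P.natDegree,
    Finset.sum_nonneg fun _ _ => norm_nonneg _, fun x => ?_⟩
  rw [Polynomial.eval_eq_sum_range, Finset.sum_mul]
  refine (norm_sum_le _ _).trans (Finset.sum_le_sum fun i hi => ?_)
  rw [norm_mul, norm_pow]
  refine mul_le_mul_of_nonneg_left ?_ (norm_nonneg _)
  calc ‖x‖ ^ i ≤ (1 + ‖x‖) ^ i := by gcongr; linarith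
    _ ≤ (1 + ‖x‖) ^ P.natDegree :=
        pow_le_pow_right₀ (by linarith [norm_nonneg x]) (Finset.mem_range_succ_iff.1 hi)

/-- The product polynomial `P₁(x₁) ⋯ Pₙ(xₙ)` as a function on `ℝⁿ`. Every monomial is of this
form, and partial differences act on a single factor. -/
def polyProd (P : Fin n → Polynomial ℂ) (x : E n) : ℂ := ∏ i, (P i).eval (x i : ℂ)

lemma exists_norm_polyProd_le (P : Fin n → Polynomial ℂ) :
    ∃ c d : ℝ, ∀ x : E n, ‖polyProd P x‖ ≤ c * (1 + ‖x‖) ^ d := by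
  choose c d hc hP using fun i => exists_norm_polynomial_eval_le (P i)
  refine ⟨∏ i, c i, (∑ i, d i : ℕ), fun x => ?_⟩
  rw [Real.rpow_natCast, polyProd, norm_prod, ← Finset.prod_pow_eq_pow_sum,
    ← Finset.prod_mul_distrib]
  refine Finset.prod_le_prod (fun _ _ => norm_nonneg _) fun i _ => (hP i _).trans ?_
  have : ‖(x i : ℂ)‖ ≤ ‖x‖ := by simpa using PiLp.norm_apply_le x i
  gcongr
  exact hc i

lemma polyProd_update (P : Fin n → Polynomial ℂ) (j : Fin n) (Q : Polynomial ℂ) (x : E n) :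
    polyProd (Function.update P j Q) x =
      Q.eval (x j : ℂ) * ∏ i ∈ Finset.univ.erase j, (P i).eval (x i : ℂ) := by
  rw [polyProd, ← Finset.mul_prod_erase _ _ (Finset.mem_univ j), Function.update_self]
  congr 1
  refine Finset.prod_congr rfl fun i hi => ?_
  rw [Function.update_of_ne (Finset.ne_of_mem_erase hi)]

lemma polyProd_add_smul_basisVec (P : Fin n → Polynomial ℂ) (j : Fin n) (x : E n) (t : ℝ) :
    polyProd P (x + t • basisVec j) =
      (P j).eval (x j + t : ℂ) * ∏ i ∈ Finset.univ.erase j, (P i).eval (x i : ℂ) := by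
  rw [polyProd, ← Finset.mul_prod_erase _ _ (Finset.mem_univ j)]
  congr 1
  · simp [basisVec]
  · refine Finset.prod_congr rfl fun i hi => ?_
    simp [basisVec, Finset.ne_of_mem_erase hi]

/-- The backward difference `P(X) - P(X - 1)` of a polynomial. -/
def polyBackDiff (P : Polynomial ℂ) : Polynomial ℂ := P - Polynomial.taylor (-1) P

lemma iterate_polyBackDiff_eq_zero {P : Polynomial ℂ} {m : ℕ} (hP : P.degree < m) :
    polyBackDiff^[m] P = 0 := by
  induction m generalizing P with
  | zero => exact Polynomial.degree_eq_bot.1 (Nat.WithBot.lt_zero_iff.1 hP)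
  | succ m ih =>
    rw [Function.iterate_succ_apply]
    rcases eq_or_ne P 0 with rfl | hP0
    · exact ih (by simp [polyBackDiff])
    · refine ih ((Polynomial.degree_sub_lt_left (Polynomial.degree_taylor P (-1)).symm hP0
        (Polynomial.leadingCoeff_taylor (-1) P).symm).trans_le ?_)
      rw [Polynomial.degree_eq_natDegree hP0] at hP ⊢
      exact_mod_cast Nat.lt_succ_iff.1 (by exact_mod_cast hP)

lemma polyProd_sub_polyProd_sub_basisVec (P : Fin n → Polynomial ℂ) (j : Fin n) (x : E n) :
    polyProd P x - polyProd P (x - basisVec j) =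
      polyProd (Function.update P j (polyBackDiff (P j))) x := by
  have hx := polyProd_add_smul_basisVec P j x 0
  have hx' := polyProd_add_smul_basisVec P j x (-1)
  rw [zero_smul, add_zero, Complex.ofReal_zero, add_zero] at hx
  rw [neg_one_smul, ← sub_eq_add_neg] at hx'
  rw [hx, hx', polyProd_update, polyBackDiff, Polynomial.eval_sub, Polynomial.taylor_eval]
  rw [Complex.ofReal_neg, Complex.ofReal_one]
  ring

/-- The sum `∑ₖ f(ξ - k) p(k)` over `k ∈ ℤⁿ`. -/
def lattConv (f : E n → ℂ) (p : (Fin n → ℤ) → ℂ) (ξ : E n) : ℂ :=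
  ∑' k, f (ξ - latt k) * p k

lemma summable_schwartz_mul (ψ : 𝓢(E n, ℂ)) {p : (Fin n → ℤ) → ℂ} {c d : ℝ}
    (hp : ∀ k, ‖p k‖ ≤ c * (1 + ‖latt k‖) ^ d) (ξ : E n) :
    Summable fun k => ψ (ξ - latt k) * p k := by
  obtain ⟨u, hu, hle⟩ := exists_summable_bound_schwartz_sub_latt ψ hp ‖ξ‖
  exact hu.of_norm_bounded fun k => (norm_mul_le _ _).trans (hle ξ le_rfl k)

lemma hasDerivAt_lattConv (ψ : 𝓢(E n, ℂ)) {p : (Fin n → ℤ) → ℂ} {c d : ℝ}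
    (hp : ∀ k, ‖p k‖ ≤ c * (1 + ‖latt k‖) ^ d) (ξ v : E n) (t : ℝ) :
    HasDerivAt (fun t : ℝ => lattConv ψ p (ξ + t • v))
      (lattConv (∂_{v} ψ : 𝓢(E n, ℂ)) p (ξ + t • v)) t := by
  obtain ⟨u, hu, hle⟩ :=
    exists_summable_bound_schwartz_sub_latt (∂_{v} ψ : 𝓢(E n, ℂ)) hp (‖ξ‖ + (|t| + 1) * ‖v‖)
  refine hasDerivAt_tsum_of_isPreconnected (t := Metric.ball t 1) (y₀ := t)
    (g' := fun k s => (∂_{v} ψ : 𝓢(E n, ℂ)) (ξ + s • v - latt k) * p k) hu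
    Metric.isOpen_ball (convex_ball t 1).isPreconnected (fun k s _ => ?_)
    (fun k s hs => (norm_mul_le _ _).trans (hle _ ?_ k))
    (Metric.mem_ball_self one_pos) (summable_schwartz_mul ψ hp _) (Metric.mem_ball_self one_pos)
  · have hline : HasDerivAt (fun s : ℝ => ξ + s • v - latt k) v s := by
      simpa using (((hasDerivAt_id s).smul_const v).const_add ξ).sub_const (latt k)
    rw [SchwartzMap.lineDerivOp_apply_eq_fderiv]
    exact (ψ.differentiableAt.hasFDerivAt.comp_hasDerivAt s hline).mul_const (p k)
  · have hs' : |s| ≤ |t| + 1 := by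
      rw [Metric.mem_ball, Real.dist_eq] at hs
      linarith [abs_sub_abs_le_abs_sub s t]
    calc ‖ξ + s • v‖ ≤ ‖ξ‖ + |s| * ‖v‖ := (norm_add_le _ _).trans_eq (by rw [norm_smul]; rfl)
      _ ≤ ‖ξ‖ + (|t| + 1) * ‖v‖ := by gcongr

lemma multiPow_single {X : Type*} (D : Fin n → X → X) (j : Fin n) (m : ℕ) (x : X) :
    multiPow D (Pi.single j m) x = (D j)^[m] x := by
  have hfold : ∀ l : List (Fin n), l.Nodup →
      l.foldr (fun i y => (D i)^[(Pi.single j m : Fin n → ℕ) i] y) x =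
        if j ∈ l then (D j)^[m] x else x := by
    intro l hl
    induction l with
    | nil => simp
    | cons i l ih =>
      rw [List.nodup_cons] at hl
      rw [List.foldr_cons, ih hl.2]
      by_cases h : i = j
      · subst h; simp [hl.1]
      · simp [h, Ne.symm h]
  rw [multiPow, hfold _ (List.nodup_finRange n), if_pos (List.mem_finRange j)]

lemma partialD_coe (j : Fin n) (ψ : 𝓢(E n, ℂ)) :
    partialD j ψ = (∂_{(basisVec j : E n)} ψ : 𝓢(E n, ℂ)) := by
  ext ξ
  exact (SchwartzMap.lineDerivOp_apply _ _ _).symm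

lemma iterate_partialD_coe (j : Fin n) (m : ℕ) (ψ : 𝓢(E n, ℂ)) :
    (partialD j)^[m] ψ = ((∂_{(basisVec j : E n)} ·)^[m] ψ : 𝓢(E n, ℂ)) :=
  ((Function.Semiconj.iterate_right
    (f := fun ψ : 𝓢(E n, ℂ) => (ψ : E n → ℂ)) (fun ψ => (partialD_coe j ψ).symm) m).eq ψ).symm

/-- The backward difference `ψ(ξ) - ψ(ξ - e_j)` within the Schwartz space. -/
def schwartzBackDiff (j : Fin n) (ψ : 𝓢(E n, ℂ)) : 𝓢(E n, ℂ) :=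
  ψ - SchwartzMap.compSubConstCLM ℂ (basisVec j) ψ

lemma iterate_backDiff_coe (j : Fin n) (m : ℕ) (ψ : 𝓢(E n, ℂ)) :
    (backDiff j)^[m] ψ = ((schwartzBackDiff j)^[m] ψ : 𝓢(E n, ℂ)) :=
  ((Function.Semiconj.iterate_right (f := fun ψ : 𝓢(E n, ℂ) => (ψ : E n → ℂ)) (fun _ => rfl)
    m).eq ψ).symm

lemma lattConv_schwartzBackDiff (ψ : 𝓢(E n, ℂ)) (P : Fin n → Polynomial ℂ) (j : Fin n)
    (ξ : E n) :
    lattConv (schwartzBackDiff j ψ) (fun k => polyProd P (latt k)) ξ =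
      lattConv ψ (fun k => polyProd (Function.update P j (polyBackDiff (P j))) (latt k)) ξ := by
  obtain ⟨c, d, hP⟩ := exists_norm_polyProd_le P
  obtain ⟨c', d', hP'⟩ := exists_norm_polyProd_le (Function.update P j (polyBackDiff (P j)))
  have hs := summable_schwartz_mul ψ (fun k => hP (latt k)) ξ
  have hs' := summable_schwartz_mul ψ (fun k => hP' (latt k)) ξ
  have hshift : ∑' k, ψ (ξ - basisVec j - latt k) * polyProd P (latt k) =
      ∑' k, ψ (ξ - latt k) * polyProd P (latt k - basisVec j) := by
    rw [← (Equiv.subRight (Pi.single j 1 : Fin n → ℤ)).tsum_eq]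
    simp only [Equiv.subRight_apply, latt_sub, latt_single]
    exact tsum_congr fun k => by congr 2; abel
  calc lattConv (schwartzBackDiff j ψ) (fun k => polyProd P (latt k)) ξ
      = ∑' k, (ψ (ξ - latt k) * polyProd P (latt k) -
          ψ (ξ - basisVec j - latt k) * polyProd P (latt k)) := by
        refine tsum_congr fun k => ?_
        rw [← sub_mul, sub_right_comm ξ]
        rfl
    _ = ∑' k, ψ (ξ - latt k) * polyProd P (latt k) -
          ∑' k, ψ (ξ - latt k) * polyProd P (latt k - basisVec j) := by
        rw [hs.tsum_sub (summable_schwartz_mul ψ (fun k => hP (latt k)) _), hshift]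
    _ = lattConv ψ (fun k => polyProd (Function.update P j (polyBackDiff (P j))) (latt k)) ξ := by
        simp only [lattConv, ← polyProd_sub_polyProd_sub_basisVec, mul_sub] at hs' ⊢
        rw [hs.tsum_sub (by simpa only [sub_sub_cancel] using hs.sub hs')]

lemma lattConv_iterate_schwartzBackDiff_eq_zero (ψ : 𝓢(E n, ℂ)) {P : Fin n → Polynomial ℂ}
    {j : Fin n} {m : ℕ} (hm : (P j).degree < m) (ξ : E n) :
    lattConv ((schwartzBackDiff j)^[m] ψ) (fun k => polyProd P (latt k)) ξ = 0 := by
  suffices h : ∀ P : Fin n → Polynomial ℂ,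
      lattConv ((schwartzBackDiff j)^[m] ψ) (fun k => polyProd P (latt k)) ξ =
        lattConv ψ
          (fun k => polyProd (Function.update P j (polyBackDiff^[m] (P j))) (latt k)) ξ by
    rw [h, iterate_polyBackDiff_eq_zero hm]
    simp [lattConv, polyProd_update]
  clear hm
  induction m with
  | zero => simp
  | succ m ih =>
    intro P
    rw [Function.iterate_succ_apply', lattConv_schwartzBackDiff, ih]
    simp

lemma exists_polynomial_lattConv_line {φ : 𝓢(E n, ℂ)} (hφ : IsMeyer φ)
    (P : Fin n → Polynomial ℂ) (j : Fin n) (ξ : E n) :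
    ∃ Q : Polynomial ℂ, ∀ t : ℝ,
      lattConv φ (fun k => polyProd P (latt k)) (ξ + t • basisVec j) = Q.eval (t : ℂ) := by
  obtain ⟨c, d, hP⟩ := exists_norm_polyProd_le P
  refine exists_polynomial_of_hasDerivAt ((P j).natDegree + 1)
    (fun i t => lattConv ((∂_{(basisVec j : E n)} ·)^[i] φ : 𝓢(E n, ℂ))
      (fun k => polyProd P (latt k)) (ξ + t • basisVec j)) (fun i t => ?_) (fun t => ?_)
  · simp only [Function.iterate_succ_apply']
    exact hasDerivAt_lattConv _ (fun k => hP (latt k)) ξ _ t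
  · obtain ⟨ψ, hψ⟩ := hφ.derivs (Pi.single j ((P j).natDegree + 1))
    rw [multiPow_single, multiPow_single, iterate_partialD_coe, iterate_backDiff_coe] at hψ
    simp only [hψ]
    exact lattConv_iterate_schwartzBackDiff_eq_zero ψ
      (Polynomial.degree_le_natDegree.trans_lt (by exact_mod_cast Nat.lt_succ_self _)) _

lemma exists_polynomial_polyProd_line (P : Fin n → Polynomial ℂ) (j : Fin n) (ξ : E n) :
    ∃ Q : Polynomial ℂ, ∀ t : ℝ, polyProd P (ξ + t • basisVec j) = Q.eval (t : ℂ) :=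
  ⟨Polynomial.taylor (ξ j : ℂ) (P j) *
    Polynomial.C (∏ i ∈ Finset.univ.erase j, (P i).eval (ξ i : ℂ)), fun t => by
      rw [polyProd_add_smul_basisVec, Polynomial.eval_mul, Polynomial.taylor_eval,
        Polynomial.eval_C, add_comm (t : ℂ)]⟩

lemma eq_zero_of_polynomial_line_of_latt {D : E n → ℂ}
    (hD : ∀ j ξ, ∃ Q : Polynomial ℂ, ∀ t : ℝ, D (ξ + t • basisVec j) = Q.eval (t : ℂ))
    (h0 : ∀ k, D (latt k) = 0) (ξ : E n) : D ξ = 0 := by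
  suffices h : ∀ (s : Finset (Fin n)) (ξ : E n), (∀ i ∉ s, ∃ m : ℤ, ξ i = m) → D ξ = 0 from
    h Finset.univ ξ (by simp)
  intro s
  induction s using Finset.induction_on with
  | empty =>
    intro ξ h
    choose k hk using fun i => h i (Finset.notMem_empty i)
    rw [show ξ = latt k by ext i; simp [hk]]
    exact h0 k
  | insert j s hj ih =>
    intro ξ h
    obtain ⟨Q, hQ⟩ := hD j ξ
    have hroot : ∀ m : ℤ, Q.eval (((m - ξ j : ℝ)) : ℂ) = 0 := by
      intro m
      rw [← hQ]
      refine ih _ fun i hi => ?_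
      by_cases hij : i = j
      · exact ⟨m, by subst hij; simp [basisVec]⟩
      · obtain ⟨l, hl⟩ := h i (by simp [hij, hi])
        exact ⟨l, by simp [basisVec, hij, hl]⟩
    have hinj : Function.Injective fun m : ℤ => ((m - ξ j : ℝ) : ℂ) := fun a b hab => by
      simpa using hab
    have hQ0 : Q = 0 := Polynomial.eq_zero_of_infinite_isRoot Q
      ((Set.infinite_range_of_injective hinj).mono (Set.range_subset_iff.2 hroot))
    simpa [hQ0] using hQ 0

lemma lattConv_latt {φ : 𝓢(E n, ℂ)} (hφ : IsMeyer φ) (p : (Fin n → ℤ) → ℂ) (k : Fin n → ℤ) :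
    lattConv φ p (latt k) = p k := by
  rw [lattConv, tsum_eq_single k]
  · simp [hφ.map_zero]
  · intro l hl
    rw [← latt_sub, hφ.map_latt _ (sub_ne_zero.2 hl.symm), zero_mul]

lemma lattConv_polyProd {φ : 𝓢(E n, ℂ)} (hφ : IsMeyer φ) (P : Fin n → Polynomial ℂ) (ξ : E n) :
    lattConv φ (fun k => polyProd P (latt k)) ξ = polyProd P ξ := by
  refine sub_eq_zero.1 (eq_zero_of_polynomial_line_of_latt
    (D := fun ξ => lattConv φ (fun k => polyProd P (latt k)) ξ - polyProd P ξ)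
    (fun j ξ => ?_) (fun k => ?_) ξ)
  · obtain ⟨Q, hQ⟩ := exists_polynomial_lattConv_line hφ P j ξ
    obtain ⟨R, hR⟩ := exists_polynomial_polyProd_line P j ξ
    exact ⟨Q - R, fun t => by rw [hQ, hR, Polynomial.eval_sub]⟩
  · rw [lattConv_latt hφ, sub_self]

lemma hasSum_mul_polyProd {φ : 𝓢(E n, ℂ)} (hφ : IsMeyer φ) (P : Fin n → Polynomial ℂ) (ξ : E n) :
    HasSum (fun k => φ (ξ - latt k) * polyProd P (latt k)) (polyProd P ξ) := by
  obtain ⟨c, d, hP⟩ := exists_norm_polyProd_le P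
  rw [← lattConv_polyProd hφ P ξ]
  exact (summable_schwartz_mul φ (fun k => hP (latt k)) ξ).hasSum

lemma exists_polyProd_eq_prod_coord_sub {m : ℕ} (r : Fin m → Fin n) (ξ : E n) :
    ∃ P : Fin n → Polynomial ℂ, ∀ x : E n,
      polyProd P x = ((∏ i, (x - ξ) (r i) : ℝ) : ℂ) := by
  refine ⟨fun l => (Polynomial.X - Polynomial.C (ξ l : ℂ)) ^
    (Finset.univ.filter fun i => r i = l).card, fun x => ?_⟩
  rw [polyProd, ← Finset.prod_fiberwise (s := Finset.univ) (g := r)]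
  push_cast
  refine Finset.prod_congr rfl fun l _ => ?_
  rw [Finset.prod_congr rfl (g := fun _ => (x l : ℂ) - ξ l), Finset.prod_const]
  · simp
  · intro i hi
    simp [(Finset.mem_filter.1 hi).2]

section Multilinear

variable {F : Type*} [NormedAddCommGroup F] [NormedSpace ℝ F] {m : ℕ}

lemma multilinear_diag_eq_sum (L : E n [×m]→L[ℝ] F) (x : E n) :
    L (fun _ => x) = ∑ r : Fin m → Fin n, (∏ i, x (r i)) • L fun i => basisVec (r i) := by
  conv_lhs => rw [eq_sum_smul_basisVec x]
  rw [L.map_sum]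
  exact Finset.sum_congr rfl fun r _ => L.map_smul_univ _ _

/-- The moments of a Meyer-type function are those of the Dirac mass at the origin. -/
lemma hasSum_smul_multilinear [NormedSpace ℂ F] [IsScalarTower ℝ ℂ F] {φ : 𝓢(E n, ℂ)}
    (hφ : IsMeyer φ) (ξ : E n) (L : E n [×m]→L[ℝ] F) :
    HasSum (fun k : Fin n → ℤ => φ (ξ - latt k) • L (fun _ => latt k - ξ)) (L 0) := by
  have hcoord (r : Fin m → Fin n) : HasSum (fun k : Fin n → ℤ =>
      φ (ξ - latt k) * ((∏ i, (latt k - ξ) (r i) : ℝ) : ℂ))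
      ((∏ i : Fin m, (0 : E n) (r i) : ℝ) : ℂ) := by
    obtain ⟨P, hP⟩ := exists_polyProd_eq_prod_coord_sub r ξ
    simpa only [hP, sub_self] using hasSum_mul_polyProd hφ P ξ
  have hdiag (x : E n) : L (fun _ => x) =
      ∑ r : Fin m → Fin n, ((∏ i, x (r i) : ℝ) : ℂ) • L fun i => basisVec (r i) := by
    simp only [multilinear_diag_eq_sum L x, ← Complex.coe_algebraMap, algebraMap_smul]
  have hsum := hasSum_sum fun (r : Fin m → Fin n) (_ : r ∈ Finset.univ) =>
    (hcoord r).smul_const (L fun i => basisVec (r i))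
  simp only [hdiag, Finset.smul_sum, smul_smul]
  exact (hdiag 0).symm ▸ hsum

end Multilinear

/-! ### Interpolation of symbols -/

section RapidDecay

variable {X F : Type*} [NormedAddCommGroup X] [NormedAddCommGroup F]

/-- Decay faster than every power of `1 + ‖x‖`. -/
def RapidDecay (h : X → F) : Prop :=
  ∀ N : ℕ, ∃ C : ℝ, ∀ x, ‖h x‖ ≤ C * (1 + ‖x‖) ^ (-(N : ℝ))

variable [NormedSpace ℝ X] [NormedSpace ℝ F]

lemma mul_norm_fderiv_apply_le {h : X → F} (hd : Differentiable ℝ h) {K : NNReal}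
    (hK : LipschitzWith K (fderiv ℝ h)) {ε : ℝ} (hε : 0 ≤ ε) (x : X) {v : X} (hv : ‖v‖ = 1) :
    ε * ‖fderiv ℝ h x v‖ ≤ ‖h (x + ε • v)‖ + ‖h x‖ + K * ε * ε := by
  have hball : ∀ y ∈ Metric.closedBall x ε, ‖fderiv ℝ h y - fderiv ℝ h x‖ ≤ K * ε := fun y hy =>
    (hK.norm_sub_le y x).trans
      (mul_le_mul_of_nonneg_left (mem_closedBall_iff_norm.1 hy) K.coe_nonneg)
  have hmean := (convex_closedBall x ε).norm_image_sub_le_of_norm_fderiv_le'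
    (fun y _ => hd y) hball (Metric.mem_closedBall_self hε)
    (y := x + ε • v) (by simp [norm_smul, hv, abs_of_nonneg hε])
  rw [add_sub_cancel_left, map_smul, norm_smul, hv, mul_one, Real.norm_of_nonneg hε] at hmean
  have htri := norm_sub_le (h (x + ε • v) - h x) (h (x + ε • v) - h x - ε • fderiv ℝ h x v)
  rw [sub_sub_cancel, norm_smul, Real.norm_of_nonneg hε] at htri
  linarith [norm_sub_le (h (x + ε • v)) (h x)]

/-- The difference quotient of step `(1 + ‖x‖)^{-N}` approximates the derivative at `x`. -/
lemma RapidDecay.fderiv {h : X → F} (hr : RapidDecay h) (hd : Differentiable ℝ h) {K : NNReal}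
    (hK : LipschitzWith K (fderiv ℝ h)) : RapidDecay (fderiv ℝ h) := by
  intro N
  obtain ⟨C, hC⟩ := hr (2 * N)
  have hC0 : 0 ≤ C := by simpa using (norm_nonneg _).trans (hC 0)
  refine ⟨K + C * 2 ^ (2 * N) + C, fun x => ?_⟩
  set ε : ℝ := (1 + ‖x‖) ^ (-(N : ℝ))
  have hε : 0 < ε := by positivity
  have hε1 : ε ≤ 1 := Real.rpow_le_one_of_one_le_of_nonpos (by simp) (by simp)
  have hε2 : (1 + ‖x‖) ^ (-((2 * N : ℕ) : ℝ)) = ε * ε := by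
    rw [← Real.rpow_add (by positivity)]
    congr 1
    push_cast
    ring
  refine ContinuousLinearMap.opNorm_le_of_unit_norm (by positivity) fun v hv => ?_
  have hshift : ‖h (x + ε • v)‖ ≤ C * 2 ^ (2 * N) * (ε * ε) := by
    have hpeetre := one_add_norm_add_rpow_neg_le (s := ((2 * N : ℕ) : ℝ)) (by positivity) x (ε • v)
    rw [norm_smul, hv, mul_one, Real.norm_of_nonneg hε.le, hε2, Real.rpow_natCast] at hpeetre
    have hpow : (1 + ε) ^ (2 * N) ≤ 2 ^ (2 * N) := by gcongr; linarith
    calc ‖h (x + ε • v)‖ ≤ C * (ε * ε * 2 ^ (2 * N)) := by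
          refine (hC _).trans (mul_le_mul_of_nonneg_left (hpeetre.trans ?_) hC0)
          exact mul_le_mul_of_nonneg_left hpow (by positivity)
      _ = C * 2 ^ (2 * N) * (ε * ε) := by ring
  have hx : ‖h x‖ ≤ C * (ε * ε) := hε2 ▸ hC x
  refine le_of_mul_le_mul_left ?_ hε
  linarith [mul_norm_fderiv_apply_le hd hK hε.le x hv]

lemma lipschitzWith_fderiv_iteratedFDeriv {g : X → F} (hg : ContDiff ℝ ∞ g) {b : ℕ} {K : NNReal}
    (hK : ∀ x, ‖iteratedFDeriv ℝ (b + 2) g x‖ ≤ K) :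
    LipschitzWith K (fderiv ℝ (iteratedFDeriv ℝ b g)) := by
  have hlip : LipschitzWith K (iteratedFDeriv ℝ (b + 1) g) := by
    refine lipschitzWith_of_nnnorm_fderiv_le (𝕜 := ℝ)
      (hg.differentiable_iteratedFDeriv (by exact_mod_cast ENat.natCast_lt_top (b + 1)))
      fun x => ?_
    rw [← NNReal.coe_le_coe, coe_nnnorm, norm_fderiv_iteratedFDeriv]
    exact hK x
  rw [fderiv_iteratedFDeriv]
  simpa only [one_mul] using (LinearIsometryEquiv.isometry _).lipschitz.comp hlip

lemma RapidDecay.iteratedFDeriv {g : X → F} (hr : RapidDecay g) (hg : ContDiff ℝ ∞ g)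
    (hb : ∀ b : ℕ, ∃ C : ℝ, ∀ x, ‖iteratedFDeriv ℝ b g x‖ ≤ C) (b : ℕ) :
    RapidDecay (iteratedFDeriv ℝ b g) := by
  induction b with
  | zero => simpa only [RapidDecay, norm_iteratedFDeriv_zero] using hr
  | succ b ih =>
    obtain ⟨K, hK⟩ := hb (b + 2)
    have hd : Differentiable ℝ (_root_.iteratedFDeriv ℝ b g) :=
      hg.differentiable_iteratedFDeriv (by exact_mod_cast ENat.natCast_lt_top b)
    have := ih.fderiv hd (lipschitzWith_fderiv_iteratedFDeriv hg (K := K.toNNReal)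
      fun x => (hK x).trans (Real.le_coe_toNNReal K))
    simpa only [RapidDecay, norm_fderiv_iteratedFDeriv] using this

end RapidDecay

section SymbolEstimates

variable {X F : Type*} [NormedAddCommGroup X] [NormedSpace ℝ X] [NormedAddCommGroup F]
  [NormedSpace ℝ F]

/-- Smooth maps satisfying the symbol estimates of order `s`, up to the origin. -/
structure SymbolBound (s : ℝ) (f : X → F) : Prop where
  contDiff : ContDiff ℝ ∞ f
  bound : ∀ m : ℕ, ∃ C : ℝ, ∀ ξ, ‖iteratedFDeriv ℝ m f ξ‖ ≤ C * (1 + ‖ξ‖) ^ (s - m)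

lemma SymbolBound.norm_le {s : ℝ} {f : X → F} (hf : SymbolBound s f) :
    ∃ C : ℝ, 0 ≤ C ∧ ∀ ξ, ‖f ξ‖ ≤ C * (1 + ‖ξ‖) ^ s := by
  obtain ⟨C, hC⟩ := hf.bound 0
  refine ⟨C, ?_, fun ξ => by simpa using hC ξ⟩
  simpa using (norm_nonneg _).trans (hC 0)

lemma SymbolBound.exists_norm_iteratedFDeriv_le {s : ℝ} (hs : s ≤ 0) {f : X → F}
    (hf : SymbolBound s f) (m : ℕ) : ∃ C : ℝ, ∀ ξ, ‖iteratedFDeriv ℝ m f ξ‖ ≤ C := by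
  obtain ⟨C, hC⟩ := hf.bound m
  have hC0 : 0 ≤ C := by simpa using (norm_nonneg _).trans (hC 0)
  refine ⟨C, fun ξ => (hC ξ).trans (mul_le_of_le_one_right hC0
    (Real.rpow_le_one_of_one_le_of_nonpos (by simp) ?_))⟩
  linarith [m.cast_nonneg (α := ℝ)]

lemma SymbolBound.summable {s : ℝ} (hs : s < -n) {f : E n → F} (hf : SymbolBound s f) :
    Summable fun k : Fin n → ℤ => ‖f (latt k)‖ := by
  obtain ⟨C, -, hC⟩ := hf.norm_le
  have := (summable_one_add_norm_latt_rpow (n := n) (r := -s) (by linarith)).mul_left C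
  rw [neg_neg] at this
  exact this.of_nonneg_of_le (fun _ => norm_nonneg _) fun k => hC _

/-- The value at `x + v` of the Taylor polynomial of degree `N` of `f` at `x`. -/
def taylorPoly (f : X → F) (N : ℕ) (x v : X) : F :=
  ∑ m ∈ Finset.range (N + 1), (m.factorial : ℝ)⁻¹ • iteratedFDeriv ℝ m f x fun _ => v

lemma norm_sub_taylorPoly_le [CompleteSpace F] {f : X → F} {N : ℕ} (hf : ContDiff ℝ (N + 1) f)
    {x v : X} {M : ℝ}
    (hM : ∀ t ∈ Set.Ioc (0 : ℝ) 1, ‖iteratedFDeriv ℝ (N + 1) f (x + t • v)‖ ≤ M) :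
    ‖f (x + v) - taylorPoly f N x v‖ ≤ M * ‖v‖ ^ (N + 1) := by
  rw [taylorPoly, map_add_eq_sum_add_integral_iteratedFDeriv (n := N) (x := x) (y := v)
    (fun t _ => hf.contDiffAt), add_sub_cancel_left, norm_smul]
  have hfact : ‖(N.factorial : ℝ)⁻¹‖ ≤ 1 := by
    rw [norm_inv, Real.norm_natCast]
    exact inv_le_one_of_one_le₀ (by exact_mod_cast N.factorial_pos)
  refine (mul_le_mul hfact (intervalIntegral.norm_integral_le_of_norm_le_const
    (C := M * ‖v‖ ^ (N + 1)) fun t ht => ?_) (norm_nonneg _) zero_le_one).trans_eq (by simp)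
  rw [Set.uIoc_of_le zero_le_one] at ht
  have ht0 : 0 ≤ 1 - t := by linarith [ht.2]
  have hpow : ‖(1 - t) ^ N‖ ≤ 1 := by
    rw [norm_pow, Real.norm_of_nonneg ht0]
    exact pow_le_one₀ ht0 (by linarith [ht.1])
  rw [norm_smul]
  refine (mul_le_of_le_one_left (norm_nonneg _) hpow).trans ?_
  simpa using (iteratedFDeriv ℝ (N + 1) f (x + t • v)).le_of_opNorm_le (hM t ht) fun _ => v

lemma SymbolBound.norm_sub_taylorPoly_le [CompleteSpace F] {s : ℝ} (hs : s ≤ 0) {f : X → F}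
    (hf : SymbolBound s f) (N : ℕ) :
    ∃ C : ℝ, 0 ≤ C ∧ ∀ ξ v : X, ‖f (ξ + v) - taylorPoly f N ξ v‖ ≤
      C * (1 + ‖ξ‖) ^ (-(N + 1 - s)) * (1 + ‖v‖) ^ (2 * (N + 1) - s) := by
  obtain ⟨C, hC⟩ := hf.bound (N + 1)
  have hC0 : 0 ≤ C := by simpa using (norm_nonneg _).trans (hC 0)
  have hNs : (0 : ℝ) ≤ N + 1 - s := by linarith [N.cast_nonneg (α := ℝ)]
  refine ⟨C, hC0, fun ξ v => ?_⟩
  have hderiv : ∀ t ∈ Set.Ioc (0 : ℝ) 1, ‖iteratedFDeriv ℝ (N + 1) f (ξ + t • v)‖ ≤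
      C * ((1 + ‖ξ‖) ^ (-(N + 1 - s)) * (1 + ‖v‖) ^ (N + 1 - s)) := by
    intro t ht
    have htv : ‖t • v‖ ≤ ‖v‖ := by
      rw [norm_smul, Real.norm_of_nonneg ht.1.le]
      exact mul_le_of_le_one_left (norm_nonneg _) ht.2
    refine (hC _).trans (mul_le_mul_of_nonneg_left ?_ hC0)
    rw [show s - ((N + 1 : ℕ) : ℝ) = -(N + 1 - s) by push_cast; ring]
    refine (one_add_norm_add_rpow_neg_le hNs ξ (t • v)).trans ?_
    gcongr
  calc ‖f (ξ + v) - taylorPoly f N ξ v‖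
      ≤ C * ((1 + ‖ξ‖) ^ (-(N + 1 - s)) * (1 + ‖v‖) ^ (N + 1 - s)) * ‖v‖ ^ (N + 1) :=
        NCTorus.norm_sub_taylorPoly_le (hf.contDiff.of_le (by exact_mod_cast le_top)) hderiv
    _ ≤ C * ((1 + ‖ξ‖) ^ (-(N + 1 - s)) * (1 + ‖v‖) ^ (N + 1 - s)) *
          (1 + ‖v‖) ^ ((N : ℝ) + 1) := by
        rw [← Nat.cast_succ, Real.rpow_natCast]
        gcongr
        linarith
    _ = C * (1 + ‖ξ‖) ^ (-(N + 1 - s)) * (1 + ‖v‖) ^ (2 * (N + 1) - s) := by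
        rw [show (2 * ((N : ℝ) + 1) - s) = (N + 1 - s) + (N + 1) by ring,
          Real.rpow_add (by positivity) (N + 1 - s)]
        ring

end SymbolEstimates

section Translates

variable {X F : Type*} [NormedAddCommGroup X] [NormedSpace ℝ X] [NormedAddCommGroup F]
  [NormedSpace ℝ F] [NormedSpace ℂ F] [IsScalarTower ℝ ℂ F]

lemma contDiff_schwartz_sub_smul (φ : 𝓢(X, ℂ)) (a : X) (v : F) :
    ContDiff ℝ ∞ fun ξ => φ (ξ - a) • v :=
  ((φ.smooth ⊤).comp (contDiff_id.sub contDiff_const)).smul contDiff_const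

lemma norm_iteratedFDeriv_schwartz_sub_smul_le (φ : 𝓢(X, ℂ)) (a : X) (v : F) (b : ℕ) (ξ : X) :
    ‖iteratedFDeriv ℝ b (fun ξ => φ (ξ - a) • v) ξ‖ ≤ ‖iteratedFDeriv ℝ b φ (ξ - a)‖ * ‖v‖ := by
  let L : ℂ →L[ℝ] F := (ContinuousLinearMap.toSpanSingleton ℂ v).restrictScalars ℝ
  have hL : ‖L‖ ≤ ‖v‖ := by
    refine L.opNorm_le_bound (norm_nonneg _) fun z => ?_
    simp [L, norm_smul, mul_comm]
  have h := L.norm_iteratedFDeriv_comp_left (f := fun ξ => φ (ξ - a)) (x := ξ) (N := ∞) (n := b)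
    (((φ.smooth ⊤).comp (contDiff_id.sub contDiff_const)).contDiffAt) (by exact_mod_cast le_top)
  rw [iteratedFDeriv_comp_sub'] at h
  refine h.trans ?_
  rw [mul_comm]
  exact mul_le_mul_of_nonneg_left hL (norm_nonneg _)

variable {ι : Type*} [CompleteSpace F]

lemma contDiff_tsum_schwartz_sub_smul (φ : 𝓢(X, ℂ)) (a : ι → X) {v : ι → F}
    (hv : Summable fun k => ‖v k‖) :
    ContDiff ℝ ∞ (fun ξ => ∑' k, φ (ξ - a k) • v k) ∧
      ∀ b : ℕ, ∃ C : ℝ, ∀ ξ, ‖iteratedFDeriv ℝ b (fun ξ => ∑' k, φ (ξ - a k) • v k) ξ‖ ≤ C := by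
  choose C _ hC using fun b => exists_norm_iteratedFDeriv_schwartz_le φ b 0
  simp only [neg_zero, Real.rpow_zero, mul_one] at hC
  have hsmooth (k : ι) := contDiff_schwartz_sub_smul φ (a k) (v k)
  have hterm : ∀ (b : ℕ) (k : ι) (ξ : X), (b : ℕ∞) ≤ (⊤ : ℕ∞) →
      ‖iteratedFDeriv ℝ b (fun ξ => φ (ξ - a k) • v k) ξ‖ ≤ C b * ‖v k‖ := fun b k ξ _ =>
    (norm_iteratedFDeriv_schwartz_sub_smul_le φ (a k) (v k) b ξ).trans
      (mul_le_mul_of_nonneg_right (hC b _) (norm_nonneg _))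
  have hsum : ∀ b : ℕ, (b : ℕ∞) ≤ (⊤ : ℕ∞) → Summable fun k => C b * ‖v k‖ :=
    fun b _ => hv.mul_left _
  refine ⟨contDiff_tsum hsmooth hsum hterm, fun b => ⟨∑' k, C b * ‖v k‖, fun ξ => ?_⟩⟩
  rw [iteratedFDeriv_tsum_apply hsmooth hsum hterm le_top]
  exact tsum_of_norm_bounded (hsum b le_top).hasSum fun k => hterm b k ξ le_top

omit [IsScalarTower ℝ ℂ F] [NormedSpace ℝ F] in
lemma summable_schwartz_sub_smul (φ : 𝓢(X, ℂ)) (a : ι → X) {v : ι → F}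
    (hv : Summable fun k => ‖v k‖) (ξ : X) : Summable fun k => φ (ξ - a k) • v k := by
  obtain ⟨C, _, hC⟩ := exists_norm_schwartz_le φ 0
  simp only [neg_zero, Real.rpow_zero, mul_one] at hC
  refine (hv.mul_left C).of_norm_bounded fun k => ?_
  rw [norm_smul]
  exact mul_le_mul_of_nonneg_right (hC _) (norm_nonneg _)

end Translates

section Interpolation

variable {F : Type*} [NormedAddCommGroup F] [NormedSpace ℝ F] [NormedSpace ℂ F]
  [IsScalarTower ℝ ℂ F]

lemma hasSum_smul_taylorPoly {φ : 𝓢(E n, ℂ)} (hφ : IsMeyer φ) (f : E n → F) (N : ℕ) (ξ : E n) :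
    HasSum (fun k : Fin n → ℤ => φ (ξ - latt k) • taylorPoly f N ξ (latt k - ξ)) (f ξ) := by
  have h := hasSum_sum fun (m : ℕ) (_ : m ∈ Finset.range (N + 1)) =>
    (hasSum_smul_multilinear hφ ξ (iteratedFDeriv ℝ m f ξ)).const_smul ((m.factorial : ℝ)⁻¹)
  convert h using 2 with k
  · rw [taylorPoly, Finset.smul_sum]
    exact Finset.sum_congr rfl fun m _ => smul_comm _ _ _
  · rw [Finset.sum_range_succ']
    simp [ContinuousMultilinearMap.map_zero]

variable [CompleteSpace F] {φ : 𝓢(E n, ℂ)} {s : ℝ} {f : E n → F}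

lemma SymbolBound.rapidDecay_tsum_sub (hf : SymbolBound s f) (hs : s < -n) (hφ : IsMeyer φ) :
    RapidDecay fun ξ => (∑' k, φ (ξ - latt k) • f (latt k)) - f ξ := by
  intro N
  have hs0 : s ≤ 0 := by linarith [n.cast_nonneg (α := ℝ)]
  obtain ⟨C, hC0, hC⟩ := hf.norm_sub_taylorPoly_le hs0 N
  obtain ⟨C', hC0', hC'⟩ := exists_norm_schwartz_le φ ((2 * (N + 1) - s) + (n + 1))
  obtain ⟨K, hK⟩ := exists_tsum_one_add_norm_sub_latt_rpow_le (n := n) (r := n + 1) (by linarith)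
  refine ⟨C' * C * K, fun ξ => ?_⟩
  have hterm (k : Fin n → ℤ) :
      ‖φ (ξ - latt k) • f (latt k) - φ (ξ - latt k) • taylorPoly f N ξ (latt k - ξ)‖ ≤
        C' * C * (1 + ‖ξ‖) ^ (-(N : ℝ)) * (1 + ‖ξ - latt k‖) ^ (-((n : ℝ) + 1)) := by
    rw [← smul_sub, norm_smul]
    have hrem := hC ξ (latt k - ξ)
    rw [add_sub_cancel, norm_sub_rev (latt k)] at hrem
    have hdecay : (1 + ‖ξ‖) ^ (-(N + 1 - s)) ≤ (1 + ‖ξ‖) ^ (-(N : ℝ)) :=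
      Real.rpow_le_rpow_of_exponent_le (by simp) (by linarith)
    calc _ ≤ (C' * (1 + ‖ξ - latt k‖) ^ (-(2 * (N + 1) - s + (n + 1)))) *
          (C * (1 + ‖ξ‖) ^ (-(N : ℝ)) * (1 + ‖ξ - latt k‖) ^ (2 * (N + 1) - s)) := by
          refine mul_le_mul (hC' _) (hrem.trans ?_) (norm_nonneg _) (by positivity)
          gcongr
      _ = C' * C * (1 + ‖ξ‖) ^ (-(N : ℝ)) * ((1 + ‖ξ - latt k‖) ^ (-(2 * (N + 1) - s + (n + 1))) *
            (1 + ‖ξ - latt k‖) ^ (2 * (N + 1) - s)) := by ring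
      _ = _ := by
          rw [← Real.rpow_add (by positivity)]
          congr 2
          ring
  have hsub := (summable_schwartz_sub_smul φ latt (hf.summable hs) ξ).hasSum.sub
    (hasSum_smul_taylorPoly hφ f N ξ)
  calc ‖(∑' k, φ (ξ - latt k) • f (latt k)) - f ξ‖
      ≤ C' * C * (1 + ‖ξ‖) ^ (-(N : ℝ)) *
          ∑' k : Fin n → ℤ, (1 + ‖ξ - latt k‖) ^ (-((n : ℝ) + 1)) :=
        hsub.norm_le_of_bounded ((hK ξ).1.hasSum.mul_left _) hterm
    _ ≤ C' * C * (1 + ‖ξ‖) ^ (-(N : ℝ)) * K :=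
        mul_le_mul_of_nonneg_left (hK ξ).2 (by positivity)
    _ = C' * C * K * (1 + ‖ξ‖) ^ (-(N : ℝ)) := by ring

lemma SymbolBound.rapidDecay_iteratedFDeriv_tsum_sub (hf : SymbolBound s f) (hs : s < -n)
    (hφ : IsMeyer φ) (b : ℕ) :
    RapidDecay (iteratedFDeriv ℝ b fun ξ => (∑' k, φ (ξ - latt k) • f (latt k)) - f ξ) := by
  obtain ⟨hsmooth, hbound⟩ := contDiff_tsum_schwartz_sub_smul φ latt (hf.summable hs)
  refine (hf.rapidDecay_tsum_sub hs hφ).iteratedFDeriv (hsmooth.sub hf.contDiff) (fun b => ?_) b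
  obtain ⟨C, hC⟩ := hbound b
  obtain ⟨C', hC'⟩ := hf.exists_norm_iteratedFDeriv_le (by linarith [n.cast_nonneg (α := ℝ)]) b
  refine ⟨C + C', fun ξ => ?_⟩
  rw [fun_iteratedFDeriv_sub_apply (hsmooth.contDiffAt.of_le (by exact_mod_cast le_top))
    (hf.contDiff.contDiffAt.of_le (by exact_mod_cast le_top))]
  exact (norm_sub_le _ _).trans (add_le_add (hC ξ) (hC' ξ))

end Interpolation

/-! ### Existence of Meyer-type functions -/

/-- Smooth functions on the line supported in `[-1, 1]`. Meyer-type functions are obtained as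
Fourier transforms of products `∏ᵢ aᵢ(xᵢ)` of such functions. -/
@[ext]
structure Bump where
  toFun : ℝ → ℂ
  contDiff : ContDiff ℝ ∞ toFun
  eq_zero : ∀ x, 1 < |x| → toFun x = 0

/-- Multiplication by a smooth function. -/
def Bump.mul {g : ℝ → ℂ} (hg : ContDiff ℝ ∞ g) (a : Bump) : Bump :=
  ⟨fun x => g x * a.toFun x, hg.mul a.contDiff, fun x hx => by simp [a.eq_zero x hx]⟩

lemma Bump.iterate_mul_apply {g : ℝ → ℂ} (hg : ContDiff ℝ ∞ g) (a : Bump) (b : ℕ) (x : ℝ) :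
    ((Bump.mul hg)^[b] a).toFun x = g x ^ b * a.toFun x := by
  induction b generalizing a with
  | zero => simp
  | succ b ih =>
    rw [Function.iterate_succ_apply, ih, pow_succ, Bump.mul, mul_assoc]

/-- The product `∏ᵢ aᵢ(xᵢ)`, as a Schwartz function. -/
def prodBump (a : Fin n → Bump) : 𝓢(E n, ℂ) :=
  HasCompactSupport.toSchwartzMap (f := fun x : E n => ∏ i, (a i).toFun (x i))
    (by
      refine HasCompactSupport.intro (K := (WithLp.toLp 2 : (Fin n → ℝ) → E n) ''
        Set.univ.pi fun _ => Set.Icc (-1) 1) ?_ fun x hx => ?_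
      · exact (isCompact_univ_pi fun _ => isCompact_Icc).image (PiLp.continuous_toLp 2 _)
      · obtain ⟨i, hi⟩ : ∃ i, 1 < |x i| := by
          by_contra! h
          exact hx ⟨x.ofLp, fun i _ => abs_le.1 (h i), rfl⟩
        exact Finset.prod_eq_zero (Finset.mem_univ i) ((a i).eq_zero _ hi))
    (contDiff_prod fun i _ => (a i).contDiff.comp (by fun_prop))

lemma prodBump_apply (a : Fin n → Bump) (x : E n) : prodBump a x = ∏ i, (a i).toFun (x i) := rfl

lemma prodBump_update_mul (a : Fin n → Bump) (j : Fin n) {g : ℝ → ℂ} (hg : ContDiff ℝ ∞ g)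
    (x : E n) :
    prodBump (Function.update a j (Bump.mul hg (a j))) x = g (x j) * prodBump a x := by
  rw [prodBump_apply, prodBump_apply, ← Finset.mul_prod_erase _ _ (Finset.mem_univ j),
    ← Finset.mul_prod_erase _ (fun i => (a i).toFun (x i)) (Finset.mem_univ j)]
  have herase : ∀ i ∈ Finset.univ.erase j,
      (Function.update a j (Bump.mul hg (a j)) i).toFun (x i) = (a i).toFun (x i) := fun i hi => by
    rw [Function.update_of_ne (Finset.ne_of_mem_erase hi)]
  rw [Finset.prod_congr rfl herase, Function.update_self, ← mul_assoc]
  rfl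

lemma multiPow_update {X Y : Type*} {D : Fin n → X → X} {Φ : (Fin n → Y) → X} {T : Y → Y}
    (h : ∀ j a, D j (Φ a) = Φ (Function.update a j (T (a j)))) (β : Fin n → ℕ) (a : Fin n → Y) :
    multiPow D β (Φ a) = Φ fun i => T^[β i] (a i) := by
  have hiter : ∀ (m : ℕ) (j : Fin n) (a : Fin n → Y),
      (D j)^[m] (Φ a) = Φ (Function.update a j (T^[m] (a j))) := by
    intro m j a
    induction m with
    | zero => simp
    | succ m ih =>
      rw [Function.iterate_succ_apply', ih, h]
      simp [Function.iterate_succ_apply']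
  have hfold : ∀ l : List (Fin n), l.Nodup → l.foldr (fun i y => (D i)^[β i] y) (Φ a) =
      Φ fun i => if i ∈ l then T^[β i] (a i) else a i := by
    intro l hl
    induction l with
    | nil => simp
    | cons j l ih =>
      rw [List.nodup_cons] at hl
      rw [List.foldr_cons, ih hl.2, hiter]
      congr 1
      ext i
      by_cases hij : i = j
      · subst hij; simp [hl.1]
      · simp [hij]
  rw [multiPow, hfold _ (List.nodup_finRange n)]
  simp

lemma contDiff_const_mul_ofReal (c : ℂ) : ContDiff ℝ ∞ fun x : ℝ => c * (x : ℂ) :=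
  contDiff_const.mul Complex.ofRealCLM.contDiff

lemma contDiff_one_sub_cexp :
    ContDiff ℝ ∞ fun x : ℝ => 1 - Complex.exp (-(2 * π * Complex.I) * (x : ℂ)) :=
  contDiff_const.sub (contDiff_const_mul_ofReal _).cexp

lemma inner_basisVec (x : E n) (j : Fin n) : inner ℝ x (basisVec j) = x j := by
  simp [basisVec, EuclideanSpace.inner_single_right]

lemma partialD_fourierInv_prodBump (j : Fin n) (a : Fin n → Bump) :
    partialD j (𝓕⁻ (prodBump a) : 𝓢(E n, ℂ)) = (𝓕⁻ (prodBump (Function.update a j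
      (Bump.mul (contDiff_const_mul_ofReal (2 * π * Complex.I)) (a j)))) : 𝓢(E n, ℂ)) := by
  rw [partialD_coe, SchwartzMap.lineDerivOp_fourierInv_eq]
  congr 2
  ext x
  have hg : (fun y : E n => inner ℝ y (basisVec j)).HasTemperateGrowth := by fun_prop
  rw [prodBump_update_mul, smul_apply, SchwartzMap.smulLeftCLM_apply_apply hg, inner_basisVec]
  simp [mul_assoc]

section FourierInv

variable {X : Type*} [NormedAddCommGroup X] [InnerProductSpace ℝ X] [FiniteDimensional ℝ X]
  [MeasurableSpace X] [BorelSpace X]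

lemma schwartz_fourierInv_apply (f : 𝓢(X, ℂ)) (w : X) :
    (𝓕⁻ f : 𝓢(X, ℂ)) w = ∫ v, Complex.exp (2 * π * Complex.I * (inner ℝ v w : ℝ)) * f v := by
  rw [SchwartzMap.fourierInv_coe, Real.fourierInv_eq']
  refine integral_congr_ae (Eventually.of_forall fun v => ?_)
  simp only [smul_eq_mul]
  congr 2
  push_cast
  ring

lemma integrable_cexp_inner_mul_schwartz (f : 𝓢(X, ℂ)) (w : X) :
    Integrable fun v => Complex.exp (2 * π * Complex.I * (inner ℝ v w : ℝ)) * f v := by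
  refine f.integrable.bdd_mul (c := 1) (Continuous.aestronglyMeasurable (by fun_prop)) ?_
  refine Eventually.of_forall fun v => ?_
  rw [show 2 * π * Complex.I * ((inner ℝ v w : ℝ) : ℂ) =
    ((2 * π * inner ℝ v w : ℝ) : ℂ) * Complex.I by push_cast; ring, Complex.norm_exp_ofReal_mul_I]

end FourierInv

lemma backDiff_fourierInv_prodBump (j : Fin n) (a : Fin n → Bump) :
    backDiff j (𝓕⁻ (prodBump a) : 𝓢(E n, ℂ)) = (𝓕⁻ (prodBump (Function.update a j
      (Bump.mul contDiff_one_sub_cexp (a j)))) : 𝓢(E n, ℂ)) := by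
  ext ξ
  rw [backDiff, schwartz_fourierInv_apply, schwartz_fourierInv_apply, schwartz_fourierInv_apply,
    ← integral_sub (integrable_cexp_inner_mul_schwartz _ _)
      (integrable_cexp_inner_mul_schwartz _ _)]
  refine integral_congr_ae (Eventually.of_forall fun v => ?_)
  simp only [prodBump_update_mul, inner_sub_right, inner_basisVec, Complex.ofReal_sub, mul_sub,
    Complex.exp_sub, neg_mul, Complex.exp_neg]
  ring

lemma contDiff_dslope_exp :
    ContDiff ℝ ∞ fun x : ℝ => dslope Complex.exp 0 (-(2 * π * Complex.I) * (x : ℂ)) := by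
  have hentire : Differentiable ℂ (dslope Complex.exp 0) := by
    rw [← differentiableOn_univ, Complex.differentiableOn_dslope univ_mem]
    exact Complex.differentiable_exp.differentiableOn
  exact (hentire.contDiff.restrict_scalars ℝ).comp (contDiff_const_mul_ofReal _)

lemma two_pi_I_mul_dslope_exp (x : ℝ) : 2 * π * Complex.I * (x : ℂ) *
    dslope Complex.exp 0 (-(2 * π * Complex.I) * (x : ℂ)) =
      1 - Complex.exp (-(2 * π * Complex.I) * (x : ℂ)) := by
  have h := sub_smul_dslope Complex.exp 0 (-(2 * π * Complex.I) * (x : ℂ))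
  rw [smul_eq_mul, Complex.exp_zero, sub_zero] at h
  linear_combination -h

lemma dslope_exp_ne_zero {x : ℝ} (hx : |x| < 1) :
    dslope Complex.exp 0 (-(2 * π * Complex.I) * (x : ℂ)) ≠ 0 := by
  rcases eq_or_ne x 0 with rfl | hx0
  · simp [dslope_same]
  intro h
  have hexp := two_pi_I_mul_dslope_exp x
  rw [h, mul_zero, eq_comm, sub_eq_zero, eq_comm, Complex.exp_eq_one_iff] at hexp
  obtain ⟨m, hm⟩ := hexp
  have hxm : -x = m := by
    have : -(x : ℂ) = m := mul_left_cancel₀ Complex.two_pi_I_ne_zero (by linear_combination hm)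
    exact_mod_cast this
  have hm0 : m = 0 := by
    rw [← abs_neg, hxm, ← Int.cast_abs] at hx
    exact Int.abs_lt_one_iff.1 (by exact_mod_cast hx)
  exact hx0 (neg_eq_zero.1 (by simpa [hm0] using hxm))

/-- A smooth step, vanishing for `x ≤ -3/4` and equal to `1` for `x ≥ -1/4`. -/
def meyerStep (x : ℝ) : ℝ := Real.smoothTransition (2 * x + 3 / 2)

lemma contDiff_meyerStep : ContDiff ℝ ∞ meyerStep :=
  Real.smoothTransition.contDiff.comp (by fun_prop)

lemma meyerStep_eq_zero {x : ℝ} (hx : x ≤ -(3 / 4)) : meyerStep x = 0 :=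
  Real.smoothTransition.zero_of_nonpos (by linarith)

lemma meyerStep_eq_one {x : ℝ} (hx : -(1 / 4) ≤ x) : meyerStep x = 1 :=
  Real.smoothTransition.one_of_one_le (by linarith)

/-- The one-dimensional profile of the Fourier transform of a Meyer-type function: a bump whose
integer translates sum to `1`. -/
def meyerProfile (x : ℝ) : ℂ := ((meyerStep x - meyerStep (x - 1) : ℝ) : ℂ)

lemma meyerProfile_eq_zero {x : ℝ} (hx : 3 / 4 ≤ |x|) : meyerProfile x = 0 := by
  rcases le_abs.1 hx with h | h
  · rw [meyerProfile, meyerStep_eq_one (by linarith), meyerStep_eq_one (by linarith)]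
    simp
  · rw [meyerProfile, meyerStep_eq_zero (by linarith), meyerStep_eq_zero (by linarith)]
    simp

lemma meyerProfile_zero : meyerProfile 0 = 1 := by
  rw [meyerProfile, meyerStep_eq_one (by norm_num), meyerStep_eq_zero (by norm_num)]
  simp

lemma contDiff_meyerProfile : ContDiff ℝ ∞ meyerProfile :=
  Complex.ofRealCLM.contDiff.comp
    (contDiff_meyerStep.sub (contDiff_meyerStep.comp (contDiff_id.sub contDiff_const)))

/-- The bump `(2πix / (1 - e^{-2πix}))^b h(x)`, where `h` is the profile. On the Fourier side it
turns `b` partial derivatives into `b` backward differences. -/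
def meyerBump (b : ℕ) : Bump where
  toFun x := (dslope Complex.exp 0 (-(2 * π * Complex.I) * (x : ℂ)))⁻¹ ^ b * meyerProfile x
  contDiff := by
    rw [contDiff_iff_contDiffAt]
    intro x
    by_cases hx : |x| < 1
    · exact ((contDiff_dslope_exp.contDiffAt.inv (dslope_exp_ne_zero hx)).pow b).mul
        contDiff_meyerProfile.contDiffAt
    · have : ∀ᶠ y in 𝓝 x, 3 / 4 < |y| :=
        (continuous_abs.continuousAt).eventually_const_lt (by linarith [not_lt.1 hx])
      refine (contDiffAt_const (c := (0 : ℂ))).congr_of_eventuallyEq ?_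
      filter_upwards [this] with y hy
      rw [meyerProfile_eq_zero hy.le, mul_zero]
  eq_zero x hx := by rw [meyerProfile_eq_zero (by linarith), mul_zero]

lemma meyerBump_zero_apply (x : ℝ) : (meyerBump 0).toFun x = meyerProfile x := by
  simp [meyerBump]

lemma iterate_mul_meyerBump_zero (b : ℕ) :
    (Bump.mul (contDiff_const_mul_ofReal (2 * π * Complex.I)))^[b] (meyerBump 0) =
      (Bump.mul contDiff_one_sub_cexp)^[b] (meyerBump b) := by
  ext x
  rw [Bump.iterate_mul_apply, Bump.iterate_mul_apply, meyerBump_zero_apply]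
  by_cases hx : 3 / 4 ≤ |x|
  · simp [meyerBump, meyerProfile_eq_zero hx]
  · have := dslope_exp_ne_zero (x := x) (by linarith [not_le.1 hx])
    rw [meyerBump, ← mul_assoc, ← mul_pow, ← two_pi_I_mul_dslope_exp, mul_assoc _ _ (_⁻¹),
      mul_inv_cancel₀ this, mul_one]

lemma intervalIntegral_sub_comp_sub_one {F : Type*} [NormedAddCommGroup F] [NormedSpace ℝ F]
    {f : ℝ → F} (hf : Continuous f) :
    ∫ x in (-1 : ℝ)..1, (f x - f (x - 1)) =
      (∫ x in (0 : ℝ)..1, f x) - ∫ x in (-2 : ℝ)..(-1), f x := by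
  have hi (a b : ℝ) : IntervalIntegrable f volume a b := hf.intervalIntegrable a b
  have hf' : Continuous fun x => f (x - 1) := by fun_prop
  rw [intervalIntegral.integral_sub (hi _ _) (hf'.intervalIntegrable _ _),
    intervalIntegral.integral_comp_sub_right, show (-1 : ℝ) - 1 = -2 by norm_num, sub_self,
    ← intervalIntegral.integral_add_adjacent_intervals (hi (-1) 0) (hi 0 1),
    ← intervalIntegral.integral_add_adjacent_intervals (hi (-2) (-1)) (hi (-1) 0)]
  abel

lemma intervalIntegral_cexp_two_pi_I_int_mul (k : ℤ) :
    ∫ x in (0 : ℝ)..1, Complex.exp (2 * π * Complex.I * (k * x : ℝ)) = if k = 0 then 1 else 0 := by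
  split_ifs with hk
  · simp [hk]
  · have hc : (2 * π * Complex.I * k : ℂ) ≠ 0 :=
      mul_ne_zero Complex.two_pi_I_ne_zero (by exact_mod_cast hk)
    simp only [Complex.ofReal_mul, Complex.ofReal_intCast, ← mul_assoc]
    rw [integral_exp_mul_complex hc, Complex.ofReal_one, mul_one, Complex.ofReal_zero, mul_zero,
      Complex.exp_zero, mul_comm _ (k : ℂ), Complex.exp_int_mul_two_pi_mul_I, sub_self, zero_div]

/-- As the integer translates of the profile sum to `1`, its Fourier transform at `k ∈ ℤ` is that
of the indicator function of a period. -/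
lemma integral_cexp_mul_meyerProfile (k : ℤ) :
    ∫ x : ℝ, Complex.exp (2 * π * Complex.I * (k * x : ℝ)) * meyerProfile x =
      if k = 0 then 1 else 0 := by
  let e : ℝ → ℂ := fun x => Complex.exp (2 * π * Complex.I * (k * x : ℝ))
  let f : ℝ → ℂ := fun x => e x * (meyerStep x : ℂ)
  have he : Continuous e := by fun_prop
  have hf : Continuous f := he.mul (Complex.continuous_ofReal.comp contDiff_meyerStep.continuous)
  have hper (x : ℝ) : e (x - 1) = e x := by
    have : 2 * π * Complex.I * ((k * (x - 1) : ℝ) : ℂ) =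
        2 * π * Complex.I * ((k * x : ℝ) : ℂ) - k * (2 * π * Complex.I) := by push_cast; ring
    simp only [e, this, Complex.exp_sub, Complex.exp_int_mul_two_pi_mul_I, div_one]
  have hsupp : (Function.support fun x => e x * meyerProfile x) ⊆ Set.Ioc (-1) 1 := by
    intro x hx
    have : |x| < 3 / 4 := not_le.1 fun h => hx (by simp [meyerProfile_eq_zero h])
    exact ⟨by linarith [(abs_lt.1 this).1], by linarith [(abs_lt.1 this).2]⟩
  have hzero : ∫ x in (-2 : ℝ)..(-1), f x = 0 := by
    rw [intervalIntegral.integral_congr (g := fun _ => 0), intervalIntegral.integral_zero]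
    intro x hx
    rw [Set.uIcc_of_le (by norm_num)] at hx
    simp [f, meyerStep_eq_zero (show x ≤ -(3 / 4) by linarith [hx.2])]
  have hone : ∫ x in (0 : ℝ)..1, f x = ∫ x in (0 : ℝ)..1, e x := by
    refine intervalIntegral.integral_congr fun x hx => ?_
    rw [Set.uIcc_of_le zero_le_one] at hx
    simp [f, meyerStep_eq_one (show -(1 / 4) ≤ x by linarith [hx.1])]
  calc ∫ x : ℝ, e x * meyerProfile x
      = ∫ x in (-1 : ℝ)..1, (f x - f (x - 1)) := by
        rw [← intervalIntegral.integral_eq_integral_of_support_subset hsupp]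
        refine intervalIntegral.integral_congr fun x _ => ?_
        simp only [f, hper, meyerProfile, Complex.ofReal_sub, mul_sub]
    _ = ∫ x in (0 : ℝ)..1, e x := by
        rw [intervalIntegral_sub_comp_sub_one hf, hzero, hone, sub_zero]
    _ = if k = 0 then 1 else 0 := intervalIntegral_cexp_two_pi_I_int_mul k

lemma integral_euclideanSpace_prod_eq_prod (f : Fin n → ℝ → ℂ) :
    ∫ x : E n, ∏ i, f i (x i) = ∏ i, ∫ x, f i x := by
  rw [← integral_fintype_prod_volume_eq_prod,
    ← (EuclideanSpace.volume_preserving_symm_measurableEquiv_toLp (Fin n)).integral_comp']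
  rfl

lemma fourierInv_prodBump_latt (k : Fin n → ℤ) :
    (𝓕⁻ (prodBump fun _ : Fin n => meyerBump 0) : 𝓢(E n, ℂ)) (latt k) =
      if k = 0 then 1 else 0 := by
  have hprod (v : E n) : Complex.exp (2 * π * Complex.I * (inner ℝ v (latt k) : ℝ)) *
      prodBump (fun _ : Fin n => meyerBump 0) v =
      ∏ i, Complex.exp (2 * π * Complex.I * (k i * v i : ℝ)) * meyerProfile (v i) := by
    rw [prodBump_apply, Finset.prod_mul_distrib, ← Complex.exp_sum, ← Finset.mul_sum]
    simp only [meyerBump_zero_apply]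
    congr 3
    rw [PiLp.inner_apply]
    push_cast
    exact Finset.sum_congr rfl fun i _ => by simp
  simp only [schwartz_fourierInv_apply, hprod]
  rw [integral_euclideanSpace_prod_eq_prod fun i x =>
    Complex.exp (2 * π * Complex.I * (k i * x : ℝ)) * meyerProfile x]
  simp only [integral_cexp_mul_meyerProfile]
  split_ifs with hk
  · simp [hk]
  · obtain ⟨i, hi⟩ := Function.ne_iff.1 hk
    exact Finset.prod_eq_zero (Finset.mem_univ i) (if_neg hi)

theorem exists_isMeyer (n : ℕ) : ∃ φ : 𝓢(E n, ℂ), IsMeyer φ := by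
  refine ⟨𝓕⁻ (prodBump fun _ => meyerBump 0), ?_, fun k hk => ?_, fun β => ?_, ?_⟩
  · rw [← latt_zero, fourierInv_prodBump_latt, if_pos rfl]
  · rw [fourierInv_prodBump_latt, if_neg hk]
  · refine ⟨𝓕⁻ (prodBump fun i => meyerBump (β i)), ?_⟩
    let Φ (a : Fin n → Bump) : E n → ℂ := (𝓕⁻ (prodBump a) : 𝓢(E n, ℂ))
    calc multiPow partialD β (Φ fun _ => meyerBump 0)
        = Φ fun i => (Bump.mul (contDiff_const_mul_ofReal _))^[β i] (meyerBump 0) :=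
          multiPow_update partialD_fourierInv_prodBump β _
      _ = Φ fun i => (Bump.mul contDiff_one_sub_cexp)^[β i] (meyerBump (β i)) := by
          simp only [iterate_mul_meyerBump_zero]
      _ = multiPow backDiff β (Φ fun i => meyerBump (β i)) :=
          (multiPow_update backDiff_fourierInv_prodBump β _).symm
  · have hone : (𝓕 (𝓕⁻ (prodBump fun _ : Fin n => meyerBump 0) : 𝓢(E n, ℂ)) : 𝓢(E n, ℂ)) 0 = 1 := by
      rw [FourierTransform.fourier_fourierInv_eq, prodBump_apply]
      exact Finset.prod_eq_one fun i _ => by rw [meyerBump_zero_apply, PiLp.zero_apply,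
        meyerProfile_zero]
    rw [← hone, SchwartzMap.fourier_coe, Real.fourier_eq']
    simp

/-! ### Weyl unitaries -/

lemma latt_add (k l : Fin n → ℤ) : latt (k + l) = latt k + latt l := by
  ext i; simp

lemma inner_latt_single (k : Fin n → ℤ) (j : Fin n) (c : ℝ) :
    inner ℝ (latt k) (EuclideanSpace.single j c) = k j * c := by
  rw [EuclideanSpace.inner_single_right]
  simp [mul_comm]

/-- The projection `ℝⁿ → 𝕋ⁿ`. -/
def toTorus (v : E n) : Torus n := fun i => ((v i : ℝ) : AddCircle (2 * π))

lemma toTorus_add (v w : E n) : toTorus (v + w) = toTorus v + toTorus w := rfl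

lemma toTorus_zero : toTorus (0 : E n) = 0 := rfl

lemma coeFn_mulOp (f : C(Torus n, ℂ)) (g : L2 n) :
    mulOp f g =ᵐ[torusMeasure n] fun x => f x * g x := by
  have hmul : mulOp f g =ᵐ[torusMeasure n] fun x =>
      (ContinuousMap.toLp ∞ (torusMeasure n) ℂ f) x * g x :=
    (ContinuousLinearMap.mul ℂ ℂ).coeFn_holder (r := 2)
      (ContinuousMap.toLp ∞ (torusMeasure n) ℂ f) g
  filter_upwards [hmul, ContinuousMap.coeFn_toLp (p := ∞) (𝕜 := ℂ) (torusMeasure n) f]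
    with x hx hf
  rw [hx, hf]

lemma coeFn_V (s : E n) (g : L2 n) :
    V s g =ᵐ[torusMeasure n] fun x => g (x + toTorus s) :=
  Lp.coeFn_compMeasurePreserving g (measurePreserving_add_right (torusMeasure n) (toTorus s))

lemma ae_add_right {p : Torus n → Prop} (a : Torus n) (h : ∀ᵐ x ∂torusMeasure n, p x) :
    ∀ᵐ x ∂torusMeasure n, p (x + a) :=
  (measurePreserving_add_right (torusMeasure n) a).quasiMeasurePreserving.ae h

lemma mulOp_mul (f g : C(Torus n, ℂ)) : mulOp (f * g) = mulOp f * mulOp g := by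
  ext1 u
  apply Lp.ext
  filter_upwards [coeFn_mulOp f (mulOp g u), coeFn_mulOp g u, coeFn_mulOp (f * g) u]
    with x hfg hg hprod
  rw [mul_apply_eq_comp, hfg, hg, hprod, ContinuousMap.mul_apply, mul_assoc]

lemma mulOp_one : mulOp (1 : C(Torus n, ℂ)) = 1 := by
  ext1 u
  apply Lp.ext
  filter_upwards [coeFn_mulOp 1 u] with x hx
  simp [hx]

lemma norm_mulOp_apply {f : C(Torus n, ℂ)} (hf : ∀ x, ‖f x‖ = 1) (u : L2 n) :
    ‖mulOp f u‖ = ‖u‖ := by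
  rw [Lp.norm_def, Lp.norm_def]
  congr 1
  refine eLpNorm_congr_norm_ae ?_
  filter_upwards [coeFn_mulOp f u] with x hx
  rw [hx, norm_mul, hf, one_mul]

lemma V_add (s t : E n) : V (s + t) = V s * V t := by
  ext1 u
  apply Lp.ext
  filter_upwards [coeFn_V s (V t u), ae_add_right (toTorus s) (coeFn_V t u), coeFn_V (s + t) u]
    with x hs ht hst
  rw [mul_apply_eq_comp, hs, ht, hst, toTorus_add, add_assoc]

lemma V_zero : V (0 : E n) = 1 := by
  ext1 u
  apply Lp.ext
  filter_upwards [coeFn_V 0 u] with x hx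
  simp [hx, toTorus_zero]

lemma inner_V_V (s : E n) (f g : L2 n) : (inner ℂ (V s f) (V s g) : ℂ) = inner ℂ f g :=
  (Lp.compMeasurePreservingₗᵢ (p := 2) (E := ℂ) ℂ _
    (measurePreserving_add_right (torusMeasure n) (toTorus s))).inner_map_map f g

lemma norm_V_apply (s : E n) (u : L2 n) : ‖V s u‖ = ‖u‖ :=
  Lp.norm_compMeasurePreserving u (measurePreserving_add_right (torusMeasure n) (toTorus s))

lemma V_mul_mulOp {s : E n} {f : C(Torus n, ℂ)} {c : ℂ}
    (hf : ∀ x, f (x + toTorus s) = c * f x) : V s * mulOp f = c • (mulOp f * V s) := by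
  ext1 u
  apply Lp.ext
  have hsmul := Lp.coeFn_smul c (mulOp f (V s u))
  filter_upwards [coeFn_V s (mulOp f u), ae_add_right (toTorus s) (coeFn_mulOp f u),
    coeFn_mulOp f (V s u), coeFn_V s u, hsmul] with x hV hshift hmul hVu hsmul
  rw [mul_apply_eq_comp, hV, hshift, hf]
  refine Eq.trans ?_ hsmul.symm
  rw [Pi.smul_apply, hmul, hVu, smul_eq_mul, mul_assoc]

/-- The character `e^{i k·x}` of `𝕋ⁿ`. -/
def expChar (k : Fin n → ℤ) : C(Torus n, ℂ) where
  toFun x := ∏ i, fourier (k i) (x i)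
  continuous_toFun := by fun_prop

lemma expChar_apply (k : Fin n → ℤ) (x : Torus n) : expChar k x = ∏ i, fourier (k i) (x i) := rfl

lemma expChar_add (k l : Fin n → ℤ) : expChar (k + l) = expChar k * expChar l := by
  ext x
  simp only [expChar_apply, ContinuousMap.mul_apply, Pi.add_apply, fourier_add,
    Finset.prod_mul_distrib]

lemma expChar_zero : expChar (0 : Fin n → ℤ) = 1 := by
  ext x
  simp [expChar_apply]

lemma expChar_single (j : Fin n) : expChar (Pi.single j 1) = expCoord j := by
  ext x
  rw [expChar_apply, Finset.prod_eq_single j]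
  · simp [expCoord]
  · intro i _ hi
    simp [hi]
  · simp

lemma norm_expChar_apply (k : Fin n → ℤ) (x : Torus n) : ‖expChar k x‖ = 1 := by
  rw [expChar_apply, norm_prod]
  exact Finset.prod_eq_one fun i _ => by rw [fourier_apply, Circle.norm_coe]

lemma expChar_neg_apply (k : Fin n → ℤ) (x : Torus n) :
    expChar (-k) x = starRingEnd ℂ (expChar k x) := by
  simp only [expChar_apply, Pi.neg_apply, fourier_neg, map_prod]

lemma fourier_add_coe (m : ℤ) (x : AddCircle (2 * π)) (t : ℝ) :
    fourier m (x + (t : AddCircle (2 * π))) =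
      Complex.exp (Complex.I * (m * t : ℝ)) * fourier m x := by
  have hcoe : (fourier m (t : AddCircle (2 * π)) : ℂ) = Complex.exp (Complex.I * (m * t : ℝ)) := by
    rw [fourier_coe_apply]
    congr 1
    have : (π : ℂ) ≠ 0 := by exact_mod_cast pi_ne_zero
    push_cast
    field_simp
  rw [← hcoe]
  simp only [fourier_apply, smul_add, AddCircle.toCircle_add, Circle.coe_mul]
  ring

lemma expChar_add_toTorus (k : Fin n → ℤ) (v : E n) (x : Torus n) :
    expChar k (x + toTorus v) =
      Complex.exp (Complex.I * (inner ℝ (latt k) v : ℝ)) * expChar k x := by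
  simp only [expChar_apply, Pi.add_apply, toTorus, fourier_add_coe, Finset.prod_mul_distrib]
  rw [← Complex.exp_sum, ← Finset.mul_sum, PiLp.inner_apply, Complex.ofReal_sum]
  simp [mul_comm]

lemma V_mul_mulOp_expChar (s : E n) (k : Fin n → ℤ) :
    V s * mulOp (expChar k) =
      Complex.exp (Complex.I * (inner ℝ (latt k) s : ℝ)) • (mulOp (expChar k) * V s) :=
  V_mul_mulOp (expChar_add_toTorus k s)

/-- The vector `πθk`, by which the Weyl unitary `W_k` translates. -/
def weylShift (θ : Matrix (Fin n) (Fin n) ℝ) (k : Fin n → ℤ) : E n :=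
  π • Matrix.toEuclideanLin θ (latt k)

lemma weylShift_add (θ : Matrix (Fin n) (Fin n) ℝ) (k l : Fin n → ℤ) :
    weylShift θ (k + l) = weylShift θ k + weylShift θ l := by
  rw [weylShift, latt_add, map_add, smul_add]
  rfl

lemma weylShift_zero (θ : Matrix (Fin n) (Fin n) ℝ) : weylShift θ 0 = 0 := by
  simp [weylShift]

/-- The Weyl unitaries `(W_k f)(x) = e^{i k·x} f(x + πθk)`, which are unimodular multiples of the
monomials `U₁^{k₁} ⋯ Uₙ^{kₙ}`. -/
def W (θ : Matrix (Fin n) (Fin n) ℝ) (k : Fin n → ℤ) : B n :=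
  mulOp (expChar k) * V (weylShift θ k)

/-- The cocycle `c(k, l) = e^{iπ l·θk}` of the Weyl unitaries. -/
def cocycle (θ : Matrix (Fin n) (Fin n) ℝ) (k l : Fin n → ℤ) : ℂ :=
  Complex.exp (Complex.I * (inner ℝ (latt l) (weylShift θ k) : ℝ))

lemma norm_cocycle (θ : Matrix (Fin n) (Fin n) ℝ) (k l : Fin n → ℤ) : ‖cocycle θ k l‖ = 1 :=
  Complex.norm_exp_I_mul_ofReal _

lemma cocycle_ne_zero (θ : Matrix (Fin n) (Fin n) ℝ) (k l : Fin n → ℤ) : cocycle θ k l ≠ 0 :=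
  Complex.exp_ne_zero _

lemma W_mul (θ : Matrix (Fin n) (Fin n) ℝ) (k l : Fin n → ℤ) :
    W θ k * W θ l = cocycle θ k l • W θ (k + l) := by
  calc W θ k * W θ l
      = mulOp (expChar k) * (V (weylShift θ k) * mulOp (expChar l)) * V (weylShift θ l) := by
        simp only [W, mul_assoc]
    _ = cocycle θ k l • ((mulOp (expChar k) * mulOp (expChar l)) *
          (V (weylShift θ k) * V (weylShift θ l))) := by
        rw [V_mul_mulOp_expChar, mul_smul_comm, smul_mul_assoc, cocycle]
        simp only [mul_assoc]
    _ = cocycle θ k l • W θ (k + l) := by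
        rw [← mulOp_mul, ← V_add, ← expChar_add, ← weylShift_add, W]

lemma W_zero (θ : Matrix (Fin n) (Fin n) ℝ) : W θ 0 = 1 := by
  rw [W, expChar_zero, mulOp_one, weylShift_zero, V_zero, mul_one]

lemma U_eq_W (θ : Matrix (Fin n) (Fin n) ℝ) (j : Fin n) : U θ j = W θ (Pi.single j 1) := by
  have hshift : toTorus (weylShift θ (Pi.single j 1)) =
      fun i => ((π * θ i j : ℝ) : AddCircle (2 * π)) := by
    ext i
    simp [toTorus, weylShift, latt_single, basisVec]
  rw [U, W, expChar_single, ← hshift]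
  rfl

lemma norm_W_apply (θ : Matrix (Fin n) (Fin n) ℝ) (k : Fin n → ℤ) (u : L2 n) :
    ‖W θ k u‖ = ‖u‖ := by
  rw [W, mul_apply_eq_comp, norm_mulOp_apply (norm_expChar_apply k), norm_V_apply]

lemma norm_W_le (θ : Matrix (Fin n) (Fin n) ℝ) (k : Fin n → ℤ) : ‖W θ k‖ ≤ 1 :=
  ContinuousLinearMap.opNorm_le_bound _ zero_le_one fun u => by rw [norm_W_apply, one_mul]

lemma norm_smul_W_le (θ : Matrix (Fin n) (Fin n) ℝ) (c : ℂ) (k : Fin n → ℤ) :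
    ‖c • W θ k‖ ≤ ‖c‖ := by
  rw [norm_smul]
  exact mul_le_of_le_one_right (norm_nonneg _) (norm_W_le θ k)

lemma star_W_mul_W (θ : Matrix (Fin n) (Fin n) ℝ) (k : Fin n → ℤ) :
    star (W θ k) * W θ k = 1 := by
  rw [ContinuousLinearMap.star_eq_adjoint]
  exact (ContinuousLinearMap.norm_map_iff_adjoint_comp_self _).1 (norm_W_apply θ k)

lemma W_mul_smul_W_neg (θ : Matrix (Fin n) (Fin n) ℝ) (k : Fin n → ℤ) :
    W θ k * (cocycle θ k (-k))⁻¹ • W θ (-k) = 1 := by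
  rw [mul_smul_comm, W_mul, add_neg_cancel, W_zero, inv_smul_smul₀ (cocycle_ne_zero θ k _)]

lemma star_W (θ : Matrix (Fin n) (Fin n) ℝ) (k : Fin n → ℤ) :
    star (W θ k) = (cocycle θ k (-k))⁻¹ • W θ (-k) :=
  left_inv_eq_right_inv (star_W_mul_W θ k) (W_mul_smul_W_neg θ k)

lemma W_mul_star_W (θ : Matrix (Fin n) (Fin n) ℝ) (k : Fin n → ℤ) :
    W θ k * star (W θ k) = 1 := by
  rw [star_W, W_mul_smul_W_neg]

/-! ### The action of `ℝⁿ` and the state `τ` -/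

/-- `α_s` as a continuous linear map. -/
def actL (s : E n) : B n →L[ℂ] B n :=
  (ContinuousLinearMap.mul ℂ (B n) (V s)) ∘L ((ContinuousLinearMap.mul ℂ (B n)).flip (V (-s)))

lemma actL_apply (s : E n) (T : B n) : actL s T = act s T := by
  simp [actL, act, mul_assoc]

lemma act_add (s t : E n) (T : B n) : act (s + t) T = act s (act t T) := by
  simp only [act, neg_add_rev, V_add, mul_assoc]

lemma act_W (θ : Matrix (Fin n) (Fin n) ℝ) (s : E n) (k : Fin n → ℤ) :
    act s (W θ k) = Complex.exp (Complex.I * (inner ℝ (latt k) s : ℝ)) • W θ k := by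
  calc act s (W θ k) = (V s * mulOp (expChar k)) * (V (weylShift θ k) * V (-s)) := by
        simp only [act, W, mul_assoc]
    _ = Complex.exp (Complex.I * (inner ℝ (latt k) s : ℝ)) • (mulOp (expChar k) *
          (V s * (V (weylShift θ k) * V (-s)))) := by
        rw [V_mul_mulOp_expChar, smul_mul_assoc, mul_assoc]
    _ = Complex.exp (Complex.I * (inner ℝ (latt k) s : ℝ)) • W θ k := by
        rw [← V_add, ← V_add, W, add_neg_cancel_comm_assoc]

lemma V_oneL2 (s : E n) : V s (oneL2 n) = oneL2 n := by
  apply Lp.ext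
  have hconst := Lp.coeFn_const (p := 2) (μ := torusMeasure n) (1 : ℂ)
  filter_upwards [coeFn_V s (oneL2 n), hconst, ae_add_right (toTorus s) hconst]
    with x hV hone hshift
  rw [hV]
  exact hshift.trans hone.symm

lemma norm_oneL2 : ‖oneL2 n‖ = 1 := by
  refine (Lp.norm_const' (p := 2) (μ := torusMeasure n) (c := (1 : ℂ)) (by simp) (by simp)).trans ?_
  simp

/-- The state `τ` as a continuous linear form. -/
def τL (n : ℕ) : B n →L[ℂ] ℂ :=
  (innerSL ℂ (oneL2 n)) ∘L (ContinuousLinearMap.apply ℂ (L2 n) (oneL2 n))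

lemma τ_smul (c : ℂ) (T : B n) : τ (c • T) = c * τ T := (τL n).map_smul c T

lemma norm_τ_le (T : B n) : ‖τ T‖ ≤ ‖T‖ :=
  calc ‖τ T‖ ≤ ‖oneL2 n‖ * ‖T (oneL2 n)‖ := norm_inner_le_norm _ _
    _ ≤ ‖oneL2 n‖ * (‖T‖ * ‖oneL2 n‖) := by gcongr; exact T.le_opNorm _
    _ = ‖T‖ := by rw [norm_oneL2, mul_one, one_mul]

lemma τ_act (s : E n) (T : B n) : τ (act s T) = τ T :=
  calc τ (act s T) = inner ℂ (V s (oneL2 n)) (V s (T (oneL2 n))) := by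
        rw [τ, act, mul_apply_eq_comp, mul_apply_eq_comp, V_oneL2, V_oneL2]
    _ = τ T := inner_V_V s _ _

lemma τ_W (θ : Matrix (Fin n) (Fin n) ℝ) (k : Fin n → ℤ) :
    τ (W θ k) = if k = 0 then 1 else 0 := by
  split_ifs with hk
  · rw [hk, W_zero, τ, one_apply_eq_self, inner_self_eq_norm_sq_to_K, norm_oneL2]
    simp
  · obtain ⟨j, hj⟩ := Function.ne_iff.1 hk
    have hkj : (k j : ℝ) ≠ 0 := by exact_mod_cast hj
    -- Translation by half a period of `W_k` in a direction with `k_j ≠ 0` maps `W_k` to `-W_k`.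
    have hinv := τ_act (EuclideanSpace.single j (π / k j)) (W θ k)
    rw [act_W, τ_smul, inner_latt_single, mul_div_cancel₀ _ hkj, mul_comm Complex.I,
      Complex.exp_pi_mul_I] at hinv
    have htwo : (2 : ℂ) * τ (W θ k) = 0 := by linear_combination -hinv
    simpa using htwo

/-! ### The algebra `A_θ` and its Fourier coefficients -/

section Algebra

variable {θ : Matrix (Fin n) (Fin n) ℝ}

lemma isClosed_A : IsClosed (A θ : Set (B n)) := StarSubalgebra.isClosed_topologicalClosure _

lemma hasSum_mem_A {ι : Type*} {f : ι → B n} {u : B n} (hf : ∀ i, f i ∈ A θ) (h : HasSum f u) :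
    u ∈ A θ :=
  isClosed_A.mem_of_tendsto h (Eventually.of_forall fun _ => sum_mem fun i _ => hf i)

lemma W_mem_adjoin (k : Fin n → ℤ) : W θ k ∈ StarAlgebra.adjoin ℂ (Set.range (U θ)) := by
  set S := StarAlgebra.adjoin ℂ (Set.range (U θ))
  have mem_of_smul_mem {c : ℂ} (hc : c ≠ 0) {T : B n} (h : c • T ∈ S) : T ∈ S := by
    simpa [inv_smul_smul₀ hc] using SMulMemClass.smul_mem c⁻¹ h
  let G : AddSubgroup (Fin n → ℤ) :=
    { carrier := {k | W θ k ∈ S}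
      zero_mem' := show W θ 0 ∈ S from W_zero θ ▸ one_mem S
      add_mem' := fun {k l} hk hl => mem_of_smul_mem (cocycle_ne_zero θ k l)
        (W_mul θ k l ▸ mul_mem hk hl)
      neg_mem' := fun {k} hk => mem_of_smul_mem (inv_ne_zero (cocycle_ne_zero θ k (-k)))
        (star_W θ k ▸ star_mem hk) }
  have hgen (j : Fin n) : Pi.single j 1 ∈ G :=
    show W θ (Pi.single j 1) ∈ S from U_eq_W θ j ▸ StarAlgebra.subset_adjoin ℂ _ ⟨j, rfl⟩
  have hk : k = ∑ j, k j • (Pi.single j 1 : Fin n → ℤ) := by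
    ext i
    simp [Finset.sum_apply, Pi.single_apply]
  change k ∈ G
  rw [hk]
  exact sum_mem fun j _ => zsmul_mem (hgen j) _

lemma W_mem_A (k : Fin n → ℤ) : W θ k ∈ A θ :=
  StarSubalgebra.le_topologicalClosure _ (W_mem_adjoin k)

lemma exists_eq_smul_W_of_mem_closure {T : B n}
    (hT : T ∈ Submonoid.closure (Set.range (U θ) ∪ star (Set.range (U θ)))) :
    ∃ (c : ℂ) (k : Fin n → ℤ), T = c • W θ k := by
  induction hT using Submonoid.closure_induction with
  | mem T hT =>
    rcases hT with ⟨j, rfl⟩ | ⟨j, hj⟩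
    · exact ⟨1, Pi.single j 1, by rw [U_eq_W, one_smul]⟩
    · exact ⟨_, -Pi.single j 1, by rw [← star_star T, ← hj, U_eq_W, star_W]⟩
  | one => exact ⟨1, 0, by rw [W_zero, one_smul]⟩
  | mul S T _ _ hS hT =>
    obtain ⟨c, k, rfl⟩ := hS
    obtain ⟨d, l, rfl⟩ := hT
    exact ⟨c * d * cocycle θ k l, k + l, by rw [smul_mul_smul_comm, W_mul, smul_smul]⟩

lemma mem_of_mem_A {K : Submodule ℂ (B n)} (hK : IsClosed (K : Set (B n)))
    (hW : ∀ k, W θ k ∈ K) {u : B n} (hu : u ∈ A θ) : u ∈ K := by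
  have hadjoin : (StarAlgebra.adjoin ℂ (Set.range (U θ))).toSubalgebra.toSubmodule ≤ K := by
    rw [StarAlgebra.adjoin_eq_span, Submodule.span_le]
    intro T hT
    obtain ⟨c, k, rfl⟩ := exists_eq_smul_W_of_mem_closure hT
    exact K.smul_mem c (hW k)
  exact closure_minimal (fun T hT => hadjoin hT) hK hu

lemma eqOn_A {X : Type*} [NormedAddCommGroup X] [NormedSpace ℂ X]
    {L₁ L₂ : B n →L[ℂ] X} (h : ∀ k, L₁ (W θ k) = L₂ (W θ k)) : Set.EqOn L₁ L₂ (A θ) := by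
  intro u hu
  have := mem_of_mem_A (K := LinearMap.ker (L₁ - L₂ : B n →L[ℂ] X).toLinearMap)
    (L₁ - L₂).isClosed_ker (fun k => by simp [h k]) hu
  simpa [sub_eq_zero] using this

lemma act_mem_A (s : E n) {u : B n} (hu : u ∈ A θ) : act s u ∈ A θ := by
  rw [← actL_apply]
  refine mem_of_mem_A (K := (A θ).toSubalgebra.toSubmodule.comap (actL s).toLinearMap)
    (isClosed_A.preimage (actL s).continuous) (fun k => ?_) hu
  change actL s (W θ k) ∈ A θ
  rw [actL_apply, act_W]
  exact SMulMemClass.smul_mem _ (W_mem_A k)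

/-- The Fourier coefficient `T ↦ τ(T W_k*)`. -/
def coef (θ : Matrix (Fin n) (Fin n) ℝ) (k : Fin n → ℤ) : B n →L[ℂ] ℂ :=
  (τL n) ∘L ((ContinuousLinearMap.mul ℂ (B n)).flip (star (W θ k)))

lemma coef_apply (k : Fin n → ℤ) (T : B n) : coef θ k T = τ (T * star (W θ k)) := rfl

lemma norm_coef_le (k : Fin n → ℤ) (T : B n) : ‖coef θ k T‖ ≤ ‖T‖ :=
  calc ‖coef θ k T‖ ≤ ‖T * star (W θ k)‖ := by rw [coef_apply]; exact norm_τ_le _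
    _ ≤ ‖T‖ * ‖star (W θ k)‖ := norm_mul_le _ _
    _ = ‖T‖ * ‖W θ k‖ := by
        rw [ContinuousLinearMap.star_eq_adjoint, LinearIsometryEquiv.norm_map]
    _ ≤ ‖T‖ := mul_le_of_le_one_right (norm_nonneg _) (norm_W_le θ k)

lemma coef_W (k l : Fin n → ℤ) : coef θ k (W θ l) = if l = k then 1 else 0 := by
  rw [coef_apply]
  split_ifs with h
  · rw [h, W_mul_star_W, ← W_zero θ, τ_W, if_pos rfl]
  · rw [star_W, mul_smul_comm, W_mul, smul_smul, τ_smul, τ_W, ← sub_eq_add_neg,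
      if_neg (sub_ne_zero.2 h), mul_zero]

lemma coef_act (k : Fin n → ℤ) (s : E n) {u : B n} (hu : u ∈ A θ) :
    coef θ k (act s u) = Complex.exp (Complex.I * (inner ℝ (latt k) s : ℝ)) * coef θ k u := by
  have heq := eqOn_A (L₁ := coef θ k ∘L actL s)
    (L₂ := Complex.exp (Complex.I * (inner ℝ (latt k) s : ℝ)) • coef θ k) (fun l => ?_) hu
  · simpa [actL_apply] using heq
  · simp only [ContinuousLinearMap.comp_apply, actL_apply, act_W, map_smul, smul_apply,
      smul_eq_mul, coef_W]
    split_ifs with h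
    · rw [h]
    · simp only [mul_zero]

lemma span_expChar_closure_eq_top :
    (Submodule.span ℂ (Set.range (expChar (n := n)))).topologicalClosure = ⊤ := by
  let S : StarSubalgebra ℂ C(Torus n, ℂ) :=
    { toSubalgebra := Algebra.adjoin ℂ (Set.range expChar)
      star_mem' := by
        change Algebra.adjoin ℂ (Set.range expChar) ≤ star (Algebra.adjoin ℂ (Set.range expChar))
        refine Algebra.adjoin_le ?_
        rintro _ ⟨k, rfl⟩
        refine Algebra.subset_adjoin ⟨-k, ?_⟩
        ext1 x
        rw [expChar_neg_apply, ContinuousMap.star_apply, starRingEnd_apply] }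
  have hspan : S.toSubalgebra.toSubmodule = Submodule.span ℂ (Set.range (expChar (n := n))) := by
    refine Algebra.adjoin_eq_span_of_subset ℂ (subset_trans (fun x => ?_) Submodule.subset_span)
    refine Submonoid.closure_induction (fun _ => id) ⟨0, expChar_zero⟩ ?_
    rintro _ _ _ _ ⟨k, rfl⟩ ⟨l, rfl⟩
    exact ⟨k + l, expChar_add k l⟩
  have hsep : S.SeparatesPoints := by
    intro x y hxy
    obtain ⟨i, hi⟩ := Function.ne_iff.1 hxy
    refine ⟨_, ⟨expChar (Pi.single i 1), Algebra.subset_adjoin ⟨Pi.single i 1, rfl⟩, rfl⟩, ?_⟩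
    simp only [expChar_single, expCoord, ContinuousMap.coe_mk, fourier_one]
    exact fun h => hi (AddCircle.injective_toCircle (by positivity) (Circle.ext h))
  rw [← hspan]
  exact congrArg (Subalgebra.toSubmodule <| StarSubalgebra.toSubalgebra ·)
    (ContinuousMap.starSubalgebra_topologicalClosure_eq_top_of_separatesPoints S hsep)

lemma W_oneL2 (k : Fin n → ℤ) :
    W θ k (oneL2 n) = ContinuousMap.toLp 2 (torusMeasure n) ℂ (expChar k) := by
  rw [W, mul_apply_eq_comp, V_oneL2]
  apply Lp.ext
  filter_upwards [coeFn_mulOp (expChar k) (oneL2 n),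
    ContinuousMap.coeFn_toLp (p := 2) (𝕜 := ℂ) (torusMeasure n) (expChar k),
    Lp.coeFn_const (p := 2) (μ := torusMeasure n) (1 : ℂ)] with x hmul hexp hone
  rw [hmul, hexp, oneL2, hone, Function.const_apply, mul_one]

lemma dense_span_W_oneL2 :
    Dense (Submodule.span ℂ (Set.range fun k => W θ k (oneL2 n)) : Set (L2 n)) := by
  let J := ContinuousMap.toLp (E := ℂ) 2 (torusMeasure n) ℂ
  have himage : (Submodule.span ℂ (Set.range fun k => W θ k (oneL2 n)) : Set (L2 n)) =
      J '' Submodule.span ℂ (Set.range (expChar (n := n))) := by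
    simp only [W_oneL2]
    rw [← ContinuousLinearMap.coe_coe, ← Submodule.map_coe, Submodule.map_span, ← Set.range_comp]
    rfl
  rw [himage]
  exact (ContinuousMap.toLp_denseRange ℂ (torusMeasure n) ℂ (by simp)).dense_image J.continuous
    (Submodule.dense_iff_topologicalClosure_eq_top.2 span_expChar_closure_eq_top)

/- For `u = W_m` the left side vanishes unless `m = k - l`, so that it only depends on the
Fourier coefficient of `u` at `k - l`. -/
lemma τ_star_W_mul_mul_W (k l : Fin n → ℤ) {u : B n} (hu : u ∈ A θ) :
    τ (star (W θ k) * u * W θ l) =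
      τ (star (W θ k) * W θ (k - l) * W θ l) * coef θ (k - l) u := by
  let L : B n →L[ℂ] ℂ := (τL n) ∘L ((ContinuousLinearMap.mul ℂ (B n)).flip (W θ l)) ∘L
    (ContinuousLinearMap.mul ℂ (B n) (star (W θ k)))
  have hL (T : B n) : L T = τ (star (W θ k) * T * W θ l) := rfl
  rw [← hL, ← hL]
  refine eqOn_A (L₂ := L (W θ (k - l)) • coef θ (k - l)) (fun m => ?_) hu
  rw [smul_apply, coef_W, smul_eq_mul]
  split_ifs with hm
  · rw [hm, mul_one]
  · have hne : -k + m + l ≠ 0 := fun h => hm (by rw [← sub_eq_zero, ← h]; abel)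
    rw [hL, star_W, smul_mul_assoc, smul_mul_assoc, W_mul, smul_mul_assoc, W_mul, τ_smul, τ_smul,
      τ_smul, τ_W, if_neg hne]
    ring

lemma eq_zero_of_coef {u : B n} (hu : u ∈ A θ) (h : ∀ k, coef θ k u = 0) : u = 0 := by
  refine ContinuousLinearMap.ext_on (dense_span_W_oneL2 (θ := θ)) ?_
  rintro _ ⟨l, rfl⟩
  refine (inner_self_eq_zero (𝕜 := ℂ)).1 (DFunLike.congr_fun (?_ : innerSL ℂ _ = 0) _)
  refine ContinuousLinearMap.ext_on (dense_span_W_oneL2 (θ := θ)) ?_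
  rintro _ ⟨k, rfl⟩
  have hmatrix : (inner ℂ (W θ k (oneL2 n)) (u (W θ l (oneL2 n))) : ℂ) =
      τ (star (W θ k) * u * W θ l) := by
    rw [τ, mul_apply_eq_comp, mul_apply_eq_comp, ContinuousLinearMap.star_eq_adjoint,
      ContinuousLinearMap.adjoint_inner_right]
  rw [innerSL_apply_apply, ← inner_conj_symm, hmatrix, τ_star_W_mul_mul_W k l hu, h, mul_zero,
    map_zero, zero_apply]

lemma eq_of_coef {u v : B n} (hu : u ∈ A θ) (hv : v ∈ A θ)
    (h : ∀ k, coef θ k u = coef θ k v) : u = v :=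
  sub_eq_zero.1 (eq_zero_of_coef (sub_mem hu hv) fun k => by rw [map_sub, h, sub_self])

lemma hasSum_coef_smul_W {u : B n} (hu : u ∈ A θ) (hsum : Summable fun k => ‖coef θ k u‖) :
    HasSum (fun k => coef θ k u • W θ k) u := by
  have hs : Summable fun k => coef θ k u • W θ k :=
    hsum.of_norm_bounded fun k => norm_smul_W_le θ _ k
  suffices heq : ∑' k, coef θ k u • W θ k = u by simpa [heq] using hs.hasSum
  refine eq_of_coef (hasSum_mem_A (fun k => SMulMemClass.smul_mem _ (W_mem_A k)) hs.hasSum) hu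
    fun l => ?_
  have hcoef (k) : coef θ l (coef θ k u • W θ k) = if k = l then coef θ l u else 0 := by
    rw [map_smul, coef_W]
    split_ifs with hk <;> simp [hk]
  rw [(coef θ l).map_tsum hs]
  simp only [hcoef, tsum_ite_eq]

end Algebra

/-! ### Smooth elements -/

section Smooth

variable {θ : Matrix (Fin n) (Fin n) ℝ}

section Delta

variable {u : B n} (hu : Differentiable ℝ fun s : E n => act s u)
include hu

lemma hasDerivAt_act (s v : E n) :
    HasDerivAt (fun t : ℝ => act (s + t • v) u) (fderiv ℝ (fun s => act s u) s v) 0 := by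
  have hline : HasDerivAt (fun t : ℝ => s + t • v) v 0 := by
    simpa using ((hasDerivAt_id (0 : ℝ)).smul_const v).const_add s
  refine HasFDerivAt.comp_hasDerivAt (0 : ℝ) (l := fun s => act s u) ?_ hline
  simpa using (hu s).hasFDerivAt

lemma delta_eq (j : Fin n) :
    delta j u = (-Complex.I) • fderiv ℝ (fun s => act s u) 0 (basisVec j) := by
  simpa [delta] using congrArg ((-Complex.I) • ·) (hasDerivAt_act hu 0 (basisVec j)).deriv

lemma act_delta (j : Fin n) (s : E n) :
    act s (delta j u) = (-Complex.I) • fderiv ℝ (fun s => act s u) s (basisVec j) := by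
  rw [delta_eq hu, ← actL_apply, map_smul]
  congr 1
  have hact := ((actL s).restrictScalars ℝ).hasFDerivAt.comp_hasDerivAt (0 : ℝ)
    (hasDerivAt_act hu 0 (basisVec j))
  refine hact.unique ((hasDerivAt_act hu s (basisVec j)).congr_of_eventuallyEq
    (Eventually.of_forall fun t => ?_))
  simp [actL_apply, act_add]

end Delta

lemma differentiable_act_of_mem_SA {u : B n} (hu : u ∈ SA θ) :
    Differentiable ℝ fun s : E n => act s u :=
  hu.2.differentiable (by simp)

lemma delta_mem_SA {u : B n} (hu : u ∈ SA θ) (j : Fin n) : delta j u ∈ SA θ := by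
  have hdiff := differentiable_act_of_mem_SA hu
  constructor
  · rw [delta_eq hdiff]
    refine SMulMemClass.smul_mem _ ?_
    refine isClosed_A.mem_of_tendsto (hasDerivAt_act hdiff 0 (basisVec j)).tendsto_slope
      (Eventually.of_forall fun t => ?_)
    rw [slope_def_module, ← algebraMap_smul ℂ]
    exact SMulMemClass.smul_mem _ (sub_mem (act_mem_A _ hu.1) (act_mem_A _ hu.1))
  · simp only [act_delta hdiff]
    exact ((hu.2.fderiv_right (by simp)).clm_apply contDiff_const).const_smul _

lemma hasDerivAt_cexp_I_mul (a t : ℝ) :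
    HasDerivAt (fun t : ℝ => Complex.exp (Complex.I * (a * t : ℝ)))
      (Complex.I * a * Complex.exp (Complex.I * (a * t : ℝ))) t := by
  have hexponent : HasDerivAt (fun t : ℝ => Complex.I * (a * t : ℝ)) (Complex.I * a) t := by
    simpa using (((hasDerivAt_id t).const_mul a).ofReal_comp).const_mul Complex.I
  simpa only [mul_comm] using hexponent.cexp

lemma coef_delta {u : B n} (hu : u ∈ SA θ) (j : Fin n) (k : Fin n → ℤ) :
    coef θ k (delta j u) = k j * coef θ k u := by
  have hcomp := ((coef θ k).restrictScalars ℝ).hasFDerivAt.comp_hasDerivAt (0 : ℝ)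
    (hasDerivAt_act (differentiable_act_of_mem_SA hu) 0 (basisVec j))
  have hphase (t : ℝ) : coef θ k (act (0 + t • basisVec j) u) =
      Complex.exp (Complex.I * (k j * t : ℝ)) * coef θ k u := by
    rw [coef_act k _ hu.1, zero_add, inner_smul_right, basisVec, inner_latt_single, mul_one,
      mul_comm t]
  have hderiv : coef θ k (fderiv ℝ (fun s => act s u) 0 (basisVec j)) =
      Complex.I * k j * coef θ k u := by
    refine hcomp.unique (HasDerivAt.congr_of_eventuallyEq ?_ (Eventually.of_forall hphase))
    simpa using (hasDerivAt_cexp_I_mul (k j) 0).mul_const (coef θ k u)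
  rw [delta_eq (differentiable_act_of_mem_SA hu), map_smul, hderiv, smul_eq_mul, ← mul_assoc,
    ← mul_assoc, neg_mul, Complex.I_mul_I, neg_neg, one_mul]

lemma multiPow_zero {X : Type*} (D : Fin n → X → X) (x : X) : multiPow D 0 x = x := by
  have hfoldr (l : List (Fin n)) :
      l.foldr (fun j y => (D j)^[(0 : Fin n → ℕ) j] y) x = x := by
    induction l with
    | nil => rfl
    | cons j l ih => rw [List.foldr_cons, ih]; rfl
  exact hfoldr _

lemma deltaPow_zero (u : B n) : deltaPow 0 u = u := multiPow_zero _ _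

lemma multiPow_mem {X : Type*} {D : Fin n → X → X} {S : Set X} (hD : ∀ j, Set.MapsTo (D j) S S)
    (β : Fin n → ℕ) {x : X} (hx : x ∈ S) : multiPow D β x ∈ S := by
  rw [multiPow]
  induction List.finRange n with
  | nil => exact hx
  | cons j l ih => exact (hD j).iterate _ ih

lemma map_multiPow_eq_prod_mul {X R : Type*} [CommMonoid R] {D : Fin n → X → X} {S : Set X}
    (hD : ∀ j, Set.MapsTo (D j) S S) {L : X → R} {c : Fin n → R}
    (hL : ∀ j, ∀ y ∈ S, L (D j y) = c j * L y) (β : Fin n → ℕ) {x : X} (hx : x ∈ S) :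
    L (multiPow D β x) = (∏ j, c j ^ β j) * L x := by
  have hiter (j : Fin n) (m : ℕ) {y : X} (hy : y ∈ S) : L ((D j)^[m] y) = c j ^ m * L y := by
    induction m with
    | zero => simp
    | succ m ih =>
      rw [Function.iterate_succ_apply', hL j _ ((hD j).iterate m hy), ih, ← mul_assoc, pow_succ']
  have hfoldr (l : List (Fin n)) : l.foldr (fun j y => (D j)^[β j] y) x ∈ S ∧
      L (l.foldr (fun j y => (D j)^[β j] y) x) = (l.map fun j => c j ^ β j).prod * L x := by
    induction l with
    | nil => simpa using hx
    | cons j l ih =>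
      exact ⟨(hD j).iterate _ ih.1, by
        rw [List.foldr_cons, hiter j _ ih.1, ih.2, List.map_cons, List.prod_cons, mul_assoc]⟩
  rw [Fin.prod_univ_def]
  exact (hfoldr _).2

lemma deltaPow_mem_SA {u : B n} (hu : u ∈ SA θ) (β : Fin n → ℕ) : deltaPow β u ∈ SA θ :=
  multiPow_mem (D := delta) (S := (SA θ : Set (B n))) (fun j _ hv => delta_mem_SA hv j) β hu

lemma coef_deltaPow {u : B n} (hu : u ∈ SA θ) (β : Fin n → ℕ) (k : Fin n → ℤ) :
    coef θ k (deltaPow β u) = (∏ j, (k j : ℂ) ^ β j) * coef θ k u :=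
  map_multiPow_eq_prod_mul (S := SA θ) (fun j _ hv => delta_mem_SA hv j)
    (fun j _ hv => coef_delta hv j k) β hu

lemma norm_latt_le_sum_abs (k : Fin n → ℤ) : ‖latt k‖ ≤ ∑ j, |(k j : ℝ)| := by
  rw [eq_sum_smul_basisVec (latt k)]
  refine (norm_sum_le _ _).trans_eq (Finset.sum_congr rfl fun j _ => ?_)
  simp [norm_smul, basisVec]

lemma one_add_norm_latt_pow_le (k : Fin n → ℤ) (m : ℕ) :
    (1 + ‖latt k‖) ^ m ≤ ((n : ℝ) + 1) ^ m * (1 + ∑ j, |(k j : ℝ)| ^ m) := by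
  have hpos : (0 : ℝ) < n + 1 := by positivity
  have hmean := Real.pow_arith_mean_le_arith_mean_pow Finset.univ (fun _ => ((n : ℝ) + 1)⁻¹)
    (Fin.cons 1 fun j => |(k j : ℝ)| : Fin (n + 1) → ℝ) (fun _ _ => by positivity)
    (by simp [hpos.ne']) (fun i _ => by cases i using Fin.cases <;> simp) m
  simp only [Fin.sum_univ_succ, Fin.cons_zero, Fin.cons_succ, one_pow, ← Finset.mul_sum]
    at hmean
  calc (1 + ‖latt k‖) ^ m
      ≤ (1 + ∑ j, |(k j : ℝ)|) ^ m := by gcongr; exact norm_latt_le_sum_abs k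
    _ = ((n : ℝ) + 1) ^ m * (((n : ℝ) + 1)⁻¹ * (1 + ∑ j, |(k j : ℝ)|)) ^ m := by
        rw [← mul_pow, mul_inv_cancel_left₀ hpos.ne']
    _ ≤ ((n : ℝ) + 1) ^ m * (((n : ℝ) + 1)⁻¹ * (1 + ∑ j, |(k j : ℝ)| ^ m)) := by gcongr
    _ ≤ ((n : ℝ) + 1) ^ m * (1 + ∑ j, |(k j : ℝ)| ^ m) := by
        gcongr
        exact mul_le_of_le_one_left (by positivity) (inv_le_one_of_one_le₀ (by simp))

lemma norm_coef_le_of_mem_SA (m : ℕ) {u : B n} (hu : u ∈ SA θ) (k : Fin n → ℤ) :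
    ‖coef θ k u‖ ≤ ((n : ℝ) + 1) ^ m * (‖u‖ + ∑ j, ‖deltaPow (Pi.single j m) u‖) *
      (1 + ‖latt k‖) ^ (-(m : ℝ)) := by
  rw [Real.rpow_neg (by positivity), ← div_eq_mul_inv, le_div_iff₀ (by positivity),
    Real.rpow_natCast]
  have hdelta (j : Fin n) :
      ‖coef θ k u‖ * |(k j : ℝ)| ^ m ≤ ‖deltaPow (Pi.single j m) u‖ := by
    have h := norm_coef_le (θ := θ) k (deltaPow (Pi.single j m) u)
    rw [coef_deltaPow hu, norm_mul, norm_prod, Finset.prod_eq_single j] at h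
    · simpa [mul_comm] using h
    · intro i _ hi; simp [hi]
    · simp
  calc ‖coef θ k u‖ * (1 + ‖latt k‖) ^ m
      ≤ ‖coef θ k u‖ * (((n : ℝ) + 1) ^ m * (1 + ∑ j, |(k j : ℝ)| ^ m)) :=
        mul_le_mul_of_nonneg_left (one_add_norm_latt_pow_le k m) (norm_nonneg _)
    _ = ((n : ℝ) + 1) ^ m * (‖coef θ k u‖ + ∑ j, ‖coef θ k u‖ * |(k j : ℝ)| ^ m) := by
        rw [← Finset.mul_sum]; ring
    _ ≤ _ := by
        gcongr with j
        · exact norm_coef_le k u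
        · exact hdelta j

lemma summable_one_add_norm_latt_rpow_succ :
    Summable fun k : Fin n → ℤ => (1 + ‖latt k‖) ^ (-((n + 1 : ℕ) : ℝ)) :=
  summable_one_add_norm_latt_rpow (by push_cast; linarith)

lemma summable_norm_of_le_rpow {F : Type*} [SeminormedAddCommGroup F] {c : (Fin n → ℤ) → F} {C : ℝ}
    (h : ∀ k, ‖c k‖ ≤ C * (1 + ‖latt k‖) ^ (-((n + 1 : ℕ) : ℝ))) :
    Summable fun k => ‖c k‖ :=
  (summable_one_add_norm_latt_rpow_succ.mul_left C).of_nonneg_of_le (fun _ => norm_nonneg _) h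

lemma summable_norm_coef {u : B n} (hu : u ∈ SA θ) : Summable fun k => ‖coef θ k u‖ :=
  summable_norm_of_le_rpow fun k => norm_coef_le_of_mem_SA (n + 1) hu k

section Exp

variable {F X : Type*} [NormedAddCommGroup F] [InnerProductSpace ℝ F]
  [NormedAddCommGroup X] [NormedSpace ℂ X] [NormedSpace ℝ X] [IsScalarTower ℝ ℂ X]

lemma contDiff_cexp_I_mul_smul (v : X) :
    ContDiff ℝ ∞ fun t : ℝ => Complex.exp (Complex.I * t) • v :=
  ((contDiff_const.mul Complex.ofRealCLM.contDiff).cexp).smul contDiff_const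

lemma contDiff_cexp_I_inner_smul (x : F) (v : X) :
    ContDiff ℝ ∞ fun s : F => Complex.exp (Complex.I * (inner ℝ x s : ℝ)) • v :=
  (contDiff_cexp_I_mul_smul v).comp (innerSL ℝ x).contDiff

lemma iteratedDeriv_cexp_I_mul_smul (v : X) (b : ℕ) :
    iteratedDeriv b (fun t : ℝ => Complex.exp (Complex.I * t) • v) =
      fun t : ℝ => Complex.exp (Complex.I * t) • Complex.I ^ b • v := by
  induction b with
  | zero => simp
  | succ b ih =>
    rw [iteratedDeriv_succ, ih]
    ext t
    have hexp := hasDerivAt_cexp_I_mul 1 t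
    simp only [one_mul, Complex.ofReal_one, mul_one] at hexp
    rw [(hexp.smul_const (Complex.I ^ b • v)).deriv, smul_smul, smul_smul, pow_succ']
    ring_nf

lemma norm_iteratedFDeriv_cexp_I_inner_smul_le (x : F) (v : X) (b : ℕ) (s : F) :
    ‖iteratedFDeriv ℝ b (fun s : F => Complex.exp (Complex.I * (inner ℝ x s : ℝ)) • v) s‖ ≤
      ‖x‖ ^ b * ‖v‖ := by
  change ‖iteratedFDeriv ℝ b
    ((fun t : ℝ => Complex.exp (Complex.I * t) • v) ∘ innerSL ℝ x) s‖ ≤ _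
  rw [(innerSL ℝ x).iteratedFDeriv_comp_right (contDiff_cexp_I_mul_smul v) s
    (by exact_mod_cast le_top)]
  refine (ContinuousMultilinearMap.norm_compContinuousLinearMap_le _ _).trans_eq ?_
  rw [norm_iteratedFDeriv_eq_norm_iteratedDeriv, iteratedDeriv_cexp_I_mul_smul, Finset.prod_const,
    Finset.card_univ, Fintype.card_fin, norm_smul, norm_smul, Complex.norm_exp_I_mul_ofReal,
    norm_pow, Complex.norm_I, one_pow, one_mul, one_mul, mul_comm, innerSL_apply_norm]

end Exp

lemma summable_norm_latt_pow_mul_norm {F : Type*} [SeminormedAddCommGroup F]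
    {c : (Fin n → ℤ) → F}
    (h : ∀ m : ℕ, ∃ C : ℝ, ∀ k, ‖c k‖ ≤ C * (1 + ‖latt k‖) ^ (-(m : ℝ))) (b : ℕ) :
    Summable fun k => ‖latt k‖ ^ b * ‖c k‖ := by
  obtain ⟨C, hC⟩ := h (b + (n + 1))
  refine (summable_one_add_norm_latt_rpow_succ.mul_left C).of_nonneg_of_le
    (fun _ => by positivity) fun k => ?_
  calc ‖latt k‖ ^ b * ‖c k‖
      ≤ (1 + ‖latt k‖) ^ b * (C * (1 + ‖latt k‖) ^ (-((b + (n + 1) : ℕ) : ℝ))) := by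
        gcongr
        · linarith
        · exact hC k
    _ = C * ((1 + ‖latt k‖) ^ (b : ℝ) * (1 + ‖latt k‖) ^ (-((b + (n + 1) : ℕ) : ℝ))) := by
        rw [Real.rpow_natCast]; ring
    _ = C * (1 + ‖latt k‖) ^ (-((n + 1 : ℕ) : ℝ)) := by
        rw [← Real.rpow_add (by positivity)]
        congr 2
        push_cast
        ring

lemma mem_SA_of_norm_coef_le {u : B n} (hu : u ∈ A θ)
    (h : ∀ m : ℕ, ∃ C : ℝ, ∀ k, ‖coef θ k u‖ ≤ C * (1 + ‖latt k‖) ^ (-(m : ℝ))) : u ∈ SA θ := by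
  refine ⟨hu, ?_⟩
  obtain ⟨C, hC⟩ := h (n + 1)
  have hsum := hasSum_coef_smul_W hu (summable_norm_of_le_rpow hC)
  have hact : (fun s : E n => act s u) = fun s : E n =>
      ∑' k, Complex.exp (Complex.I * (inner ℝ (latt k) s : ℝ)) • (coef θ k u • W θ k) := by
    ext1 s
    rw [← actL_apply, ← ((actL s).hasSum hsum).tsum_eq]
    refine tsum_congr fun k => ?_
    rw [map_smul, actL_apply, act_W, smul_comm]
  rw [hact]
  refine contDiff_tsum (N := ⊤) (fun k => contDiff_cexp_I_inner_smul (latt k) _)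
    (fun b _ => summable_norm_latt_pow_mul_norm h b) (fun b k s _ => ?_)
  refine (norm_iteratedFDeriv_cexp_I_inner_smul_le (latt k) _ b s).trans ?_
  gcongr
  exact norm_smul_W_le θ _ k

lemma W_mem_SA (k : Fin n → ℤ) : W θ k ∈ SA θ := by
  refine mem_SA_of_norm_coef_le (W_mem_A k) fun m => ⟨(1 + ‖latt k‖) ^ (m : ℝ), fun l => ?_⟩
  rw [coef_W]
  split_ifs with h
  · rw [h, ← Real.rpow_add (by positivity), add_neg_cancel, Real.rpow_zero, norm_one]
  · rw [norm_zero]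
    positivity

lemma hasSum_coef {u : B n} (hu : u ∈ SA θ) : HasSum (fun k => coef θ k u • W θ k) u :=
  hasSum_coef_smul_W hu.1 (summable_norm_coef hu)

end Smooth

/-! ### Oscillating integrals -/

lemma eq_zero_of_notMem_fst_image_tsupport {F G Y : Type*} [TopologicalSpace F]
    [TopologicalSpace G] [Zero Y] {f : F × G → Y}
    {t : F} (ht : t ∉ Prod.fst '' tsupport f) (ζ : G) : f (t, ζ) = 0 := by
  by_contra h
  exact ht ⟨(t, ζ), subset_tsupport _ h, rfl⟩

section Slice

variable {F G X : Type*} [NormedAddCommGroup F] [NormedSpace ℝ F] [NormedAddCommGroup G]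
  [NormedSpace ℝ G] [NormedAddCommGroup X] [NormedSpace ℝ X]

lemma norm_iteratedFDeriv_prodMk_left_le {f : F × G → X} (hf : ContDiff ℝ ∞ f) (p : ℕ) (t : F)
    (ζ : G) : ‖iteratedFDeriv ℝ p (fun t => f (t, ζ)) t‖ ≤ ‖iteratedFDeriv ℝ p f (t, ζ)‖ := by
  have hslice : (fun t => f (t, ζ)) =
      (fun z => f (z + (0, ζ))) ∘ ContinuousLinearMap.inl ℝ F G := by
    ext t
    simp
  rw [hslice, (ContinuousLinearMap.inl ℝ F G).iteratedFDeriv_comp_right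
    (f := fun z => f (z + (0, ζ))) (hf.comp (contDiff_id.add contDiff_const)) t
    (by exact_mod_cast le_top), iteratedFDeriv_comp_add_right]
  refine (ContinuousMultilinearMap.norm_compContinuousLinearMap_le _ _).trans ?_
  rw [Finset.prod_const, ContinuousLinearMap.inl_apply, Prod.mk_add_mk, add_zero, zero_add]
  exact mul_le_of_le_one_right (norm_nonneg _)
    (pow_le_one₀ (norm_nonneg _) (ContinuousLinearMap.norm_inl_le_one _ _ _))

lemma exists_integrable_norm_iteratedFDeriv_prodMk_left_le [MeasurableSpace F] [BorelSpace F]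
    {μ : Measure F} [IsFiniteMeasureOnCompacts μ] {f : F × G → X} (hf : ContDiff ℝ ∞ f)
    (hc : HasCompactSupport f) (p : ℕ) :
    ∃ g : F → ℝ, Integrable g μ ∧
      ∀ ζ t, ‖iteratedFDeriv ℝ p (fun t => f (t, ζ)) t‖ ≤ g t := by
  have hK : IsCompact (Prod.fst '' tsupport f) := hc.isCompact.image continuous_fst
  obtain ⟨C, hC⟩ := (hf.continuous_iteratedFDeriv (m := p)
    (by exact_mod_cast le_top)).bounded_above_of_compact_support (hc.iteratedFDeriv p)
  refine ⟨(Prod.fst '' tsupport f).indicator fun _ => C,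
    (integrableOn_const (hs := hK.measure_lt_top.ne)).integrable_indicator hK.measurableSet,
    fun ζ t => (norm_iteratedFDeriv_prodMk_left_le hf p t ζ).trans ?_⟩
  by_cases ht : t ∈ Prod.fst '' tsupport f
  · rw [Set.indicator_of_mem ht]
    exact hC _
  · rw [Set.indicator_of_notMem ht]
    refine (norm_eq_zero.2 ?_).le
    by_contra h
    exact ht ⟨(t, ζ), support_iteratedFDeriv_subset p h, rfl⟩

end Slice

section OscKernel

variable {F : Type*} [NormedAddCommGroup F] [InnerProductSpace ℝ F] [FiniteDimensional ℝ F]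
  [MeasurableSpace F] [BorelSpace F] {χ : F × F → ℂ}

/-- The partial Fourier transform `∫ e^{i t·η} χ(t, ζ) dt` of a cut-off function. Integrating out
the first variable of an oscillating integral produces it as the kernel of an approximate
identity. -/
def oscKernel (χ : F × F → ℂ) (η ζ : F) : ℂ :=
  ∫ t : F, Complex.exp (Complex.I * (inner ℝ t η : ℝ)) * χ (t, ζ)

lemma continuous_oscKernel (hχ : Continuous χ) (hc : HasCompactSupport χ) :
    Continuous fun p : F × F => oscKernel χ p.1 p.2 := by
  have hK : IsCompact (Prod.fst '' tsupport χ) := hc.isCompact.image continuous_fst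
  have hintegrand : Continuous (Function.uncurry fun (p : F × F) (t : F) =>
      Complex.exp (Complex.I * (inner ℝ t p.1 : ℝ)) * χ (t, p.2)) := by
    simp only [Function.uncurry_def]
    fun_prop
  refine (continuous_parametric_integral_of_continuous (μ := volume) hintegrand hK).congr
    fun p => setIntegral_eq_integral_of_forall_compl_eq_zero fun t ht => ?_
  rw [eq_zero_of_notMem_fst_image_tsupport ht, mul_zero]

lemma oscKernel_eq_fourier (η ζ : F) :
    oscKernel χ η ζ = 𝓕 (fun t => χ (t, ζ)) (-(2 * π)⁻¹ • η) := by
  rw [Real.fourier_eq', oscKernel]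
  refine integral_congr_ae (Eventually.of_forall fun t => ?_)
  have hphase : -2 * π * (-(2 * π)⁻¹ * inner ℝ t η) = inner ℝ t η := by
    field_simp
  simp only [smul_eq_mul, inner_smul_right, hphase, mul_comm Complex.I]

lemma exists_pow_mul_norm_oscKernel_le (hχ : ContDiff ℝ ∞ χ) (hc : HasCompactSupport χ) (m : ℕ) :
    ∃ C : ℝ, 0 ≤ C ∧ ∀ η ζ, ‖η‖ ^ m * ‖oscKernel χ η ζ‖ ≤ C := by
  choose g hg hχg using
    exists_integrable_norm_iteratedFDeriv_prodMk_left_le (μ := (volume : Measure F)) hχ hc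
  have hslice (ζ : F) : ContDiff ℝ ∞ fun t => χ (t, ζ) :=
    hχ.comp (contDiff_id.prodMk contDiff_const)
  have hint (ζ : F) (p : ℕ) : Integrable fun t => ‖iteratedFDeriv ℝ p (fun t => χ (t, ζ)) t‖ :=
    (hg p).mono' ((hslice ζ).continuous_iteratedFDeriv
      (by exact_mod_cast le_top)).norm.aestronglyMeasurable
      (Eventually.of_forall fun t => by rw [norm_norm]; exact hχg p ζ t)
  have hg0 (p : ℕ) : 0 ≤ ∫ t, g p t :=
    integral_nonneg fun t => (norm_nonneg _).trans (hχg p 0 t)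
  refine ⟨(2 * π) ^ m * (2 ^ m * ∑ p ∈ Finset.range (m + 1), ∫ t, g p t),
    mul_nonneg (by positivity) (mul_nonneg (by positivity) (Finset.sum_nonneg fun p _ => hg0 p)),
    fun η ζ => ?_⟩
  have hfourier := Real.pow_mul_norm_iteratedFDeriv_fourier_le (K := 0) (N := ⊤) (hslice ζ)
    (fun k p hk _ => by
      obtain rfl : k = 0 := by simpa using hk
      simpa using hint ζ p)
    (k := 0) (n := m) (by simp) (by exact_mod_cast le_top) (-(2 * π)⁻¹ • η)
  rw [norm_iteratedFDeriv_zero, ← oscKernel_eq_fourier, norm_smul, norm_neg, norm_inv, mul_pow,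
    inv_pow, Real.norm_of_nonneg (by positivity), mul_assoc, inv_mul_le_iff₀ (by positivity),
    zero_add, Finset.range_one, Finset.sum_product, Finset.sum_singleton] at hfourier
  simp only [pow_zero, one_mul, Nat.cast_zero, mul_zero, zero_add] at hfourier
  refine hfourier.trans ?_
  gcongr with p
  · exact hint ζ p
  · exact hg p
  · exact fun t => hχg p ζ t

lemma exists_norm_oscKernel_le (hχ : ContDiff ℝ ∞ χ) (hc : HasCompactSupport χ) (m : ℕ) :
    ∃ C : ℝ, 0 ≤ C ∧ ∀ η ζ, ‖oscKernel χ η ζ‖ ≤ C * (1 + ‖η‖) ^ (-(m : ℝ)) := by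
  obtain ⟨C₀, hC₀, hbound₀⟩ := exists_pow_mul_norm_oscKernel_le hχ hc 0
  obtain ⟨C₁, hC₁, hbound₁⟩ := exists_pow_mul_norm_oscKernel_le hχ hc m
  refine ⟨2 ^ (m - 1) * (C₀ + C₁), by positivity, fun η ζ => ?_⟩
  rw [Real.rpow_neg (by positivity), ← div_eq_mul_inv, le_div_iff₀ (by positivity),
    Real.rpow_natCast]
  calc ‖oscKernel χ η ζ‖ * (1 + ‖η‖) ^ m
      ≤ ‖oscKernel χ η ζ‖ * (2 ^ (m - 1) * (1 ^ m + ‖η‖ ^ m)) := by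
        gcongr
        exact add_pow_le zero_le_one (norm_nonneg η) m
    _ = 2 ^ (m - 1) * (‖η‖ ^ 0 * ‖oscKernel χ η ζ‖ + ‖η‖ ^ m * ‖oscKernel χ η ζ‖) := by ring
    _ ≤ _ := by
        gcongr
        · exact hbound₀ η ζ
        · exact hbound₁ η ζ

lemma integrable_one_add_norm_rpow_finrank_succ :
    Integrable fun η : F => (1 + ‖η‖) ^ (-((Module.finrank ℝ F + 1 : ℕ) : ℝ)) :=
  integrable_one_add_norm (by simp)

lemma integrable_oscKernel (hχ : ContDiff ℝ ∞ χ) (hc : HasCompactSupport χ) (ζ : F) :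
    Integrable fun η => oscKernel χ η ζ := by
  obtain ⟨C, -, hC⟩ := exists_norm_oscKernel_le hχ hc (Module.finrank ℝ F + 1)
  exact (integrable_one_add_norm_rpow_finrank_succ.const_mul C).mono'
    ((continuous_oscKernel hχ.continuous hc).comp
      (by fun_prop : Continuous fun η : F => (η, ζ))).aestronglyMeasurable
    (Eventually.of_forall fun η => hC η ζ)

lemma integral_oscKernel (hχ : ContDiff ℝ ∞ χ) (hc : HasCompactSupport χ) (ζ : F) :
    ∫ η, oscKernel χ η ζ = (2 * π : ℂ) ^ Module.finrank ℝ F * χ (0, ζ) := by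
  have hπ : 2 * π ≠ 0 := by positivity
  have hcont : Continuous fun t => χ (t, ζ) := hχ.continuous.comp (by fun_prop)
  have hsupp : HasCompactSupport fun t => χ (t, ζ) :=
    HasCompactSupport.of_support_subset_isCompact (hc.isCompact.image continuous_fst)
      fun t ht => ⟨(t, ζ), subset_tsupport _ ht, rfl⟩
  have hfourier : 𝓕 (fun t => χ (t, ζ)) = fun w => oscKernel χ ((-(2 * π)) • w) ζ := by
    ext w
    rw [oscKernel_eq_fourier, smul_smul, neg_mul_neg, inv_mul_cancel₀ hπ, one_smul]
  have hinv := (hcont.integrable_of_hasCompactSupport hsupp).fourierInv_fourier_eq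
    (by rw [hfourier]; exact (integrable_oscKernel hχ hc ζ).comp_smul (neg_ne_zero.2 hπ))
    (hcont.continuousAt (x := 0))
  rw [Real.fourierInv_eq'] at hinv
  simp only [inner_zero_right, mul_zero, Complex.ofReal_zero, zero_mul, Complex.exp_zero,
    one_smul] at hinv
  rw [hfourier, Measure.integral_comp_smul volume (fun η => oscKernel χ η ζ)] at hinv
  rw [← hinv, abs_inv, abs_pow, abs_neg, abs_of_pos (by positivity : 0 < 2 * π),
    Complex.real_smul, ← mul_assoc]
  push_cast
  rw [mul_inv_cancel₀ (by exact_mod_cast pow_ne_zero _ hπ), one_mul]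

end OscKernel

section OscIntegrand

variable {F X : Type*} [NormedAddCommGroup F] [InnerProductSpace ℝ F] [NormedAddCommGroup X]
  [NormedSpace ℂ X] {χ : F × F → ℂ} {f : F → X}

/-- The regularized oscillating integrand `e^{i s·(ξ - a)} χ(εs, εξ) f(ξ)` at the pair
`p = (s, ξ)`. It arises by applying `α_{-s}` to a monomial of degree `a ∈ ℤⁿ`, which produces the
phase `e^{-i s·a}`. -/
def oscIntegrand (χ : F × F → ℂ) (f : F → X) (a : F) (ε : ℝ) (p : F × F) : X :=
  (Complex.exp (Complex.I * (inner ℝ p.1 (p.2 - a) : ℝ)) * χ (ε • p)) • f p.2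

lemma norm_oscIntegrand (χ : F × F → ℂ) (f : F → X) (a : F) (ε : ℝ) (p : F × F) :
    ‖oscIntegrand χ f a ε p‖ = ‖χ (ε • p)‖ * ‖f p.2‖ := by
  rw [oscIntegrand, norm_smul, norm_mul, Complex.norm_exp_I_mul_ofReal, one_mul]

variable [FiniteDimensional ℝ F] [MeasurableSpace F] [BorelSpace F]

lemma integrable_oscIntegrand (hχ : Continuous χ) (hc : HasCompactSupport χ) (hf : Continuous f)
    (a : F) {ε : ℝ} (hε : ε ≠ 0) : Integrable (oscIntegrand χ f a ε) := by
  have hcont : Continuous (oscIntegrand χ f a ε) := by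
    unfold oscIntegrand
    fun_prop
  exact hcont.integrable_of_hasCompactSupport ((hc.comp_smul hε).mul_left).smul_right

lemma integral_cexp_inner_mul_comp_smul (χ : F × F → ℂ) (η ξ : F) {ε : ℝ} (hε : 0 < ε) :
    ∫ s : F, Complex.exp (Complex.I * (inner ℝ s η : ℝ)) * χ (ε • (s, ξ)) =
      (ε ^ Module.finrank ℝ F)⁻¹ • oscKernel χ (ε⁻¹ • η) (ε • ξ) := by
  have hscale := Measure.integral_comp_smul volume (fun t : F =>
    Complex.exp (Complex.I * (inner ℝ t (ε⁻¹ • η) : ℝ)) * χ (t, ε • ξ)) ε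
  rw [abs_of_pos (by positivity)] at hscale
  rw [oscKernel, ← hscale]
  refine integral_congr_ae (Eventually.of_forall fun s => ?_)
  have hphase : inner ℝ (ε • s) (ε⁻¹ • η) = inner ℝ s η := by
    rw [real_inner_smul_left, real_inner_smul_right, mul_inv_cancel_left₀ hε.ne']
  simp only [hphase, Prod.smul_mk]

variable [NormedSpace ℝ X]

lemma hasSum_integral_oscIntegrand {ι : Type*} [Countable ι] {f : ι → F → X} {M : ι → ℝ}
    (hf : ∀ k, Continuous (f k)) (hfM : ∀ k ξ, ‖f k ξ‖ ≤ M k) (hM : Summable M)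
    (hχ : Continuous χ) (hc : HasCompactSupport χ) (a : ι → F) {ε : ℝ} (hε : ε ≠ 0) :
    HasSum (fun k => ∫ p, oscIntegrand χ (f k) (a k) ε p)
      (∫ p, ∑' k, oscIntegrand χ (f k) (a k) ε p) := by
  have hint (k : ι) := integrable_oscIntegrand hχ hc (hf k) (a k) hε
  have hχint : Integrable fun p : F × F => ‖χ (ε • p)‖ :=
    ((hχ.comp (continuous_const_smul ε)).integrable_of_hasCompactSupport (hc.comp_smul hε)).norm
  refine hasSum_integral_of_summable_integral_norm hint
    ((hM.mul_left (∫ p : F × F, ‖χ (ε • p)‖)).of_nonneg_of_le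
      (fun k => integral_nonneg fun p => norm_nonneg _) fun k => ?_)
  rw [← integral_mul_const]
  refine integral_mono (hint k).norm (hχint.mul_const _) fun p => ?_
  simp only [norm_oscIntegrand]
  exact mul_le_mul_of_nonneg_left (hfM k p.2) (norm_nonneg _)

variable [IsScalarTower ℝ ℂ X] [CompleteSpace X]

lemma integral_oscIntegrand (hχ : Continuous χ) (hc : HasCompactSupport χ) (hf : Continuous f)
    (a : F) {ε : ℝ} (hε : 0 < ε) :
    ∫ p, oscIntegrand χ f a ε p =
      ∫ η, oscKernel χ η (ε • (a + ε • η)) • f (a + ε • η) := by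
  have hslice (ξ : F) : ∫ s, oscIntegrand χ f a ε (s, ξ) =
      (ε ^ Module.finrank ℝ F)⁻¹ • oscKernel χ (ε⁻¹ • (ξ - a)) (ε • ξ) • f ξ := by
    simp only [oscIntegrand]
    rw [integral_smul_const, integral_cexp_inner_mul_comp_smul _ _ _ hε, smul_assoc]
  have hscale := Measure.integral_comp_smul volume (fun ζ : F =>
    oscKernel χ (ε⁻¹ • (a + ζ - a)) (ε • (a + ζ)) • f (a + ζ)) ε
  rw [abs_of_pos (by positivity)] at hscale
  calc ∫ p, oscIntegrand χ f a ε p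
      = ∫ ξ, ∫ s, oscIntegrand χ f a ε (s, ξ) :=
        integral_prod_symm _ (integrable_oscIntegrand hχ hc hf a hε.ne')
    _ = (ε ^ Module.finrank ℝ F)⁻¹ •
          ∫ ξ, oscKernel χ (ε⁻¹ • (ξ - a)) (ε • ξ) • f ξ := by
        simp only [hslice, integral_smul]
    _ = (ε ^ Module.finrank ℝ F)⁻¹ •
          ∫ ζ, oscKernel χ (ε⁻¹ • (a + ζ - a)) (ε • (a + ζ)) • f (a + ζ) := by
        rw [integral_add_left_eq_self (μ := volume)
          (fun ξ => oscKernel χ (ε⁻¹ • (ξ - a)) (ε • ξ) • f ξ) a]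
    _ = ∫ η, oscKernel χ η (ε • (a + ε • η)) • f (a + ε • η) := by
        rw [← hscale]
        simp only [add_sub_cancel_left, inv_smul_smul₀ hε.ne']

lemma exists_norm_integral_oscIntegrand_le (X : Type*) [NormedAddCommGroup X] [NormedSpace ℂ X]
    [NormedSpace ℝ X] [IsScalarTower ℝ ℂ X] [CompleteSpace X] (hχ : ContDiff ℝ ∞ χ)
    (hc : HasCompactSupport χ) :
    ∃ C : ℝ, ∀ (f : F → X) (M : ℝ), Continuous f → (∀ ξ, ‖f ξ‖ ≤ M) →
      ∀ (a : F) (ε : ℝ), 0 < ε → ‖∫ p, oscIntegrand χ f a ε p‖ ≤ C * M := by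
  obtain ⟨C, hC0, hC⟩ := exists_norm_oscKernel_le hχ hc (Module.finrank ℝ F + 1)
  refine ⟨C * ∫ η : F, (1 + ‖η‖) ^ (-((Module.finrank ℝ F + 1 : ℕ) : ℝ)),
    fun f M hf hM a ε hε => ?_⟩
  rw [integral_oscIntegrand hχ.continuous hc hf a hε, mul_right_comm, ← integral_const_mul]
  refine norm_integral_le_of_norm_le (integrable_one_add_norm_rpow_finrank_succ.const_mul _)
    (Eventually.of_forall fun η => ?_)
  rw [norm_smul, mul_right_comm]
  exact mul_le_mul (hC _ _) (hM _) (norm_nonneg _) (by positivity)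

lemma tendsto_integral_oscIntegrand (hχ : ContDiff ℝ ∞ χ) (hc : HasCompactSupport χ)
    {M : ℝ} (hf : Continuous f) (hM : ∀ ξ, ‖f ξ‖ ≤ M) (a : F) :
    Tendsto (fun ε : ℝ => ∫ p, oscIntegrand χ f a ε p) (𝓝[>] 0)
      (𝓝 (((2 * π : ℂ) ^ Module.finrank ℝ F * χ 0) • f a)) := by
  obtain ⟨C, hC0, hC⟩ := exists_norm_oscKernel_le hχ hc (Module.finrank ℝ F + 1)
  have hcont : Continuous (Function.uncurry fun (ε : ℝ) (η : F) =>
      oscKernel χ η (ε • (a + ε • η)) • f (a + ε • η)) :=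
    ((continuous_oscKernel hχ.continuous hc).comp
      (by fun_prop : Continuous fun q : ℝ × F => (q.2, q.1 • (a + q.1 • q.2)))).smul
      (by fun_prop : Continuous fun q : ℝ × F => f (a + q.1 • q.2))
  have hlim : ((2 * π : ℂ) ^ Module.finrank ℝ F * χ 0) • f a = ∫ η, oscKernel χ η 0 • f a := by
    rw [integral_smul_const, integral_oscKernel hχ hc, Prod.mk_zero_zero]
  rw [hlim]
  refine Tendsto.congr' (f₁ := fun ε => ∫ η, oscKernel χ η (ε • (a + ε • η)) • f (a + ε • η)) ?_ ?_
  · filter_upwards [self_mem_nhdsWithin] with ε hε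
    exact (integral_oscIntegrand hχ.continuous hc hf a hε).symm
  refine tendsto_integral_filter_of_dominated_convergence
    (fun η => C * (1 + ‖η‖) ^ (-((Module.finrank ℝ F + 1 : ℕ) : ℝ)) * M)
    (Eventually.of_forall fun ε => (hcont.uncurry_left ε).aestronglyMeasurable)
    (Eventually.of_forall fun ε => Eventually.of_forall fun η => ?_)
    ((integrable_one_add_norm_rpow_finrank_succ.const_mul C).mul_const M)
    (Eventually.of_forall fun η => ?_)
  · rw [norm_smul]
    exact mul_le_mul (hC _ _) (hM _) (norm_nonneg _) (by positivity)
  · have hpoint := (hcont.uncurry_right η).tendsto 0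
    simp only [zero_smul, add_zero] at hpoint
    exact hpoint.mono_left nhdsWithin_le_nhds

lemma tendsto_integral_tsum_oscIntegrand {ι : Type*} [Countable ι] {f : ι → F → X} {M : ι → ℝ}
    (hf : ∀ k, Continuous (f k)) (hfM : ∀ k ξ, ‖f k ξ‖ ≤ M k) (hM : Summable M)
    (hχ : ContDiff ℝ ∞ χ) (hc : HasCompactSupport χ) (a : ι → F) :
    Tendsto (fun ε : ℝ => ∫ p, ∑' k, oscIntegrand χ (f k) (a k) ε p) (𝓝[>] 0)
      (𝓝 (((2 * π : ℂ) ^ Module.finrank ℝ F * χ 0) • ∑' k, f k (a k))) := by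
  obtain ⟨C, hC⟩ := exists_norm_integral_oscIntegrand_le X hχ hc
  rw [← tsum_const_smul'']
  refine (tendsto_tsum_of_dominated_convergence (hM.mul_left C)
    (fun k => tendsto_integral_oscIntegrand hχ hc (hf k) (hfM k) (a k)) ?_).congr' ?_
  · filter_upwards [self_mem_nhdsWithin] with ε hε k
    exact hC (f k) _ (hf k) (hfM k) _ ε hε
  · filter_upwards [self_mem_nhdsWithin] with ε hε
    exact (hasSum_integral_oscIntegrand hf hfM hM hχ.continuous hc a (ne_of_gt hε)).tsum_eq

end OscIntegrand

section Quantization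

variable {θ : Matrix (Fin n) (Fin n) ℝ}

lemma hasSum_oscIntegrand_act (χ : E n × E n → ℂ) (ρ : E n → B n) {u : B n} (hu : u ∈ SA θ)
    (ε : ℝ) (p : E n × E n) :
    HasSum (fun k => oscIntegrand χ (fun ξ => coef θ k u • (ρ ξ * W θ k)) (latt k) ε p)
      ((Complex.exp (Complex.I * (inner ℝ p.1 p.2 : ℝ)) * χ (ε • p)) •
        (ρ p.2 * act (-p.1) u)) := by
  have hact := (((actL (-p.1)).hasSum (hasSum_coef hu)).mul_left (ρ p.2)).const_smul
    (Complex.exp (Complex.I * (inner ℝ p.1 p.2 : ℝ)) * χ (ε • p))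
  rw [actL_apply] at hact
  have hphase (k : Fin n → ℤ) : Complex.exp (Complex.I * (inner ℝ p.1 (p.2 - latt k) : ℝ)) =
      Complex.exp (Complex.I * (inner ℝ p.1 p.2 : ℝ)) *
        Complex.exp (Complex.I * (inner ℝ (latt k) (-p.1) : ℝ)) := by
    rw [← Complex.exp_add, inner_sub_right, inner_neg_right, real_inner_comm p.1 (latt k)]
    push_cast
    ring_nf
  have hterm (k : Fin n → ℤ) :
      oscIntegrand χ (fun ξ => coef θ k u • (ρ ξ * W θ k)) (latt k) ε p =
        (Complex.exp (Complex.I * (inner ℝ p.1 p.2 : ℝ)) * χ (ε • p)) •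
          (ρ p.2 * actL (-p.1) (coef θ k u • W θ k)) := by
    simp only [oscIntegrand, map_smul, actL_apply, act_W, mul_smul_comm, smul_smul, hphase]
    congr 1
    ring
  rw [funext hterm]
  exact hact

theorem isOscIntegral_of_bounded {ρ : E n → B n} {M : ℝ} (hρ : Continuous ρ)
    (hM : ∀ ξ, ‖ρ ξ‖ ≤ M) {u : B n} (hu : u ∈ SA θ) :
    IsOscIntegral (fun s ξ => ρ ξ * act (-s) u)
      (∑' k, coef θ k u • (ρ (latt k) * W θ k)) := by
  intro χ hχ hc hχ0
  have hbound (k : Fin n → ℤ) (ξ : E n) :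
      ‖coef θ k u • (ρ ξ * W θ k)‖ ≤ ‖coef θ k u‖ * M := by
    rw [norm_smul]
    gcongr
    refine (norm_mul_le _ _).trans ?_
    exact (mul_le_of_le_one_right (norm_nonneg _) (norm_W_le θ k)).trans (hM ξ)
  have hlim := (tendsto_integral_tsum_oscIntegrand
    (f := fun k ξ => coef θ k u • (ρ ξ * W θ k)) (fun k => by fun_prop) hbound
    ((summable_norm_coef hu).mul_right M) hχ hc latt).const_smul ((2 * π : ℂ) ^ n)⁻¹
  have hπ : (2 * π : ℂ) ^ n ≠ 0 := pow_ne_zero _ (by simp [Real.pi_ne_zero])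
  rw [hχ0, mul_one, finrank_euclideanSpace_fin, smul_smul, inv_mul_cancel₀ hπ, one_smul] at hlim
  simpa only [(hasSum_oscIntegrand_act χ ρ hu _ _).tsum_eq] using hlim

lemma IsOscIntegral.unique {a : E n → E n → B n} {v w : B n} (hv : IsOscIntegral a v)
    (hw : IsOscIntegral a w) : v = w := by
  let bump : ContDiffBump (0 : E n × E n) := ⟨1, 2, one_pos, one_lt_two⟩
  let χ : E n × E n → ℂ := fun p => (bump p : ℂ)
  have hsmooth : ContDiff ℝ ∞ χ := Complex.ofRealCLM.contDiff.comp bump.contDiff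
  have hsupp : HasCompactSupport χ :=
    bump.hasCompactSupport.comp_left (g := Complex.ofReal) (by simp)
  have hzero : χ 0 = 1 := by
    simp only [χ]
    rw [bump.one_of_mem_closedBall (by simp [bump]), Complex.ofReal_one]
  exact tendsto_nhds_unique (hv χ hsmooth hsupp hzero) (hw χ hsmooth hsupp hzero)

end Quantization

/-! ### Interpolation of symbols with values in the smooth algebra -/

section DeltaPow

variable {θ : Matrix (Fin n) (Fin n) ℝ}

lemma deltaPow_eq_of_coef {u v : B n} (hu : u ∈ SA θ) (hv : v ∈ A θ) {β : Fin n → ℕ}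
    (h : ∀ k, coef θ k v = (∏ j, (k j : ℂ) ^ β j) * coef θ k u) : deltaPow β u = v :=
  eq_of_coef (deltaPow_mem_SA hu β).1 hv fun k => by rw [coef_deltaPow hu, h]

lemma deltaPow_smul {u : B n} (hu : u ∈ SA θ) (c : ℂ) (β : Fin n → ℕ) :
    deltaPow β (c • u) = c • deltaPow β u := by
  refine deltaPow_eq_of_coef (Submodule.smul_mem _ c hu)
    (SMulMemClass.smul_mem c (deltaPow_mem_SA hu β).1) fun k => ?_
  rw [map_smul, map_smul, coef_deltaPow hu, smul_eq_mul, smul_eq_mul, mul_left_comm]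

lemma deltaPow_sub {u v : B n} (hu : u ∈ SA θ) (hv : v ∈ SA θ) (β : Fin n → ℕ) :
    deltaPow β (u - v) = deltaPow β u - deltaPow β v := by
  refine deltaPow_eq_of_coef (sub_mem hu hv)
    (sub_mem (deltaPow_mem_SA hu β).1 (deltaPow_mem_SA hv β).1) fun k => ?_
  rw [map_sub, map_sub, coef_deltaPow hu, coef_deltaPow hv, mul_sub]

lemma deltaPow_sum {ι : Type*} (s : Finset ι) {v : ι → B n} (hv : ∀ i ∈ s, v i ∈ SA θ)
    (β : Fin n → ℕ) : deltaPow β (∑ i ∈ s, v i) = ∑ i ∈ s, deltaPow β (v i) := by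
  refine deltaPow_eq_of_coef (sum_mem hv)
    (sum_mem fun i hi => (deltaPow_mem_SA (hv i hi) β).1) fun k => ?_
  rw [map_sum, map_sum, Finset.mul_sum]
  exact Finset.sum_congr rfl fun i hi => coef_deltaPow (hv i hi) β k

section Tsum

variable {ι : Type*} {v : ι → B n} (hv : ∀ i, v i ∈ SA θ)
  (hsum : ∀ β : Fin n → ℕ, Summable fun i => ‖deltaPow β (v i)‖)
include hv hsum

lemma tsum_mem_SA : ∑' i, v i ∈ SA θ := by
  have hnorm : Summable fun i => ‖v i‖ := by simpa only [deltaPow_zero] using hsum 0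
  have hv_sum : HasSum v (∑' i, v i) := hnorm.of_norm.hasSum
  refine mem_SA_of_norm_coef_le (hasSum_mem_A (fun i => (hv i).1) hv_sum) fun m => ?_
  have hseminorm : Summable fun i => ((n : ℝ) + 1) ^ m *
      (‖v i‖ + ∑ j, ‖deltaPow (Pi.single j m) (v i)‖) :=
    (hnorm.add (summable_sum fun j _ => hsum _)).mul_left _
  refine ⟨∑' i, ((n : ℝ) + 1) ^ m * (‖v i‖ + ∑ j, ‖deltaPow (Pi.single j m) (v i)‖),
    fun k => ?_⟩
  rw [← tsum_mul_right, ← ((coef θ k).hasSum hv_sum).tsum_eq]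
  exact tsum_of_norm_bounded (hseminorm.mul_right _).hasSum
    fun i => norm_coef_le_of_mem_SA m (hv i) k

lemma deltaPow_tsum (β : Fin n → ℕ) : deltaPow β (∑' i, v i) = ∑' i, deltaPow β (v i) := by
  have hv_sum : HasSum v (∑' i, v i) := by
    simpa only [deltaPow_zero] using (hsum 0).of_norm.hasSum
  have hdelta_sum := (hsum β).of_norm.hasSum
  refine deltaPow_eq_of_coef (tsum_mem_SA hv hsum)
    (hasSum_mem_A (fun i => (deltaPow_mem_SA (hv i) β).1) hdelta_sum) fun k => ?_
  have hcoef := (coef θ k).hasSum hdelta_sum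
  simp only [coef_deltaPow (hv _)] at hcoef
  exact hcoef.unique (((coef θ k).hasSum hv_sum).mul_left _)

end Tsum

lemma IsSmoothOn.mono {Ω Ω' : Set (E n)} {ρ : E n → B n} (hρ : IsSmoothOn θ Ω ρ) (h : Ω' ⊆ Ω) :
    IsSmoothOn θ Ω' ρ :=
  ⟨fun ξ hξ => hρ.1 ξ (h hξ), fun α => (hρ.2 α).mono h⟩

lemma IsSmoothOn.sub {Ω : Set (E n)} {ρ σ : E n → B n} (hρ : IsSmoothOn θ Ω ρ)
    (hσ : IsSmoothOn θ Ω σ) : IsSmoothOn θ Ω fun ξ => ρ ξ - σ ξ :=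
  ⟨fun ξ hξ => sub_mem (hρ.1 ξ hξ) (hσ.1 ξ hξ), fun α => ((hρ.2 α).sub (hσ.2 α)).congr
    fun ξ hξ => deltaPow_sub (hρ.1 ξ hξ) (hσ.1 ξ hξ) α⟩

lemma IsSmoothOn.sum {Ω : Set (E n)} {ι : Type*} (s : Finset ι) {σ : ι → E n → B n}
    (hσ : ∀ i, IsSmoothOn θ Ω (σ i)) : IsSmoothOn θ Ω fun ξ => ∑ i ∈ s, σ i ξ :=
  ⟨fun ξ hξ => sum_mem fun i _ => (hσ i).1 ξ hξ, fun α =>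
    (ContDiffOn.sum fun i _ => (hσ i).2 α).congr
      fun ξ hξ => deltaPow_sum s (fun i _ => (hσ i).1 ξ hξ) α⟩

end DeltaPow

lemma rpow_le_two_rpow_abs_mul_rpow {x y : ℝ} (hx : 0 < x) (hxy : x ≤ y) (hyx : y ≤ 2 * x)
    (s : ℝ) : x ^ s ≤ 2 ^ |s| * y ^ s := by
  have hy : 0 < y := hx.trans_le hxy
  have hquot : x ^ s / y ^ s ≤ 2 ^ |s| := by
    rw [← Real.div_rpow hx.le hy.le, ← inv_div, Real.inv_rpow (by positivity),
      ← Real.rpow_neg (by positivity)]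
    calc (y / x) ^ (-s) ≤ (y / x) ^ |s| :=
          Real.rpow_le_rpow_of_exponent_le ((one_le_div hx).2 hxy) (neg_le_abs s)
      _ ≤ 2 ^ |s| := Real.rpow_le_rpow (by positivity) ((div_le_iff₀ hx).2 hyx) (abs_nonneg s)
  exact (div_le_iff₀ (by positivity)).1 hquot

lemma SymbolBound.of_one_le_norm {X F : Type*} [NormedAddCommGroup X] [NormedSpace ℝ X]
    [ProperSpace X] [NormedAddCommGroup F] [NormedSpace ℝ F] {f : X → F} (hf : ContDiff ℝ ∞ f)
    {s : ℝ}
    (h : ∀ m : ℕ, ∃ C : ℝ, ∀ ξ, 1 ≤ ‖ξ‖ → ‖iteratedFDeriv ℝ m f ξ‖ ≤ C * ‖ξ‖ ^ (s - m)) :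
    SymbolBound s f := by
  refine ⟨hf, fun m => ?_⟩
  obtain ⟨C, hC⟩ := h m
  obtain ⟨D, hD⟩ := (isCompact_closedBall (0 : X) 1).exists_bound_of_continuousOn
    (hf.continuous_iteratedFDeriv (m := m) (by exact_mod_cast le_top)).continuousOn
  have hD0 : 0 ≤ D := (norm_nonneg _).trans (hD 0 (by simp))
  refine ⟨(|C| + D) * 2 ^ |s - m|, fun ξ => ?_⟩
  rw [mul_assoc]
  rcases le_total 1 ‖ξ‖ with hξ | hξ
  · calc ‖iteratedFDeriv ℝ m f ξ‖ ≤ C * ‖ξ‖ ^ (s - m) := hC ξ hξ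
      _ ≤ (|C| + D) * ‖ξ‖ ^ (s - m) := by
        gcongr
        linarith [le_abs_self C]
      _ ≤ (|C| + D) * (2 ^ |s - m| * (1 + ‖ξ‖) ^ (s - m)) := by
        gcongr
        exact rpow_le_two_rpow_abs_mul_rpow (by linarith) (by linarith) (by linarith) _
  · calc ‖iteratedFDeriv ℝ m f ξ‖ ≤ D := hD ξ (by simpa using hξ)
      _ ≤ (|C| + D) * (1 : ℝ) ^ (s - m) := by
        rw [Real.one_rpow]
        linarith [abs_nonneg C]
      _ ≤ (|C| + D) * (2 ^ |s - m| * (1 + ‖ξ‖) ^ (s - m)) := by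
        gcongr
        exact rpow_le_two_rpow_abs_mul_rpow one_pos (by simp) (by linarith) _

lemma SymbolBound.integrable {F X : Type*} [NormedAddCommGroup F] [NormedSpace ℝ F]
    [FiniteDimensional ℝ F] [MeasurableSpace F] [BorelSpace F] {μ : Measure F}
    [μ.IsAddHaarMeasure] [NormedAddCommGroup X] [NormedSpace ℝ X] {s : ℝ} {f : F → X}
    (hf : SymbolBound s f) (hs : s < -Module.finrank ℝ F) : Integrable f μ := by
  obtain ⟨C, -, hC⟩ := hf.norm_le
  have hweight := integrable_one_add_norm (E := F) (μ := μ) (r := -s) (by linarith)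
  rw [neg_neg] at hweight
  exact (hweight.const_mul C).mono' hf.contDiff.continuous.aestronglyMeasurable
    (Eventually.of_forall hC)

section Symbol

variable {θ : Matrix (Fin n) (Fin n) ℝ} {q : ℂ} {ρ : E n → B n}

lemma IsClassicalSymbol.mem_SA (hρ : IsClassicalSymbol θ q ρ) (ξ : E n) : ρ ξ ∈ SA θ :=
  hρ.1.1 ξ trivial

lemma IsClassicalSymbol.symbolBound (hρ : IsClassicalSymbol θ q ρ) (α : Fin n → ℕ) :
    SymbolBound q.re fun ξ => deltaPow α (ρ ξ) := by
  obtain ⟨⟨-, hsmooth⟩, σ, -, hexpansion⟩ := hρ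
  refine SymbolBound.of_one_le_norm (contDiffOn_univ.1 (hsmooth α)) fun m => ?_
  simpa using hexpansion 0 α m

lemma IsClassicalSymbol.symbolBound_self (hρ : IsClassicalSymbol θ q ρ) : SymbolBound q.re ρ := by
  simpa only [deltaPow_zero] using hρ.symbolBound 0

lemma IsClassicalSymbol.of_rapidDecay_sub (hρ : IsClassicalSymbol θ q ρ) {ρ' : E n → B n}
    (hρ' : IsSmoothOn θ Set.univ ρ')
    (hdecay : ∀ α b, RapidDecay (iteratedFDeriv ℝ b fun η => deltaPow α (ρ' η - ρ η))) :
    IsClassicalSymbol θ q ρ' := by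
  obtain ⟨hsmooth, σ, hσ, hexpansion⟩ := id hρ
  refine ⟨hρ', σ, hσ, fun N α b => ?_⟩
  obtain ⟨C, hC⟩ := hexpansion N α b
  obtain ⟨K, hK⟩ := exists_nat_ge (-(q.re - N - b))
  obtain ⟨C', hC'⟩ := hdecay α b K
  have hC0' : 0 ≤ C' := by simpa using (norm_nonneg _).trans (hC' 0)
  have hdiff := hρ'.sub hsmooth
  have hrem := (hsmooth.mono (Set.subset_univ {0}ᶜ)).sub
    (IsSmoothOn.sum (Finset.range N) fun j => (hσ j).1)
  refine ⟨C' + C, fun ξ hξ => ?_⟩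
  have hξ0 : {0}ᶜ ∈ 𝓝 ξ :=
    isOpen_compl_singleton.mem_nhds (norm_pos_iff.1 (one_pos.trans_le hξ))
  have hsplit : (fun η => deltaPow α (ρ' η - ∑ j ∈ Finset.range N, σ j η)) =ᶠ[𝓝 ξ] fun η =>
      deltaPow α (ρ' η - ρ η) + deltaPow α (ρ η - ∑ j ∈ Finset.range N, σ j η) := by
    filter_upwards [hξ0] with η hη
    have hσ_mem : ∑ j ∈ Finset.range N, σ j η ∈ SA θ := sum_mem fun j _ => (hσ j).1.1 η hη
    rw [deltaPow_sub (hρ'.1 η trivial) hσ_mem, deltaPow_sub (hρ'.1 η trivial) (hρ.mem_SA η),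
      deltaPow_sub (hρ.mem_SA η) hσ_mem, sub_add_sub_cancel]
  rw [(hsplit.iteratedFDeriv ℝ b).eq_of_nhds, fun_iteratedFDeriv_add_apply
    (((contDiffOn_univ.1 (hdiff.2 α)).contDiffAt).of_le (by exact_mod_cast le_top))
    (((hrem.2 α).contDiffAt hξ0).of_le (by exact_mod_cast le_top)), add_mul]
  refine (norm_add_le _ _).trans (add_le_add ((hC' ξ).trans ?_) (hC ξ hξ))
  gcongr
  calc (1 + ‖ξ‖) ^ (-(K : ℝ)) ≤ ‖ξ‖ ^ (-(K : ℝ)) :=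
        Real.rpow_le_rpow_of_nonpos (by linarith) (by linarith) (by simp)
    _ ≤ ‖ξ‖ ^ (q.re - N - b) := Real.rpow_le_rpow_of_exponent_le hξ (by linarith)

section Interpolate

variable (hq : q.re < -n) {φ : 𝓢(E n, ℂ)} (hρ : IsClassicalSymbol θ q ρ)
include hq hρ

lemma summable_norm_deltaPow_schwartz_sub_smul (φ : 𝓢(E n, ℂ)) (ξ : E n) (α : Fin n → ℕ) :
    Summable fun k => ‖deltaPow α (φ (ξ - latt k) • ρ (latt k))‖ := by
  obtain ⟨C, -, hC⟩ := exists_norm_schwartz_le φ 0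
  simp only [neg_zero, Real.rpow_zero, mul_one] at hC
  simp only [deltaPow_smul (hρ.mem_SA _), norm_smul]
  exact (((hρ.symbolBound α).summable hq).mul_left C).of_nonneg_of_le
    (fun k => by positivity) fun k => mul_le_mul_of_nonneg_right (hC _) (norm_nonneg _)

lemma interpolate_mem_SA (φ : 𝓢(E n, ℂ)) (ξ : E n) : interpolate φ ρ ξ ∈ SA θ :=
  tsum_mem_SA (fun _ => Submodule.smul_mem _ _ (hρ.mem_SA _))
    (summable_norm_deltaPow_schwartz_sub_smul hq hρ φ ξ)

lemma deltaPow_interpolate (φ : 𝓢(E n, ℂ)) (ξ : E n) (α : Fin n → ℕ) :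
    deltaPow α (interpolate φ ρ ξ) =
      ∑' k : Fin n → ℤ, φ (ξ - latt k) • deltaPow α (ρ (latt k)) := by
  rw [interpolate, deltaPow_tsum (fun _ => Submodule.smul_mem _ _ (hρ.mem_SA _))
    (summable_norm_deltaPow_schwartz_sub_smul hq hρ φ ξ)]
  exact tsum_congr fun k => deltaPow_smul (hρ.mem_SA _) _ _

lemma isSmoothOn_interpolate (φ : 𝓢(E n, ℂ)) : IsSmoothOn θ Set.univ (interpolate φ ρ) := by
  refine ⟨fun ξ _ => interpolate_mem_SA hq hρ φ ξ, fun α => ?_⟩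
  rw [contDiffOn_univ]
  simp only [deltaPow_interpolate hq hρ]
  exact (contDiff_tsum_schwartz_sub_smul φ latt ((hρ.symbolBound α).summable hq)).1

variable (hφ : IsMeyer φ)
include hφ

lemma isClassicalSymbol_interpolate : IsClassicalSymbol θ q (interpolate φ ρ) := by
  refine hρ.of_rapidDecay_sub (isSmoothOn_interpolate hq hρ φ) fun α b => ?_
  simp only [deltaPow_sub (interpolate_mem_SA hq hρ φ _) (hρ.mem_SA _),
    deltaPow_interpolate hq hρ]
  exact (hρ.symbolBound α).rapidDecay_iteratedFDeriv_tsum_sub hq hφ b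

omit hq hρ in
lemma interpolate_latt (ρ : E n → B n) (k : Fin n → ℤ) :
    interpolate φ ρ (latt k) = ρ (latt k) := by
  rw [interpolate, tsum_eq_single k]
  · rw [sub_self, hφ.map_zero, one_smul]
  · intro l hl
    rw [← latt_sub, hφ.map_latt _ (sub_ne_zero.2 hl.symm), zero_smul]

lemma isNormalized_interpolate : IsNormalized (interpolate φ ρ) := by
  refine ⟨(isClassicalSymbol_interpolate hq hρ hφ).symbolBound_self.integrable (by simpa), ?_⟩
  simp only [interpolate_latt hφ]
  have hint (k : Fin n → ℤ) : Integrable fun ξ => φ (ξ - latt k) • ρ (latt k) :=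
    (φ.integrable.comp_sub_right (latt k)).smul_const _
  have hsum := hasSum_integral_of_summable_integral_norm hint (by
    simp only [norm_smul, integral_mul_const, integral_sub_right_eq_self (fun ξ => ‖φ ξ‖)]
    exact (hρ.symbolBound_self.summable hq).mul_left _)
  simp only [integral_smul_const, integral_sub_right_eq_self (fun ξ => φ ξ), hφ.integral_eq,
    one_smul] at hsum
  exact hsum

end Interpolate

lemma IsClassicalSymbol.isOscIntegral (hρ : IsClassicalSymbol θ q ρ) (hq : q.re ≤ 0) {u : B n}
    (hu : u ∈ SA θ) : IsOscIntegral (fun s ξ => ρ ξ * act (-s) u)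
      (∑' k, coef θ k u • (ρ (latt k) * W θ k)) := by
  obtain ⟨C, hC⟩ := hρ.symbolBound_self.exists_norm_iteratedFDeriv_le hq 0
  simp only [norm_iteratedFDeriv_zero] at hC
  exact isOscIntegral_of_bounded hρ.symbolBound_self.contDiff.continuous hC hu

lemma IsSymbolOf.apply_eq {P : SA θ →ₗ[ℂ] SA θ} (hP : IsSymbolOf ρ P)
    (hρ : IsClassicalSymbol θ q ρ) (hq : q.re ≤ 0) (u : SA θ) :
    (P u : B n) = ∑' k, coef θ k (u : B n) • (ρ (latt k) * W θ k) :=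
  (hP u).unique (hρ.isOscIntegral hq u.2)

lemma isSymbolOf_interpolate (hq : q.re < -n) {φ : 𝓢(E n, ℂ)} (hφ : IsMeyer φ)
    (hρ : IsClassicalSymbol θ q ρ) {P : SA θ →ₗ[ℂ] SA θ} (hP : IsSymbolOf ρ P) :
    IsSymbolOf (interpolate φ ρ) P := by
  have hq0 : q.re ≤ 0 := hq.le.trans (by simp)
  intro u
  have hosc := (isClassicalSymbol_interpolate hq hρ hφ).isOscIntegral hq0 u.2
  simp only [interpolate_latt hφ] at hosc
  rwa [← hP.apply_eq hρ hq0] at hosc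

end Symbol

/-! ### Sums of rank-one operators -/

section RankOne

open InnerProductSpace ContinuousLinearMap

lemma summable_prod_of_tsum_norm_le {α β F : Type*} [NormedAddCommGroup F] [CompleteSpace F]
    {f : α × β → F} {g : α → ℝ} (hf : ∀ a, Summable fun b => ‖f (a, b)‖)
    (hfg : ∀ a, ∑' b, ‖f (a, b)‖ ≤ g a) (hg : Summable g) :
    Summable f ∧ ‖∑' p, f p‖ ≤ ∑' a, g a := by
  have hrows : Summable fun a => ∑' b, ‖f (a, b)‖ :=
    hg.of_nonneg_of_le (fun a => tsum_nonneg fun _ => norm_nonneg _) hfg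
  have hnorm : Summable fun p => ‖f p‖ :=
    (summable_prod_of_nonneg fun p => norm_nonneg (f p)).2 ⟨hf, hrows⟩
  refine ⟨hnorm.of_norm, (norm_tsum_le_tsum_norm hnorm).trans ?_⟩
  rw [hnorm.tsum_prod' hf]
  exact hrows.tsum_le_tsum hfg hg

variable {𝕜 K ι : Type*} [RCLike 𝕜] [NormedAddCommGroup K] [InnerProductSpace 𝕜 K]

lemma tsum_norm_inner_mul_norm_inner_le {v w : ι → K} (hv : Orthonormal 𝕜 v)
    (hw : Orthonormal 𝕜 w) (x y : K) :
    (Summable fun i => ‖(inner 𝕜 (v i) x : 𝕜)‖ * ‖(inner 𝕜 (w i) y : 𝕜)‖) ∧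
      ∑' i, ‖(inner 𝕜 (v i) x : 𝕜)‖ * ‖(inner 𝕜 (w i) y : 𝕜)‖ ≤ ‖x‖ * ‖y‖ := by
  obtain ⟨hsum, hle⟩ := Real.summable_and_inner_le_Lp_mul_Lq_tsum_of_nonneg .two_two
    (fun i => norm_nonneg (inner 𝕜 (v i) x : 𝕜)) (fun i => norm_nonneg (inner 𝕜 (w i) y : 𝕜))
    (by simpa only [Real.rpow_two] using hv.inner_products_summable x)
    (by simpa only [Real.rpow_two] using hw.inner_products_summable y)
  refine ⟨hsum, hle.trans ?_⟩
  simp only [Real.rpow_two, ← Real.sqrt_eq_rpow]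
  gcongr
  · exact Real.sqrt_le_iff.2 ⟨norm_nonneg x, hv.tsum_inner_products_le x⟩
  · exact Real.sqrt_le_iff.2 ⟨norm_nonneg y, hw.tsum_inner_products_le y⟩

/-- The operator `∑ f_i ⟨e_i, ·⟩`, the sum converging in operator norm as soon as
`∑ ‖f_i‖ ‖e_i‖ < ∞`. -/
def sumRankOne (𝕜 : Type*) {K ι : Type*} [RCLike 𝕜] [NormedAddCommGroup K]
    [InnerProductSpace 𝕜 K] (e f : ι → K) : K →L[𝕜] K :=
  ∑' i, rankOne 𝕜 (f i) (e i)

variable [CompleteSpace K] {e f : ι → K} (hf : Summable fun i => ‖f i‖ * ‖e i‖)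
include hf

lemma hasSum_sumRankOne :
    HasSum (fun i => rankOne 𝕜 (f i) (e i)) (sumRankOne 𝕜 e f) :=
  (hf.of_norm_bounded fun i => (norm_rankOne (𝕜 := 𝕜) (f i) (e i)).le).hasSum

lemma hasSum_sumRankOne_apply (x : K) :
    HasSum (fun i => (inner 𝕜 (e i) x : 𝕜) • f i) (sumRankOne 𝕜 e f x) := by
  have h := (ContinuousLinearMap.apply 𝕜 K x).hasSum (hasSum_sumRankOne (𝕜 := 𝕜) hf)
  simpa only [apply_apply, rankOne_apply] using h

lemma hasSum_inner_sumRankOne_apply (x y : K) :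
    HasSum (fun i => (inner 𝕜 (e i) x * inner 𝕜 y (f i) : 𝕜))
      (inner 𝕜 y (sumRankOne 𝕜 e f x)) := by
  have h := (innerSL 𝕜 y).hasSum (hasSum_sumRankOne_apply (𝕜 := 𝕜) hf x)
  simpa only [map_smul, innerSL_apply_apply, smul_eq_mul] using h

lemma isCompactOperator_sumRankOne : IsCompactOperator (sumRankOne 𝕜 e f) := by
  refine isCompactOperator_of_tendsto (hasSum_sumRankOne (𝕜 := 𝕜) hf)
    (Eventually.of_forall fun s => ?_)
  refine sum_mem (S := compactOperator (RingHom.id 𝕜) K K) fun i _ => ?_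
  exact (isCompactOperator_of_locallyCompactSpace_rng
    (toSpanSingleton 𝕜 (f i))).comp_clm (innerSL 𝕜 (e i))

lemma hasSum_trace_sumRankOne {κ : Type*} (b : HilbertBasis κ 𝕜 K) :
    HasSum (fun j => (inner 𝕜 (b j) (sumRankOne 𝕜 e f (b j)) : 𝕜))
      (∑' i, (inner 𝕜 (e i) (f i) : 𝕜)) := by
  let g (p : ι × κ) : 𝕜 := inner 𝕜 (e p.1) (b p.2) * inner 𝕜 (b p.2) (f p.1)
  have hnorm (i : ι) (j : κ) : ‖g (i, j)‖ =
      ‖(inner 𝕜 (b j) (f i) : 𝕜)‖ * ‖(inner 𝕜 (b j) (e i) : 𝕜)‖ := by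
    rw [norm_mul, norm_inner_symm, mul_comm]
  have hrow (i : ι) := tsum_norm_inner_mul_norm_inner_le b.orthonormal b.orthonormal (f i) (e i)
  obtain ⟨hg, -⟩ := summable_prod_of_tsum_norm_le (f := g)
    (fun i => by simpa only [hnorm] using (hrow i).1)
    (fun i => by simpa only [hnorm] using (hrow i).2) hf
  have hsum_rows : HasSum (fun i => (inner 𝕜 (e i) (f i) : 𝕜)) (∑' p, g p) :=
    hg.hasSum.prod_fiberwise fun i => b.hasSum_inner_mul_inner (e i) (f i)
  rw [hsum_rows.tsum_eq]
  exact ((Equiv.prodComm κ ι).hasSum_iff.2 hg.hasSum).prod_fiberwise fun j =>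
    hasSum_inner_sumRankOne_apply hf (b j) (b j)

lemma norm_sumRankOne_apply_le {κ : Type*} (he : Orthonormal 𝕜 e) {v : κ → ι → K}
    (hv : ∀ m, Orthonormal 𝕜 (v m)) {a : κ → ι → 𝕜} {b : κ → ℝ} (hb₀ : ∀ m, 0 ≤ b m)
    (hb : Summable b)
    (hfv : ∀ i, HasSum (fun m => a m i • v m i) (f i)) {x : K}
    (ha : ∀ m i, (inner 𝕜 (e i) x : 𝕜) ≠ 0 → ‖a m i‖ ≤ b m) :
    ‖sumRankOne 𝕜 e f x‖ ≤ (∑' m, b m) * ‖x‖ := by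
  have hB : 0 ≤ ∑' m, b m := tsum_nonneg hb₀
  rw [← innerSL_apply_norm (𝕜 := 𝕜)]
  refine opNorm_le_bound _ (by positivity) fun y => ?_
  let g (p : κ × ι) : 𝕜 := inner 𝕜 (e p.2) x * (a p.1 p.2 * inner 𝕜 y (v p.1 p.2))
  have hnorm (m : κ) (i : ι) : ‖g (m, i)‖ ≤
      b m * (‖(inner 𝕜 (e i) x : 𝕜)‖ * ‖(inner 𝕜 (v m i) y : 𝕜)‖) := by
    by_cases hxi : (inner 𝕜 (e i) x : 𝕜) = 0
    · simp [g, hxi]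
    · rw [norm_mul, norm_mul, norm_inner_symm y, mul_left_comm]
      gcongr
      exact ha m i hxi
  have hrow (m : κ) := tsum_norm_inner_mul_norm_inner_le he (hv m) x y
  have hsummable (m : κ) : Summable fun i => ‖g (m, i)‖ :=
    ((hrow m).1.mul_left (b m)).of_nonneg_of_le (fun _ => norm_nonneg _) (hnorm m)
  obtain ⟨hg, hg_le⟩ := summable_prod_of_tsum_norm_le (f := g) hsummable
    (fun m => ((hsummable m).tsum_le_tsum (hnorm m) ((hrow m).1.mul_left (b m))).trans
      (tsum_mul_left.trans_le (mul_le_mul_of_nonneg_left (hrow m).2 (hb₀ m))))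
    (hb.mul_right _)
  have hcol (i : ι) : HasSum (fun m => g (m, i)) (inner 𝕜 (e i) x * inner 𝕜 y (f i)) := by
    simpa only [map_smul, innerSL_apply_apply, smul_eq_mul] using
      ((innerSL 𝕜 y).hasSum (hfv i)).mul_left (inner 𝕜 (e i) x : 𝕜)
  have hsum : HasSum (fun i => (inner 𝕜 (e i) x * inner 𝕜 y (f i) : 𝕜)) (∑' p, g p) :=
    ((Equiv.prodComm ι κ).hasSum_iff.2 hg.hasSum).prod_fiberwise hcol
  rw [innerSL_apply_apply, norm_inner_symm, (hasSum_inner_sumRankOne_apply hf x y).unique hsum,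
    mul_assoc, ← tsum_mul_right]
  exact hg_le

end RankOne

section CharValue

variable {K : Type*} [NormedAddCommGroup K] [InnerProductSpace ℂ K]

lemma charValue_nonneg (T : K →L[ℂ] K) (k : ℕ) : 0 ≤ charValue T k :=
  Real.iInf_nonneg fun F => norm_nonneg (T ∘L (F.1ᗮ).subtypeL)

lemma charValue_card_le {ι : Type*} {e : ι → K} (he : LinearIndependent ℂ e) {T : K →L[ℂ] K}
    {s : Finset ι} {C : ℝ} (hC : 0 ≤ C)
    (hT : ∀ x, (∀ i ∈ s, (inner ℂ (e i) x : ℂ) = 0) → ‖T x‖ ≤ C * ‖x‖) :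
    charValue T s.card ≤ C := by
  classical
  let F : Submodule ℂ K := Submodule.span ℂ (s.image e : Set K)
  have hfin : FiniteDimensional ℂ F := FiniteDimensional.span_finset ℂ _
  have hrank : Module.finrank ℂ F = s.card := by
    rw [← Finset.card_image_of_injective s he.injective]
    refine finrank_span_finset_eq_card ?_
    rw [Finset.coe_image]
    exact (he.linearIndepOn _).id_image
  refine (ciInf_le ⟨0, ?_⟩ ⟨F, hfin, hrank⟩).trans ?_
  · rintro _ ⟨G, rfl⟩
    exact norm_nonneg (T ∘L (G.1ᗮ).subtypeL)
  · refine ContinuousLinearMap.opNorm_le_bound _ hC fun x => hT x fun i hi => ?_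
    exact (Submodule.mem_orthogonal _ _).1 x.2 _
      (Submodule.subset_span (by simpa using ⟨i, hi, rfl⟩))

end CharValue

/-! ### The orthonormal basis of `ℋ_θ` -/

section Hilbert

variable {θ : Matrix (Fin n) (Fin n) ℝ}

lemma inner_toPreH (u v : A θ) :
    (inner ℂ (toPreH θ v : H θ) (toPreH θ u : H θ) : ℂ) = τ ((u : B n) * star (v : B n)) :=
  UniformSpace.Completion.inner_coe _ _

lemma norm_toPreH_le (u : A θ) : ‖(toPreH θ u : H θ)‖ ≤ ‖(u : B n)‖ := by
  refine le_of_sq_le_sq ?_ (norm_nonneg _)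
  calc ‖(toPreH θ u : H θ)‖ ^ 2 = ‖τ ((u : B n) * star (u : B n))‖ := by
        rw [← inner_toPreH, inner_self_eq_norm_sq_to_K, norm_pow, RCLike.norm_ofReal, abs_norm]
    _ ≤ ‖(u : B n) * star (u : B n)‖ := norm_τ_le _
    _ ≤ ‖(u : B n)‖ * ‖star (u : B n)‖ := norm_mul_le _ _
    _ = ‖(u : B n)‖ ^ 2 := by
        rw [ContinuousLinearMap.star_eq_adjoint, LinearIsometryEquiv.norm_map, sq]

/-- The inclusion of `A_θ`, with its operator norm, into `ℋ_θ`. -/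
def inclH (θ : Matrix (Fin n) (Fin n) ℝ) : A θ →L[ℂ] H θ :=
  LinearMap.mkContinuous
    { toFun := fun u => (toPreH θ u : H θ)
      map_add' := fun _ _ => UniformSpace.Completion.coe_add _ _
      map_smul' := fun c _ => UniformSpace.Completion.coe_smul c _ } 1 fun u => by
    rw [one_mul]
    exact norm_toPreH_le u

lemma norm_toH_le (u : SA θ) : ‖toH u‖ ≤ ‖(u : B n)‖ := norm_toPreH_le _

lemma toH_smul (c : ℂ) (u : SA θ) : toH (c • u) = c • toH u :=
  (inclH θ).map_smul c ⟨u, u.2.1⟩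

lemma hasSum_toH {ι : Type*} {v : ι → SA θ} {u : SA θ} (h : HasSum (fun i => (v i : B n)) u) :
    HasSum (fun i => toH (v i)) (toH u) := by
  refine (inclH θ).hasSum (f := fun i => (⟨v i, (v i).2.1⟩ : A θ)) (x := ⟨u, u.2.1⟩) ?_
  exact (Topology.IsInducing.subtypeVal.hasSum_iff (g := (A θ).subtype) _ _).1 h

lemma denseRange_inclH : DenseRange (inclH θ) :=
  UniformSpace.Completion.denseRange_coe.comp (toPreH θ).surjective.denseRange
    (UniformSpace.Completion.continuous_coe _)

/-- The Weyl unitary `W_k` as an element of `𝒜_θ`, to which operators on `𝒜_θ` apply. -/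
def smoothW (θ : Matrix (Fin n) (Fin n) ℝ) (k : Fin n → ℤ) : SA θ := ⟨W θ k, W_mem_SA k⟩

lemma inner_toH_smoothW (k : Fin n → ℤ) (u : SA θ) :
    (inner ℂ (toH (smoothW θ k)) (toH u) : ℂ) = coef θ k (u : B n) :=
  inner_toPreH _ _

lemma orthonormal_toH_smoothW : Orthonormal ℂ fun k => toH (smoothW θ k) := by
  rw [orthonormal_iff_ite]
  intro k l
  rw [inner_toH_smoothW, smoothW, coef_W]
  simp only [eq_comm]

lemma span_toH_smoothW_topologicalClosure :
    (Submodule.span ℂ (Set.range fun k => toH (smoothW θ k))).topologicalClosure = ⊤ := by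
  set M := (Submodule.span ℂ (Set.range fun k => toH (smoothW θ k))).topologicalClosure
  have hM : IsClosed (M : Set (H θ)) := Submodule.isClosed_topologicalClosure _
  have inclH_mem (u : A θ) : inclH θ u ∈ M := by
    let N : Submodule ℂ (B n) :=
      (M.comap (inclH θ).toLinearMap).map (A θ).toSubalgebra.toSubmodule.subtype
    have hN : IsClosed (N : Set (B n)) :=
      isClosed_A.isClosedEmbedding_subtypeVal.isClosedMap _ (hM.preimage (inclH θ).continuous)
    obtain ⟨v, hv, hvu⟩ := mem_of_mem_A hN (fun k => ⟨⟨W θ k, W_mem_A k⟩,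
      Submodule.le_topologicalClosure _ (Submodule.subset_span ⟨k, rfl⟩), rfl⟩) u.2
    rw [← Subtype.ext hvu]
    exact hv
  exact top_le_iff.1 fun x _ =>
    hM.closure_subset_iff.2 (Set.range_subset_iff.2 inclH_mem) (denseRange_inclH x)

/-- The orthonormal basis of `ℋ_θ` formed by the Weyl unitaries. -/
def basisH (θ : Matrix (Fin n) (Fin n) ℝ) : HilbertBasis (Fin n → ℤ) ℂ (H θ) :=
  HilbertBasis.mk orthonormal_toH_smoothW span_toH_smoothW_topologicalClosure.ge

lemma basisH_apply (k : Fin n → ℤ) : basisH θ k = toH (smoothW θ k) := by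
  rw [basisH, HilbertBasis.coe_mk]

lemma inner_basisH_toH (k : Fin n → ℤ) (u : SA θ) :
    (inner ℂ (basisH θ k) (toH u) : ℂ) = coef θ k (u : B n) := by
  rw [basisH_apply, inner_toH_smoothW]

lemma Extends.unique {P : SA θ →ₗ[ℂ] SA θ} {S T : H θ →L[ℂ] H θ} (hS : Extends S P)
    (hT : Extends T P) : S = T := by
  refine ContinuousLinearMap.ext_on
    (Submodule.dense_iff_topologicalClosure_eq_top.2 (basisH θ).dense_span) ?_
  rintro _ ⟨k, rfl⟩
  rw [basisH_apply, hS, hT]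

/-! ### The bounded extension and its trace -/

/-- The operator on `ℋ_θ` with the same values as `P` on the Weyl unitaries, written as a sum of
rank-one operators. -/
def extensionH (P : SA θ →ₗ[ℂ] SA θ) : H θ →L[ℂ] H θ :=
  sumRankOne ℂ (basisH θ) fun k => toH (P (smoothW θ k))

variable {q : ℂ} {ρ : E n → B n} {P : SA θ →ₗ[ℂ] SA θ}

lemma IsSymbolOf.apply_smoothW (hP : IsSymbolOf ρ P) (hρ : IsClassicalSymbol θ q ρ)
    (hq : q.re ≤ 0) (k : Fin n → ℤ) : (P (smoothW θ k) : B n) = ρ (latt k) * W θ k := by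
  rw [hP.apply_eq hρ hq, tsum_eq_single k, smoothW, coef_W, if_pos rfl, one_smul]
  intro l hl
  rw [smoothW, coef_W, if_neg hl.symm, zero_smul]

lemma IsSymbolOf.norm_apply_smoothW_le (hP : IsSymbolOf ρ P) (hρ : IsClassicalSymbol θ q ρ)
    (hq : q.re ≤ 0) (k : Fin n → ℤ) : ‖(P (smoothW θ k) : B n)‖ ≤ ‖ρ (latt k)‖ := by
  rw [hP.apply_smoothW hρ hq]
  exact (norm_mul_le _ _).trans (mul_le_of_le_one_right (norm_nonneg _) (norm_W_le θ k))

lemma IsSymbolOf.hasSum_apply (hP : IsSymbolOf ρ P) (hρ : IsClassicalSymbol θ q ρ)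
    (hq : q.re ≤ 0) (u : SA θ) :
    HasSum (fun k => coef θ k (u : B n) • (P (smoothW θ k) : B n)) (P u) := by
  obtain ⟨C, hC⟩ := hρ.symbolBound_self.exists_norm_iteratedFDeriv_le hq 0
  simp only [norm_iteratedFDeriv_zero] at hC
  have hsum : Summable fun k => coef θ k (u : B n) • (P (smoothW θ k) : B n) := by
    refine ((summable_norm_coef u.2).mul_right C).of_norm_bounded fun k => ?_
    rw [norm_smul]
    gcongr
    exact (hP.norm_apply_smoothW_le hρ hq k).trans (hC _)
  convert hsum.hasSum using 1
  simp only [hP.apply_smoothW hρ hq, hP.apply_eq hρ hq u]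

lemma IsSymbolOf.summable_norm_toH (hP : IsSymbolOf ρ P) (hρ : IsClassicalSymbol θ q ρ)
    (hq : q.re < -n) : Summable fun k => ‖toH (P (smoothW θ k))‖ * ‖basisH θ k‖ := by
  simp only [(basisH θ).orthonormal.1, mul_one]
  exact (hρ.symbolBound_self.summable hq).of_nonneg_of_le (fun _ => norm_nonneg _) fun k =>
    (norm_toH_le _).trans (hP.norm_apply_smoothW_le hρ (hq.le.trans (by simp)) k)

lemma IsSymbolOf.extends_extensionH (hP : IsSymbolOf ρ P) (hρ : IsClassicalSymbol θ q ρ)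
    (hq : q.re < -n) : Extends (extensionH P) P := by
  intro u
  have hleft := hasSum_sumRankOne_apply (𝕜 := ℂ) (hP.summable_norm_toH hρ hq) (toH u)
  simp only [inner_basisH_toH, ← toH_smul] at hleft
  exact hleft.unique (hasSum_toH (v := fun k => coef θ k (u : B n) • P (smoothW θ k))
    (hP.hasSum_apply hρ (hq.le.trans (by simp)) u))

lemma IsSymbolOf.hasSum_smul_basisH (hP : IsSymbolOf ρ P) (hρ : IsClassicalSymbol θ q ρ)
    (hq : q.re ≤ 0) (l : Fin n → ℤ) :
    HasSum (fun m => (coef θ m (ρ (latt l)) * cocycle θ m l) • basisH θ (m + l))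
      (toH (P (smoothW θ l))) := by
  simp only [basisH_apply, ← toH_smul]
  refine hasSum_toH ?_
  rw [hP.apply_smoothW hρ hq]
  have h := (hasSum_coef (hρ.mem_SA (latt l))).mul_right (W θ l)
  simp only [smul_mul_assoc, W_mul, smul_smul] at h
  exact h

lemma IsClassicalSymbol.exists_norm_coef_le (hρ : IsClassicalSymbol θ q ρ) (N : ℕ) :
    ∃ C : ℝ, 0 ≤ C ∧ ∀ ξ m, ‖coef θ m (ρ ξ)‖ ≤
      C * (1 + ‖ξ‖) ^ q.re * (1 + ‖latt m‖) ^ (-(N : ℝ)) := by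
  obtain ⟨C₀, hC₀, hC⟩ := hρ.symbolBound_self.norm_le
  choose D hD₀ hD using fun j : Fin n => (hρ.symbolBound (Pi.single j N)).norm_le
  have hD_sum : 0 ≤ ∑ j, D j := Finset.sum_nonneg fun j _ => hD₀ j
  refine ⟨((n : ℝ) + 1) ^ N * (C₀ + ∑ j, D j), by positivity, fun ξ m => ?_⟩
  refine (norm_coef_le_of_mem_SA N (hρ.mem_SA ξ) m).trans ?_
  rw [mul_assoc _ (C₀ + _), add_mul, Finset.sum_mul]
  gcongr with j
  · exact hC ξ
  · exact hD j ξ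

lemma IsSymbolOf.exists_norm_extensionH_apply_le (hP : IsSymbolOf ρ P)
    (hρ : IsClassicalSymbol θ q ρ) (hq : q.re < -n) :
    ∃ C : ℝ, 0 ≤ C ∧ ∀ r : ℝ, 0 < r → ∀ x : H θ,
      (∀ l, (inner ℂ (basisH θ l) x : ℂ) ≠ 0 → r ≤ 1 + ‖latt l‖) →
        ‖extensionH P x‖ ≤ C * r ^ q.re * ‖x‖ := by
  have hq₀ : q.re ≤ 0 := hq.le.trans (by simp)
  obtain ⟨C, hC₀, hC⟩ := hρ.exists_norm_coef_le (n + 1)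
  let S : ℝ := ∑' m : Fin n → ℤ, (1 + ‖latt m‖) ^ (-((n + 1 : ℕ) : ℝ))
  refine ⟨C * S, mul_nonneg hC₀ (tsum_nonneg fun m => by positivity), fun r hr x hx => ?_⟩
  rw [mul_right_comm C, ← tsum_mul_left]
  refine norm_sumRankOne_apply_le (hP.summable_norm_toH hρ hq) (basisH θ).orthonormal
    (v := fun m l => basisH θ (m + l))
    (fun m => (basisH θ).orthonormal.comp _ (add_right_injective m))
    (fun m => by positivity) (summable_one_add_norm_latt_rpow_succ.mul_left _)
    (hP.hasSum_smul_basisH hρ hq₀) fun m l hl => ?_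
  rw [norm_mul, norm_cocycle, mul_one]
  refine (hC (latt l) m).trans ?_
  gcongr ?_ * ?_ * ?_
  exact Real.rpow_le_rpow_of_nonpos hr (hx l hl) hq₀

lemma IsSymbolOf.exists_charValue_extensionH_le (hn : n ≠ 0) (hP : IsSymbolOf ρ P)
    (hρ : IsClassicalSymbol θ q ρ) (hq : q.re < -n) :
    ∃ C : ℝ, ∀ k ≠ 0, charValue (extensionH P) k ≤ C * (k : ℝ) ^ (q.re / n) := by
  obtain ⟨C, hC₀, hC⟩ := hP.exists_norm_extensionH_apply_le hρ hq
  refine ⟨C * 2 ^ (-q.re), fun k hk => ?_⟩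
  obtain ⟨s, rfl, hs⟩ := exists_finset_card_eq_le_norm_latt hn hk
  have hr : 0 < ((s.card : ℝ) ^ (n : ℝ)⁻¹ / 2) := by
    have : (0 : ℝ) < s.card := by exact_mod_cast Nat.pos_of_ne_zero hk
    positivity
  have hrpow : ((s.card : ℝ) ^ (n : ℝ)⁻¹ / 2) ^ q.re =
      2 ^ (-q.re) * (s.card : ℝ) ^ (q.re / n) := by
    rw [Real.div_rpow (by positivity) (by positivity), ← Real.rpow_mul (by positivity),
      Real.rpow_neg (by positivity), div_eq_inv_mul, inv_mul_eq_div (n : ℝ)]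
  rw [mul_assoc, ← hrpow]
  refine charValue_card_le (basisH θ).orthonormal.linearIndependent (by positivity)
    fun x hx => hC _ hr x fun l hl => hs l fun hls => hl (hx l hls)

lemma IsSymbolOf.isTraceClass_extensionH (hn : n ≠ 0) (hP : IsSymbolOf ρ P)
    (hρ : IsClassicalSymbol θ q ρ) (hq : q.re < -n) : IsTraceClass (extensionH P) := by
  refine ⟨isCompactOperator_sumRankOne (hP.summable_norm_toH hρ hq), ?_⟩
  obtain ⟨C, hC⟩ := hP.exists_charValue_extensionH_le hn hρ hq
  have hexponent : q.re / n < -1 := by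
    rw [div_lt_iff₀ (by exact_mod_cast Nat.pos_of_ne_zero hn)]
    linarith
  have hsum := (Real.summable_nat_rpow.2 hexponent).mul_left C
  rw [← summable_nat_add_iff 1] at hsum ⊢
  exact hsum.of_nonneg_of_le (fun k => charValue_nonneg _ _) fun k => hC (k + 1) k.succ_ne_zero

lemma IsNormalized.integrable_τ (hρ : IsNormalized ρ) : Integrable fun ξ => τ (ρ ξ) :=
  (τL n).integrable_comp hρ.1

lemma IsNormalized.tsum_τ (hρ : IsNormalized ρ) :
    ∑' k : Fin n → ℤ, τ (ρ (latt k)) = ∫ ξ, τ (ρ ξ) :=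
  ((τL n).hasSum hρ.2).tsum_eq.trans ((τL n).integral_comp_comm hρ.1).symm

lemma IsSymbolOf.inner_basisH_apply (hP : IsSymbolOf ρ P) (hρ : IsClassicalSymbol θ q ρ)
    (hq : q.re ≤ 0) (k : Fin n → ℤ) :
    (inner ℂ (basisH θ k) (toH (P (smoothW θ k))) : ℂ) = τ (ρ (latt k)) := by
  rw [inner_basisH_toH, hP.apply_smoothW hρ hq, coef_apply, mul_assoc, W_mul_star_W, mul_one]

lemma IsSymbolOf.hasTrace_extensionH (hn : n ≠ 0) (hP : IsSymbolOf ρ P)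
    (hρ : IsClassicalSymbol θ q ρ) (hq : q.re < -n) (hN : IsNormalized ρ) :
    HasTrace (extensionH P) (∫ ξ, τ (ρ ξ)) := by
  refine ⟨hP.isTraceClass_extensionH hn hρ hq, fun ι e => ?_⟩
  have htrace := hasSum_trace_sumRankOne (hP.summable_norm_toH hρ hq) e
  simp only [hP.inner_basisH_apply hρ (hq.le.trans (by simp)), hN.tsum_τ] at htrace
  exact htrace

end Hilbert

end NCTorus

end

theorem mainTheorem12_general (n : ℕ) (hn : n ≠ 0) (θ : Matrix (Fin n) (Fin n) ℝ) (q : ℂ)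
    (hq : q.re < -(n : ℝ)) (P : NCTorus.SA θ →ₗ[ℂ] NCTorus.SA θ)
    (hP : P ∈ NCTorus.PsiDO θ q) :
    (∃ φ : 𝓢(NCTorus.E n, ℂ), NCTorus.IsMeyer φ) ∧
    (∀ φ : 𝓢(NCTorus.E n, ℂ), NCTorus.IsMeyer φ →
      ∀ ρ : NCTorus.E n → NCTorus.B n,
        NCTorus.IsClassicalSymbol θ q ρ → NCTorus.IsSymbolOf ρ P →
          (∀ ξ, Summable fun k : Fin n → ℤ =>
            φ (ξ - NCTorus.latt k) • ρ (NCTorus.latt k)) ∧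
          NCTorus.IsClassicalSymbol θ q (NCTorus.interpolate φ ρ) ∧
          NCTorus.IsSymbolOf (NCTorus.interpolate φ ρ) P ∧
          NCTorus.IsNormalized (NCTorus.interpolate φ ρ)) ∧
    (∃! T : NCTorus.H θ →L[ℂ] NCTorus.H θ, NCTorus.Extends T P) ∧
    ∀ T : NCTorus.H θ →L[ℂ] NCTorus.H θ, NCTorus.Extends T P →
      NCTorus.IsTraceClass T ∧
      ∀ ρ : NCTorus.E n → NCTorus.B n,
        NCTorus.IsClassicalSymbol θ q ρ → NCTorus.IsSymbolOf ρ P → NCTorus.IsNormalized ρ →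
          Integrable (fun ξ => NCTorus.τ (ρ ξ)) ∧
          NCTorus.HasTrace T (∫ ξ, NCTorus.τ (ρ ξ)) := by
  obtain ⟨ρ₀, hρ₀, hP₀⟩ := hP
  have hext := hP₀.extends_extensionH hρ₀ hq
  refine ⟨NCTorus.exists_isMeyer n, fun φ hφ ρ hρ hρP => ⟨fun ξ => ?_, ?_, ?_, ?_⟩,
    ⟨_, hext, fun T hT => hT.unique hext⟩, fun T hT => ?_⟩
  · exact NCTorus.summable_schwartz_sub_smul φ NCTorus.latt
      (hρ.symbolBound_self.summable hq) ξ
  · exact NCTorus.isClassicalSymbol_interpolate hq hρ hφ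
  · exact NCTorus.isSymbolOf_interpolate hq hφ hρ hρP
  · exact NCTorus.isNormalized_interpolate hq hρ hφ
  · obtain rfl := hT.unique hext
    exact ⟨hP₀.isTraceClass_extensionH hn hρ₀ hq, fun ρ hρ hρP hN =>
      ⟨hN.integrable_τ, hρP.hasTrace_extensionH hn hρ hq hN⟩⟩

theorem mainTheorem12 (n : ℕ) (hn : 2 ≤ n) (θ : Matrix (Fin n) (Fin n) ℝ) (hθ : θᵀ = -θ)
    (q : ℂ) (hq : q.re < -(n : ℝ)) (P : NCTorus.SA θ →ₗ[ℂ] NCTorus.SA θ)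
    (hP : P ∈ NCTorus.PsiDO θ q) :
    -- Meyer-type functions exist
    (∃ φ : 𝓢(NCTorus.E n, ℂ), NCTorus.IsMeyer φ) ∧
    -- interpolating any symbol of `P` gives a normalized classical symbol of `P`
    (∀ φ : 𝓢(NCTorus.E n, ℂ), NCTorus.IsMeyer φ →
      ∀ ρ : NCTorus.E n → NCTorus.B n,
        NCTorus.IsClassicalSymbol θ q ρ → NCTorus.IsSymbolOf ρ P →
          (∀ ξ, Summable fun k : Fin n → ℤ =>
            φ (ξ - NCTorus.latt k) • ρ (NCTorus.latt k)) ∧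
          NCTorus.IsClassicalSymbol θ q (NCTorus.interpolate φ ρ) ∧
          NCTorus.IsSymbolOf (NCTorus.interpolate φ ρ) P ∧
          NCTorus.IsNormalized (NCTorus.interpolate φ ρ)) ∧
    -- `P` extends uniquely to a bounded operator on `ℋ_θ`, which is trace-class, and the trace
    -- formula holds for every normalized symbol
    (∃! T : NCTorus.H θ →L[ℂ] NCTorus.H θ, NCTorus.Extends T P) ∧
    ∀ T : NCTorus.H θ →L[ℂ] NCTorus.H θ, NCTorus.Extends T P →
      NCTorus.IsTraceClass T ∧
      ∀ ρ : NCTorus.E n → NCTorus.B n,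
        NCTorus.IsClassicalSymbol θ q ρ → NCTorus.IsSymbolOf ρ P → NCTorus.IsNormalized ρ →
          Integrable (fun ξ => NCTorus.τ (ρ ξ)) ∧
          NCTorus.HasTrace T (∫ ξ, NCTorus.τ (ρ ξ)) :=
  mainTheorem12_general n (by lia) θ q hq P hP
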